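/- Let $n\in\mathbb{N}$, write $\langle y\rangle=(1+|y|^2)^{1/2}$, and let $\mathcal S(\mathbb{R}^n)$ be the Schwartz space of complex-valued functions. For $\sigma\in\mathbb{R}^n$ and $\omega,m,q\in\mathbb{R}$, let $\mathbb{S}^{m,q}_{\sigma,\omega}$ be the set of complex-valued functions $a\in C^\infty(\mathbb{R}^n\times\mathbb{R}^n)$ such that for all multi-indices $\alpha,\beta\in\mathbb{N}_0^n$ there is a constant $C>0$ with $$|\partial_x^\alpha\partial_\xi^\beta a(x,\xi)|\le C\,\langle\sigma\cdot x+\omega\rangle^{q-|\alpha|}\,\langle\xi\rangle^{m-|\beta|}\qquad\text{for all }x,\xi\in\mathbb{R}^n,$$ and let $\Psi_a$ be the pseudo-differential operator with symbol $a$, $$\Psi_af(x)=\int_{\mathbb{R}^n}a(x,\xi)\,\widehat f(\xi)\,e^{2\pi i x\cdot\xi}\,d\xi,\qquad \widehat f(\xi)=\int_{\mathbb{R}^n}f(y)\,e^{-2\pi i y\cdot\xi}\,dy,\qquad f\in\mathcal S(\mathbb{R}^n).$$ **Proposition.** Let $\sigma\in\mathbb{R}^n$ and $m_1,m_2,\omega,q_1,q_2\in\mathbb{R}$,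 and let $a\in\mathbb{S}^{m_1,q_1}_{\sigma,\omega}$ and $b\in\mathbb{S}^{m_2,q_2}_{\sigma,\omega}$. Then $\Psi_a$ and $\Psi_b$ map $\mathcal S(\mathbb{R}^n)$ into itself, and there exists $c\in\mathbb{S}^{m_1+m_2-1,\,q_1+q_2-1}_{\sigma,\omega}$ such that, on $\mathcal S(\mathbb{R}^n)$, $$[\Psi_a,\Psi_b]=\Psi_a\Psi_b-\Psi_b\Psi_a=\Psi_c .$$ Moreover, this $c$ has the asymptotic expansion $$c\approx\sum_{|\beta|>0}\frac{1}{(2\pi i)^{|\beta|}\beta!}\Big((\partial_\xi^\beta a)(\partial_x^\beta b)-(\partial_\xi^\beta b)(\partial_x^\beta a)\Big),$$ in the sense that, for every integer $N\ge2$, $$c-\sum_{0<|\beta|<N}\frac{1}{(2\pi i)^{|\beta|}\beta!}\Big((\partial_\xi^\beta a)(\partial_x^\beta b)-(\partial_\xi^\beta b)(\partial_x^\beta a)\Big)\in\mathbb{S}^{m_1+m_2-N,\,q_1+q_2-N}_{\sigma,\omega}.$$ -/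

import Mathlib

open scoped FourierTransform SchwartzMap

/-- The Japanese bracket `⟨x⟩ = (1 + |x|²)^{1/2}` (used for `x ∈ ℝⁿ` and for `x ∈ ℝ`). -/
noncomputable def bracket {E : Type*} [NormedAddCommGroup E] (x : E) : ℝ :=
  Real.sqrt (1 + ‖x‖ ^ 2)

/-- The partial derivative `∂_{x_j} a` of a function `a(x, ξ)` on `ℝⁿ × ℝⁿ`. -/
noncomputable def partialX {n : ℕ} (j : Fin n)
    (a : EuclideanSpace ℝ (Fin n) × EuclideanSpace ℝ (Fin n) → ℂ) :
    EuclideanSpace ℝ (Fin n) × EuclideanSpace ℝ (Fin n) → ℂ :=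
  fun z => fderiv ℝ a z (EuclideanSpace.single j 1, 0)

/-- The partial derivative `∂_{ξ_j} a` of a function `a(x, ξ)` on `ℝⁿ × ℝⁿ`. -/
noncomputable def partialXi {n : ℕ} (j : Fin n)
    (a : EuclideanSpace ℝ (Fin n) × EuclideanSpace ℝ (Fin n) → ℂ) :
    EuclideanSpace ℝ (Fin n) × EuclideanSpace ℝ (Fin n) → ℂ :=
  fun z => fderiv ℝ a z (0, EuclideanSpace.single j 1)

/-- `∂_x^α a = ∂_{x_1}^{α_1} ⋯ ∂_{x_n}^{α_n} a` for a multi-index `α`. -/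
noncomputable def derivX {n : ℕ} (α : Fin n → ℕ)
    (a : EuclideanSpace ℝ (Fin n) × EuclideanSpace ℝ (Fin n) → ℂ) :
    EuclideanSpace ℝ (Fin n) × EuclideanSpace ℝ (Fin n) → ℂ :=
  (List.finRange n).foldr (fun j g => (partialX j)^[α j] g) a

/-- `∂_ξ^β a = ∂_{ξ_1}^{β_1} ⋯ ∂_{ξ_n}^{β_n} a` for a multi-index `β`. -/
noncomputable def derivXi {n : ℕ} (β : Fin n → ℕ)
    (a : EuclideanSpace ℝ (Fin n) × EuclideanSpace ℝ (Fin n) → ℂ) :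
    EuclideanSpace ℝ (Fin n) × EuclideanSpace ℝ (Fin n) → ℂ :=
  (List.finRange n).foldr (fun j g => (partialXi j)^[β j] g) a

/-- The length `|β| = β_1 + ⋯ + β_n` of a multi-index. -/
def multiLength {n : ℕ} (β : Fin n → ℕ) : ℕ := ∑ i, β i

/-- The factorial `β! = β_1! ⋯ β_n!` of a multi-index. -/
def multiFactorial {n : ℕ} (β : Fin n → ℕ) : ℕ := ∏ i, (β i).factorial

/-- The finite set of multi-indices `β ∈ ℕ₀ⁿ` with `0 < |β| < N`. -/
def multiIndicesBelow (n N : ℕ) : Finset (Fin n → ℕ) :=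
  (Fintype.piFinset fun _ => Finset.range N).filter
    fun β => 0 < multiLength β ∧ multiLength β < N

theorem mem_multiIndicesBelow {n N : ℕ} {β : Fin n → ℕ} :
    β ∈ multiIndicesBelow n N ↔ 0 < multiLength β ∧ multiLength β < N := by
  simp only [multiIndicesBelow, Finset.mem_filter, Fintype.mem_piFinset, Finset.mem_range,
    and_iff_right_iff_imp]
  rintro ⟨-, h⟩ i
  exact (Finset.single_le_sum (fun j _ => Nat.zero_le (β j)) (Finset.mem_univ i)).trans_lt h

/-- The symbol class `𝕊^{m,q}_{σ,ω}(ℝⁿ × ℝⁿ)`: smooth functions `a(x, ξ)` such that for all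
multi-indices `α, β` there is `C > 0` with
`|∂_x^α ∂_ξ^β a(x, ξ)| ≤ C ⟨σ·x + ω⟩^{q - |α|} ⟨ξ⟩^{m - |β|}` for all `x, ξ`. -/
def symbolClass {n : ℕ} (σ : EuclideanSpace ℝ (Fin n)) (ω m q : ℝ) :
    Set (EuclideanSpace ℝ (Fin n) × EuclideanSpace ℝ (Fin n) → ℂ) :=
  {a | ContDiff ℝ (⊤ : ℕ∞) a ∧ ∀ α β : Fin n → ℕ, ∃ C : ℝ, 0 < C ∧
    ∀ x ξ : EuclideanSpace ℝ (Fin n),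
      ‖derivX α (derivXi β a) (x, ξ)‖ ≤
        C * bracket (inner ℝ σ x + ω) ^ (q - (multiLength α : ℝ)) *
          bracket ξ ^ (m - (multiLength β : ℝ))}

/-- The pseudo-differential operator with symbol `a`,
`Ψ_a f(x) = ∫ a(x, ξ) f̂(ξ) e^{2πi x·ξ} dξ`, where `f̂(ξ) = ∫ f(y) e^{-2πi y·ξ} dy`. -/
noncomputable def psiDO {n : ℕ} (a : EuclideanSpace ℝ (Fin n) × EuclideanSpace ℝ (Fin n) → ℂ)
    (f : EuclideanSpace ℝ (Fin n) → ℂ) : EuclideanSpace ℝ (Fin n) → ℂ :=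
  fun x => ∫ ξ : EuclideanSpace ℝ (Fin n),
    a (x, ξ) * 𝓕 f ξ * Complex.exp (2 * Real.pi * Complex.I * (inner ℝ x ξ : ℝ))

/-- The term of index `β` in the expansion of the symbol of `[Ψ_a, Ψ_b]`:
`((∂_ξ^β a)(∂_x^β b) - (∂_ξ^β b)(∂_x^β a)) / ((2πi)^{|β|} β!)`. -/
noncomputable def commutatorTerm {n : ℕ}
    (a b : EuclideanSpace ℝ (Fin n) × EuclideanSpace ℝ (Fin n) → ℂ) (β : Fin n → ℕ) :
    EuclideanSpace ℝ (Fin n) × EuclideanSpace ℝ (Fin n) → ℂ :=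
  fun z => 1 / ((2 * Real.pi * Complex.I) ^ multiLength β * (multiFactorial β : ℂ)) *
    (derivXi β a z * derivX β b z - derivXi β b z * derivX β a z)

/-!
Formally `Ψ_a Ψ_b = Ψ_c` with `c = symbolComp 1 a b`, where

  `symbolComp t a b (x, ξ) = ∫∫ a(x, ξ + tη) b(x + y, ξ) e^{-2πi y·η} dη dy`.

The parameter `t` interpolates between the product `a b` at `t = 0` and the composed symbol at
`t = 1`, and integration by parts in `y` gives

  `d/dt symbolComp t a b = ∑ j, symbolComp t (∂_{ξ_j} a) (D_{x_j} b)`,  `D_{x_j} = (2πi)⁻¹ ∂_{x_j}`.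

Each `t`-derivative thus lowers the orders in `ξ` and in `σ·x + ω` by one, and the asymptotic
expansion is the Taylor expansion at `t = 0`: the Taylor remainder of order `N`, `compRemainder N`,
is bounded by induction on `N` with the mean value inequality (`compRemainder_bound`). The only
analytic input for it is the bound of `symbolComp` by the product of the two weights, uniformly for
bounded `t` (`symbolComp_bound`). Since `symbolComp`, the Taylor coefficients and the remainder are
bilinear and obey the Leibniz rule in `x` and `ξ`, zeroth order bounds for all pairs of symbols
already give the full symbol estimates (`mem_symbolClass_of_leibniz`). The Taylor coefficients are
the multinomial sums in the statement (`bidiffPow_eq_sum`).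

The double integral does not converge absolutely. It is regularized by trading `⟨η⟩^{-2M}` for
`(1 - Δ_x / 4π²)^M` acting on `b` (`regComp`, `weightedComp_besselX`). Once the weight makes the
`η`-integral converge, the inner integral is a kernel that decays rapidly in `y`
(`fiberKernel_decay`), and this decay absorbs the slow variation of `⟨σ·x + ω⟩` under translations
by `y`.

The identity `Ψ_a Ψ_b = Ψ_{symbolComp 1 a b}` (`psiDO_psiDO`) is Fubini's theorem when `a` has very
negative order. Since `Ψ_{ξ_j a} = Ψ_a D_j` has its counterpart for `symbolComp`
(`symbolComp_coordXi_mul`), the identity `a = ⟨ξ⟩⁻² a + ∑ ξ_j² ⟨ξ⟩⁻² a` raises the order by two, and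
induction covers all orders. That `symbolComp 0 a b = a b` follows from the case `a = 1`, which is
Fourier inversion together with the injectivity of the map from symbols to operators
(`symbolComp_zero`). In the commutator the two terms of order zero cancel.
-/

open MeasureTheory

/-! ### The Japanese bracket -/

section Bracket

variable {E : Type*} [NormedAddCommGroup E]

theorem one_le_bracket (x : E) : 1 ≤ bracket x := by
  rw [bracket, Real.one_le_sqrt]
  nlinarith [sq_nonneg ‖x‖]

theorem bracket_pos (x : E) : 0 < bracket x := zero_lt_one.trans_le (one_le_bracket x)

theorem bracket_sq (x : E) : bracket x ^ 2 = 1 + ‖x‖ ^ 2 :=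
  Real.sq_sqrt (by positivity)

theorem norm_le_bracket (x : E) : ‖x‖ ≤ bracket x :=
  Real.le_sqrt_of_sq_le (by linarith)

theorem bracket_le_one_add_norm (x : E) : bracket x ≤ 1 + ‖x‖ :=
  Real.sqrt_le_iff.mpr ⟨by positivity, by nlinarith [norm_nonneg x]⟩

theorem bracket_le_of_norm_le {F : Type*} [NormedAddCommGroup F] {x : E} {y : F} {r : ℝ}
    (hr : 1 ≤ r) (h : ‖x‖ ≤ r * ‖y‖) : bracket x ≤ r * bracket y := by
  refine Real.sqrt_le_iff.mpr ⟨by have := bracket_pos y; positivity, ?_⟩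
  rw [mul_pow, bracket_sq]
  have : ‖x‖ ^ 2 ≤ (r * ‖y‖) ^ 2 := pow_le_pow_left₀ (norm_nonneg x) h 2
  nlinarith [sq_nonneg ‖y‖]

theorem bracket_rpow_pos (x : E) (s : ℝ) : 0 < bracket x ^ s :=
  Real.rpow_pos_of_pos (bracket_pos x) s

theorem bracket_rpow_mono (x : E) {s t : ℝ} (h : s ≤ t) : bracket x ^ s ≤ bracket x ^ t :=
  Real.rpow_le_rpow_of_exponent_le (one_le_bracket x) h

theorem bracket_rpow_add (x : E) (s t : ℝ) : bracket x ^ (s + t) = bracket x ^ s * bracket x ^ t :=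
  Real.rpow_add (bracket_pos x) s t

@[fun_prop]
theorem continuous_bracket : Continuous (bracket : E → ℝ) := by
  unfold bracket; fun_prop

@[fun_prop]
theorem continuous_bracket_rpow (s : ℝ) : Continuous fun x : E => bracket x ^ s :=
  continuous_bracket.rpow_const fun x => Or.inl (bracket_pos x).ne'

theorem bracket_neg (x : E) : bracket (-x) = bracket x := by simp [bracket]

theorem bracket_add_le (x y : E) : bracket (x + y) ≤ 2 * (bracket x * bracket y) := by
  have h1 := bracket_le_one_add_norm (x + y)
  have h2 := norm_add_le x y
  have h3 := norm_le_bracket x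
  have h4 := norm_le_bracket y
  have h5 := one_le_bracket x
  have h6 := one_le_bracket y
  have h7 : bracket (x + y) ≤ bracket x + bracket y := by
    refine Real.sqrt_le_iff.mpr ⟨by linarith, ?_⟩
    have : ‖x + y‖ ^ 2 ≤ (‖x‖ + ‖y‖) ^ 2 := pow_le_pow_left₀ (norm_nonneg _) h2 2
    nlinarith [bracket_sq x, bracket_sq y, mul_le_mul h3 h4 (norm_nonneg y) (by linarith)]
  nlinarith

/-- Peetre's inequality. -/
theorem bracket_add_rpow_le (x y : E) (s : ℝ) :
    bracket (x + y) ^ s ≤ 2 ^ |s| * (bracket x ^ s * bracket y ^ |s|) := by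
  have hx := bracket_pos x
  have hy := bracket_pos y
  have hxy := bracket_pos (x + y)
  rcases le_or_gt 0 s with h | h
  · rw [abs_of_nonneg h, ← Real.mul_rpow hx.le hy.le, ← Real.mul_rpow (by norm_num) (by positivity)]
    exact Real.rpow_le_rpow hxy.le (bracket_add_le x y) h
  · have h1 : bracket x ≤ 2 * (bracket (x + y) * bracket y) := by
      have := bracket_add_le (x + y) (-y)
      rwa [add_neg_cancel_right, bracket_neg] at this
    have h2 := Real.rpow_le_rpow hx.le h1 (abs_nonneg s)
    rw [Real.mul_rpow (by norm_num) (by positivity), Real.mul_rpow hxy.le hy.le] at h2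
    have h3 : ∀ z : E, bracket z ^ s = (bracket z ^ |s|)⁻¹ := fun z => by
      rw [← Real.rpow_neg (bracket_pos z).le, abs_of_neg h, neg_neg]
    rw [h3, h3 x]
    have hp := bracket_rpow_pos x |s|
    have hq := bracket_rpow_pos (x + y) |s|
    rw [inv_le_iff_one_le_mul₀ hq]
    field_simp
    linarith

theorem bracket_rpow_le_of_le {F : Type*} [NormedAddCommGroup F] {x : E} {y : F} {r : ℝ}
    (hr : 0 ≤ r) (h : bracket x ≤ r * bracket y) (s : ℝ) (hs : 0 ≤ s) :
    bracket x ^ s ≤ r ^ s * bracket y ^ s := by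
  rw [← Real.mul_rpow hr (bracket_pos y).le]
  exact Real.rpow_le_rpow (bracket_pos x).le h hs

theorem integrable_bracket_rpow [NormedSpace ℝ E] [FiniteDimensional ℝ E] [MeasurableSpace E]
    [BorelSpace E] (μ : Measure E) [μ.IsAddHaarMeasure] {r : ℝ}
    (h : r < -(Module.finrank ℝ E : ℝ)) : Integrable (fun x : E => bracket x ^ r) μ := by
  have := integrable_rpow_neg_one_add_norm_sq (E := E) (μ := μ) (r := -r) (by linarith)
  refine this.congr (Filter.Eventually.of_forall fun x => ?_)
  simp only [bracket, Real.sqrt_eq_rpow, neg_neg]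
  rw [← Real.rpow_mul (by positivity)]
  congr 1; ring

end Bracket

/-! ### The slab weight -/

section Slab

variable {n : ℕ} (σ : EuclideanSpace ℝ (Fin n)) (ω : ℝ)

/-- The weight `⟨σ·x + ω⟩` varies slowly: translating `x` by `y` costs at most a power of `⟨y⟩`. -/
theorem exists_bracket_inner_add_rpow_le (q : ℝ) : ∃ C : ℝ, 0 < C ∧
    ∀ x y : EuclideanSpace ℝ (Fin n), bracket (inner ℝ σ (x + y) + ω) ^ q ≤
      C * (bracket (inner ℝ σ x + ω) ^ q * bracket y ^ |q|) := by
  refine ⟨2 ^ |q| * (1 + ‖σ‖) ^ |q|, by positivity, fun x y => ?_⟩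
  have h1 := bracket_add_rpow_le (inner ℝ σ x + ω) (inner ℝ σ y) q
  have h2 : bracket (inner ℝ σ y) ≤ (1 + ‖σ‖) * bracket y := by
    refine bracket_le_of_norm_le (by linarith [norm_nonneg σ]) ?_
    have := norm_inner_le_norm (𝕜 := ℝ) σ y
    nlinarith [norm_nonneg y]
  have h3 := bracket_rpow_le_of_le (by positivity) h2 |q| (abs_nonneg q)
  have h4 := bracket_rpow_pos (inner ℝ σ x + ω) q
  rw [inner_add_right, show inner ℝ σ x + inner ℝ σ y + ω = inner ℝ σ x + ω + inner ℝ σ y by ring]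
  calc _ ≤ _ := h1
    _ ≤ 2 ^ |q| * (bracket (inner ℝ σ x + ω) ^ q * ((1 + ‖σ‖) ^ |q| * bracket y ^ |q|)) := by gcongr
    _ = _ := by ring

theorem exists_bracket_inner_rpow_le (q : ℝ) : ∃ C : ℝ, 0 < C ∧
    ∀ x : EuclideanSpace ℝ (Fin n), bracket (inner ℝ σ x + ω) ^ q ≤ C * bracket x ^ |q| := by
  obtain ⟨C, hC, h⟩ := exists_bracket_inner_add_rpow_le σ ω q
  refine ⟨C * bracket (inner ℝ σ (0 : EuclideanSpace ℝ (Fin n)) + ω) ^ q,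
    mul_pos hC (bracket_rpow_pos _ _), fun x => ?_⟩
  have := h 0 x
  rw [zero_add] at this
  linarith

end Slab

/-! ### Partial derivatives and multi-indices -/

section Partial

variable {n : ℕ}

local notation "𝔼" => EuclideanSpace ℝ (Fin n)

theorem contDiff_partialX {a : 𝔼 × 𝔼 → ℂ} (ha : ContDiff ℝ (⊤ : ℕ∞) a) (j : Fin n) :
    ContDiff ℝ (⊤ : ℕ∞) (partialX j a) :=
  (ha.fderiv_right (m := (⊤ : ℕ∞)) (by simp)).clm_apply contDiff_const

theorem contDiff_partialXi {a : 𝔼 × 𝔼 → ℂ} (ha : ContDiff ℝ (⊤ : ℕ∞) a) (j : Fin n) :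
    ContDiff ℝ (⊤ : ℕ∞) (partialXi j a) :=
  (ha.fderiv_right (m := (⊤ : ℕ∞)) (by simp)).clm_apply contDiff_const

/-- Symmetry of second derivatives. -/
theorem fderiv_fderiv_apply_comm {V : Type*} [NormedAddCommGroup V] [NormedSpace ℝ V] {a : V → ℂ}
    (ha : ContDiff ℝ (⊤ : ℕ∞) a) (v w : V) :
    (fun z => fderiv ℝ (fun z => fderiv ℝ a z v) z w) =
      fun z => fderiv ℝ (fun z => fderiv ℝ a z w) z v := by
  have h1 : Differentiable ℝ (fderiv ℝ a) :=
    (ha.fderiv_right (m := (⊤ : ℕ∞)) (by simp)).differentiable (by simp)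
  have h2 : ∀ u z, fderiv ℝ (fun z => fderiv ℝ a z u) z = (fderiv ℝ (fderiv ℝ a) z).flip u := by
    intro u z
    ext y
    rw [((h1 z).hasFDerivAt.clm_apply (hasFDerivAt_const u z)).fderiv]
    simp
  funext z
  rw [h2, h2]
  exact (ha.contDiffAt.isSymmSndFDerivAt (by
    simpa using (mod_cast le_top : ((2 : ℕ∞) : WithTop ℕ∞) ≤ ((⊤ : ℕ∞) : WithTop ℕ∞)))).eq w v

theorem partialX_partialX_comm {a : 𝔼 × 𝔼 → ℂ} (ha : ContDiff ℝ (⊤ : ℕ∞) a) (i j : Fin n) :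
    partialX i (partialX j a) = partialX j (partialX i a) :=
  fderiv_fderiv_apply_comm ha _ _

theorem partialXi_partialXi_comm {a : 𝔼 × 𝔼 → ℂ} (ha : ContDiff ℝ (⊤ : ℕ∞) a) (i j : Fin n) :
    partialXi i (partialXi j a) = partialXi j (partialXi i a) :=
  fderiv_fderiv_apply_comm ha _ _

theorem partialXi_partialX_comm {a : 𝔼 × 𝔼 → ℂ} (ha : ContDiff ℝ (⊤ : ℕ∞) a) (i j : Fin n) :
    partialXi i (partialX j a) = partialX j (partialXi i a) :=
  fderiv_fderiv_apply_comm ha _ _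

theorem partialX_add {a b : 𝔼 × 𝔼 → ℂ} (ha : Differentiable ℝ a) (hb : Differentiable ℝ b)
    (j : Fin n) : partialX j (a + b) = partialX j a + partialX j b := by
  funext z; simp [partialX, fderiv_add (ha z) (hb z)]

theorem partialXi_add {a b : 𝔼 × 𝔼 → ℂ} (ha : Differentiable ℝ a) (hb : Differentiable ℝ b)
    (j : Fin n) : partialXi j (a + b) = partialXi j a + partialXi j b := by
  funext z; simp [partialXi, fderiv_add (ha z) (hb z)]

theorem partialX_sum {ι : Type*} (s : Finset ι) {a : ι → 𝔼 × 𝔼 → ℂ}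
    (ha : ∀ i, Differentiable ℝ (a i)) (j : Fin n) :
    partialX j (∑ i ∈ s, a i) = ∑ i ∈ s, partialX j (a i) := by
  funext z
  simp only [partialX, Finset.sum_apply]
  rw [fderiv_sum fun i _ => ha i z]
  simp

theorem partialXi_sum {ι : Type*} (s : Finset ι) {a : ι → 𝔼 × 𝔼 → ℂ}
    (ha : ∀ i, Differentiable ℝ (a i)) (j : Fin n) :
    partialXi j (∑ i ∈ s, a i) = ∑ i ∈ s, partialXi j (a i) := by
  funext z
  simp only [partialXi, Finset.sum_apply]
  rw [fderiv_sum fun i _ => ha i z]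
  simp

theorem partialX_smul {a : 𝔼 × 𝔼 → ℂ} (ha : Differentiable ℝ a) (c : ℂ)
    (j : Fin n) : partialX j (c • a) = c • partialX j a := by
  funext z; simp [partialX, fderiv_const_smul (ha z) c]

theorem partialXi_smul {a : 𝔼 × 𝔼 → ℂ} (ha : Differentiable ℝ a) (c : ℂ)
    (j : Fin n) : partialXi j (c • a) = c • partialXi j a := by
  funext z; simp [partialXi, fderiv_const_smul (ha z) c]

theorem partialX_mul {a b : 𝔼 × 𝔼 → ℂ} (ha : Differentiable ℝ a) (hb : Differentiable ℝ b)
    (j : Fin n) : partialX j (a * b) = partialX j a * b + a * partialX j b := by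
  funext z; simp [partialX, fderiv_mul (ha z) (hb z)]; ring

theorem partialXi_mul {a b : 𝔼 × 𝔼 → ℂ} (ha : Differentiable ℝ a) (hb : Differentiable ℝ b)
    (j : Fin n) : partialXi j (a * b) = partialXi j a * b + a * partialXi j b := by
  funext z; simp [partialXi, fderiv_mul (ha z) (hb z)]; ring

section Fold

variable {X : Type*} {S : Set X} {P : Fin n → X → X}

theorem foldr_iterate_mem (hP : ∀ j, ∀ f ∈ S, P j f ∈ S) (l : List (Fin n)) (α : Fin n → ℕ)
    {f : X} (hf : f ∈ S) : l.foldr (fun j g => (P j)^[α j] g) f ∈ S := by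
  induction l with
  | nil => exact hf
  | cons j l ih =>
    rw [List.foldr_cons]
    generalize α j = k
    induction k with
    | zero => exact ih
    | succ k ihk => rw [Function.iterate_succ_apply']; exact hP j _ ihk

theorem foldr_iterate_comm {Q : X → X} (hP : ∀ j, ∀ f ∈ S, P j f ∈ S)
    (hc : ∀ j, ∀ f ∈ S, P j (Q f) = Q (P j f)) (l : List (Fin n)) (α : Fin n → ℕ)
    {f : X} (hf : f ∈ S) :
    l.foldr (fun j g => (P j)^[α j] g) (Q f) = Q (l.foldr (fun j g => (P j)^[α j] g) f) := by
  induction l with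
  | nil => rfl
  | cons j l ih =>
    rw [List.foldr_cons, List.foldr_cons, ih]
    have hg := foldr_iterate_mem hP l α hf
    generalize l.foldr (fun j g => (P j)^[α j] g) f = g at hg
    have : ∀ k, (P j)^[k] g ∈ S ∧ (P j)^[k] (Q g) = Q ((P j)^[k] g) := by
      intro k
      induction k with
      | zero => exact ⟨hg, rfl⟩
      | succ k ihk =>
        rw [Function.iterate_succ_apply', Function.iterate_succ_apply', ihk.2]
        exact ⟨hP j _ ihk.1, hc j _ ihk.1⟩
    exact (this _).2

/-- If the operators `P j` commute, raising the exponent of `P j` by one in the ordered product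
`∏ P_i^{α_i}` amounts to applying `P j` first. -/
theorem foldr_iterate_add_single (hP : ∀ j, ∀ f ∈ S, P j f ∈ S)
    (hc : ∀ i j, ∀ f ∈ S, P i (P j f) = P j (P i f)) (α : Fin n → ℕ) (j : Fin n)
    {f : X} (hf : f ∈ S) :
    (List.finRange n).foldr (fun i g => (P i)^[(α + Pi.single j 1 : Fin n → ℕ) i] g) f =
      (List.finRange n).foldr (fun i g => (P i)^[α i] g) (P j f) := by
  have key : ∀ l : List (Fin n), l.Nodup →
      l.foldr (fun i g => (P i)^[(α + Pi.single j 1 : Fin n → ℕ) i] g) f =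
        if j ∈ l then l.foldr (fun i g => (P i)^[α i] g) (P j f)
        else l.foldr (fun i g => (P i)^[α i] g) f := by
    intro l hl
    induction l with
    | nil => simp
    | cons i l ih =>
      rw [List.nodup_cons] at hl
      simp only [List.foldr_cons, List.mem_cons]
      rw [ih hl.2]
      by_cases hij : j = i
      · subst hij
        rw [if_neg hl.1, if_pos (Or.inl rfl), foldr_iterate_comm hP (hc · j) l α hf]
        simp [Function.iterate_succ_apply]
      · simp only [hij, false_or]
        split_ifs <;> simp [Ne.symm hij]
  rw [key _ (List.nodup_finRange n), if_pos (List.mem_finRange j)]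

end Fold

theorem derivX_add_single {a : 𝔼 × 𝔼 → ℂ} (ha : ContDiff ℝ (⊤ : ℕ∞) a) (α : Fin n → ℕ)
    (j : Fin n) : derivX (α + Pi.single j 1) a = derivX α (partialX j a) :=
  foldr_iterate_add_single (S := {a | ContDiff ℝ (⊤ : ℕ∞) a})
    (fun j _ hf => contDiff_partialX hf j) (fun i j _ hf => partialX_partialX_comm hf i j) α j ha

theorem derivXi_add_single {a : 𝔼 × 𝔼 → ℂ} (ha : ContDiff ℝ (⊤ : ℕ∞) a) (α : Fin n → ℕ)
    (j : Fin n) : derivXi (α + Pi.single j 1) a = derivXi α (partialXi j a) :=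
  foldr_iterate_add_single (S := {a | ContDiff ℝ (⊤ : ℕ∞) a})
    (fun j _ hf => contDiff_partialXi hf j) (fun i j _ hf => partialXi_partialXi_comm hf i j) α j ha

theorem derivXi_partialX {a : 𝔼 × 𝔼 → ℂ} (ha : ContDiff ℝ (⊤ : ℕ∞) a) (α : Fin n → ℕ)
    (j : Fin n) : derivXi α (partialX j a) = partialX j (derivXi α a) :=
  foldr_iterate_comm (S := {a | ContDiff ℝ (⊤ : ℕ∞) a})
    (fun j _ hf => contDiff_partialXi hf j) (fun i _ hf => partialXi_partialX_comm hf i j) _ α ha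

theorem contDiff_derivXi {a : 𝔼 × 𝔼 → ℂ} (ha : ContDiff ℝ (⊤ : ℕ∞) a) (α : Fin n → ℕ) :
    ContDiff ℝ (⊤ : ℕ∞) (derivXi α a) :=
  foldr_iterate_mem (S := {a | ContDiff ℝ (⊤ : ℕ∞) a})
    (fun j _ hf => contDiff_partialXi hf j) _ α ha

@[simp]
theorem derivX_zero (a : 𝔼 × 𝔼 → ℂ) : derivX 0 a = a := by
  simp [derivX]

@[simp]
theorem derivXi_zero (a : 𝔼 × 𝔼 → ℂ) : derivXi 0 a = a := by
  simp [derivXi]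

theorem multiLength_add_single (α : Fin n → ℕ) (j : Fin n) :
    multiLength (α + Pi.single j 1) = multiLength α + 1 := by
  simp [multiLength, Finset.sum_add_distrib]

theorem multiLength_eq_sum_map (α : Fin n → ℕ) :
    multiLength α = ((List.finRange n).map α).sum := by
  rw [multiLength, Finset.sum_fin_eq_sum_range, ← List.ofFn_eq_map, List.sum_ofFn,
    Finset.sum_fin_eq_sum_range]

end Partial

/-- The differential of a function on `ℝⁿ × ℝⁿ` in terms of its partial derivatives. -/
theorem fderiv_prod_eq_sum {n : ℕ} (a : EuclideanSpace ℝ (Fin n) × EuclideanSpace ℝ (Fin n) → ℂ)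
    (z v : EuclideanSpace ℝ (Fin n) × EuclideanSpace ℝ (Fin n)) :
    fderiv ℝ a z v = ∑ j, ((v.1 j : ℂ) * partialX j a z + (v.2 j : ℂ) * partialXi j a z) := by
  have h0 : ∀ x : EuclideanSpace ℝ (Fin n), x = ∑ j, x j • EuclideanSpace.single j (1 : ℝ) := by
    intro x
    ext i
    simp [Pi.single_apply]
  have h : v = ∑ j, (v.1 j • ((EuclideanSpace.single j (1 : ℝ), 0) :
      EuclideanSpace ℝ (Fin n) × EuclideanSpace ℝ (Fin n)) +
      v.2 j • (0, EuclideanSpace.single j (1 : ℝ))) := by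
    refine Prod.ext ?_ ?_
    · simpa [Prod.fst_sum] using h0 v.1
    · simpa [Prod.snd_sum] using h0 v.2
  conv_lhs => rw [h]
  rw [map_sum]
  simp only [map_add, map_smul, partialX, partialXi, Complex.real_smul]

/-! ### Symbol classes -/

section SymbolClass

variable {n : ℕ}

local notation "𝔼" => EuclideanSpace ℝ (Fin n)

/-- The estimate `|f(x, ξ)| ≤ C ⟨σ·x + ω⟩^q ⟨ξ⟩^m`. -/
def SymbolBound (σ : 𝔼) (ω m q : ℝ) (f : 𝔼 × 𝔼 → ℂ) : Prop :=
  ∃ C : ℝ, 0 < C ∧ ∀ x ξ : 𝔼, ‖f (x, ξ)‖ ≤ C * bracket (inner ℝ σ x + ω) ^ q * bracket ξ ^ m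

/-- Symbols of finite regularity: the symbol estimates hold for up to `k` derivatives, taken one
after the other in any order. The recursive form makes closure properties of symbol classes provable
by induction on `k`. -/
def FiniteSymbol (σ : 𝔼) (ω : ℝ) : ℕ → ℝ → ℝ → (𝔼 × 𝔼 → ℂ) → Prop
  | 0, m, q, f => SymbolBound σ ω m q f
  | k + 1, m, q, f => SymbolBound σ ω m q f ∧ Differentiable ℝ f ∧
      ∀ j, FiniteSymbol σ ω k m (q - 1) (partialX j f) ∧
        FiniteSymbol σ ω k (m - 1) q (partialXi j f)

variable {σ : EuclideanSpace ℝ (Fin n)} {ω m m' q q' : ℝ} {k : ℕ}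
  {a b : EuclideanSpace ℝ (Fin n) × EuclideanSpace ℝ (Fin n) → ℂ}

namespace SymbolBound

theorem mono (h : SymbolBound σ ω m q a) (hm : m ≤ m') (hq : q ≤ q') :
    SymbolBound σ ω m' q' a := by
  obtain ⟨C, hC, h⟩ := h
  refine ⟨C, hC, fun x ξ => (h x ξ).trans ?_⟩
  have h1 := bracket_rpow_mono (inner ℝ σ x + ω) hq
  have h2 := bracket_rpow_mono ξ hm
  have h3 := (bracket_rpow_pos (inner ℝ σ x + ω) q).le
  have h4 := (bracket_rpow_pos ξ m).le
  have h5 := (bracket_rpow_pos (inner ℝ σ x + ω) q').le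
  gcongr

theorem add (ha : SymbolBound σ ω m q a) (hb : SymbolBound σ ω m q b) :
    SymbolBound σ ω m q (a + b) := by
  obtain ⟨C, hC, ha⟩ := ha
  obtain ⟨D, hD, hb⟩ := hb
  refine ⟨C + D, by positivity, fun x ξ => (norm_add_le _ _).trans ?_⟩
  have := ha x ξ
  have := hb x ξ
  linarith

theorem smul (ha : SymbolBound σ ω m q a) (c : ℂ) : SymbolBound σ ω m q (c • a) := by
  obtain ⟨C, hC, ha⟩ := ha
  refine ⟨(‖c‖ + 1) * C, by positivity, fun x ξ => ?_⟩
  have h0 := ha x ξ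
  have h1 : 0 ≤ C * bracket (inner ℝ σ x + ω) ^ q * bracket ξ ^ m := (norm_nonneg _).trans h0
  calc ‖c • a (x, ξ)‖ = ‖c‖ * ‖a (x, ξ)‖ := norm_smul _ _
    _ ≤ (‖c‖ + 1) * (C * bracket (inner ℝ σ x + ω) ^ q * bracket ξ ^ m) := by
      gcongr; linarith
    _ = _ := by ring

theorem mul (ha : SymbolBound σ ω m q a) (hb : SymbolBound σ ω m' q' b) :
    SymbolBound σ ω (m + m') (q + q') (a * b) := by
  obtain ⟨C, hC, ha⟩ := ha
  obtain ⟨D, hD, hb⟩ := hb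
  refine ⟨C * D, by positivity, fun x ξ => ?_⟩
  have h0 := ha x ξ
  calc ‖a (x, ξ) * b (x, ξ)‖ = ‖a (x, ξ)‖ * ‖b (x, ξ)‖ := norm_mul _ _
    _ ≤ (C * bracket (inner ℝ σ x + ω) ^ q * bracket ξ ^ m) *
        (D * bracket (inner ℝ σ x + ω) ^ q' * bracket ξ ^ m') :=
      mul_le_mul h0 (hb x ξ) (norm_nonneg _) ((norm_nonneg _).trans h0)
    _ = _ := by rw [bracket_rpow_add, bracket_rpow_add]; ring

end SymbolBound

namespace FiniteSymbol

theorem bound (h : FiniteSymbol σ ω k m q a) : SymbolBound σ ω m q a := by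
  cases k with
  | zero => exact h
  | succ k => exact h.1

theorem mono (h : FiniteSymbol σ ω k m q a) (hm : m ≤ m') (hq : q ≤ q') :
    FiniteSymbol σ ω k m' q' a := by
  induction k generalizing a m m' q q' with
  | zero => exact SymbolBound.mono h hm hq
  | succ k ih =>
    exact ⟨h.1.mono hm hq, h.2.1, fun j => ⟨ih (h.2.2 j).1 hm (by linarith),
      ih (h.2.2 j).2 (by linarith) hq⟩⟩

theorem of_succ (h : FiniteSymbol σ ω (k + 1) m q a) : FiniteSymbol σ ω k m q a := by
  induction k generalizing a m q with
  | zero => exact h.1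
  | succ k ih => exact ⟨h.1, h.2.1, fun j => ⟨ih (h.2.2 j).1, ih (h.2.2 j).2⟩⟩

theorem add (ha : FiniteSymbol σ ω k m q a) (hb : FiniteSymbol σ ω k m q b) :
    FiniteSymbol σ ω k m q (a + b) := by
  induction k generalizing a b m q with
  | zero => exact SymbolBound.add ha hb
  | succ k ih =>
    refine ⟨ha.1.add hb.1, ha.2.1.add hb.2.1, fun j => ?_⟩
    rw [partialX_add ha.2.1 hb.2.1, partialXi_add ha.2.1 hb.2.1]
    exact ⟨ih (ha.2.2 j).1 (hb.2.2 j).1, ih (ha.2.2 j).2 (hb.2.2 j).2⟩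

theorem smul (ha : FiniteSymbol σ ω k m q a) (c : ℂ) : FiniteSymbol σ ω k m q (c • a) := by
  induction k generalizing a m q with
  | zero => exact SymbolBound.smul ha c
  | succ k ih =>
    refine ⟨ha.1.smul c, ha.2.1.const_smul c, fun j => ?_⟩
    rw [partialX_smul ha.2.1, partialXi_smul ha.2.1]
    exact ⟨ih (ha.2.2 j).1, ih (ha.2.2 j).2⟩

theorem mul (ha : FiniteSymbol σ ω k m q a) (hb : FiniteSymbol σ ω k m' q' b) :
    FiniteSymbol σ ω k (m + m') (q + q') (a * b) := by
  induction k generalizing a b m m' q q' with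
  | zero => exact SymbolBound.mul ha hb
  | succ k ih =>
    refine ⟨ha.1.mul hb.1, ha.2.1.mul hb.2.1, fun j => ?_⟩
    rw [partialX_mul ha.2.1 hb.2.1, partialXi_mul ha.2.1 hb.2.1]
    refine ⟨.add ?_ ?_, .add ?_ ?_⟩
    · exact (ih (ha.2.2 j).1 hb.of_succ).mono (by linarith) (by linarith)
    · exact (ih ha.of_succ (hb.2.2 j).1).mono (by linarith) (by linarith)
    · exact (ih (ha.2.2 j).2 hb.of_succ).mono (by linarith) (by linarith)
    · exact (ih ha.of_succ (hb.2.2 j).2).mono (by linarith) (by linarith)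

theorem zero : FiniteSymbol σ ω k m q 0 := by
  induction k generalizing m q with
  | zero =>
    refine ⟨1, one_pos, fun x ξ => ?_⟩
    have h1 := bracket_rpow_pos (inner ℝ σ x + ω) q
    have h2 := bracket_rpow_pos ξ m
    simp only [Pi.zero_apply, norm_zero]
    positivity
  | succ k ih =>
    refine ⟨ih.bound, differentiable_const 0, fun j => ?_⟩
    have h : ∀ z, fderiv ℝ (0 : 𝔼 × 𝔼 → ℂ) z = 0 := fun z => fderiv_const_apply (0 : ℂ)
    have h1 : partialX j (0 : 𝔼 × 𝔼 → ℂ) = 0 := by funext z; simp [partialX, h]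
    have h2 : partialXi j (0 : 𝔼 × 𝔼 → ℂ) = 0 := by funext z; simp [partialXi, h]
    rw [h1, h2]
    exact ⟨ih, ih⟩

theorem const (c : ℂ) : FiniteSymbol σ ω k 0 0 (fun _ => c) := by
  have hb : SymbolBound σ ω 0 0 (fun _ => c) := ⟨‖c‖ + 1, by positivity, by simp⟩
  cases k with
  | zero => exact hb
  | succ k =>
    refine ⟨hb, differentiable_const c, fun j => ?_⟩
    have h1 : partialX j (fun _ : 𝔼 × 𝔼 => c) = 0 := by funext z; simp [partialX]
    have h2 : partialXi j (fun _ : 𝔼 × 𝔼 => c) = 0 := by funext z; simp [partialXi]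
    rw [h1, h2]
    exact ⟨zero, zero⟩

/-- The differential is controlled by the partial derivatives, hence so is regularity. -/
theorem contDiff (h : FiniteSymbol σ ω (k + 1) m q a) : ContDiff ℝ k a := by
  induction k generalizing a m q with
  | zero => exact contDiff_zero.mpr h.2.1.continuous
  | succ k ih =>
    rw [Nat.cast_succ, contDiff_succ_iff_fderiv]
    refine ⟨h.2.1, by simp, ?_⟩
    rw [contDiff_clm_apply_iff]
    intro v
    simp only [fderiv_prod_eq_sum]
    exact ContDiff.sum fun j _ => (contDiff_const.mul (ih (h.2.2 j).1)).add
      (contDiff_const.mul (ih (h.2.2 j).2))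

end FiniteSymbol

theorem symbolClass_bound (h : a ∈ symbolClass σ ω m q) : SymbolBound σ ω m q a := by
  obtain ⟨C, hC, h⟩ := h.2 0 0
  refine ⟨C, hC, fun x ξ => ?_⟩
  simpa [multiLength] using h x ξ

theorem partialX_mem_symbolClass (h : a ∈ symbolClass σ ω m q) (j : Fin n) :
    partialX j a ∈ symbolClass σ ω m (q - 1) := by
  refine ⟨contDiff_partialX h.1 j, fun α β => ?_⟩
  obtain ⟨C, hC, h'⟩ := h.2 (α + Pi.single j 1) β
  refine ⟨C, hC, fun x ξ => ?_⟩
  rw [derivXi_partialX h.1, ← derivX_add_single (contDiff_derivXi h.1 β)]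
  convert h' x ξ using 4
  rw [multiLength_add_single]; push_cast; ring

theorem partialXi_mem_symbolClass (h : a ∈ symbolClass σ ω m q) (j : Fin n) :
    partialXi j a ∈ symbolClass σ ω (m - 1) q := by
  refine ⟨contDiff_partialXi h.1 j, fun α β => ?_⟩
  obtain ⟨C, hC, h'⟩ := h.2 α (β + Pi.single j 1)
  refine ⟨C, hC, fun x ξ => ?_⟩
  rw [← derivXi_add_single h.1]
  convert h' x ξ using 3
  rw [multiLength_add_single]; push_cast; ring

/-- The recursive and the multi-index description of symbol classes agree: smoothness comes from
`FiniteSymbol.contDiff`, and each `∂_x^α ∂_ξ^β` is a chain of `|α| + |β|` first derivatives. -/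
theorem mem_symbolClass_iff : a ∈ symbolClass σ ω m q ↔ ∀ k, FiniteSymbol σ ω k m q a := by
  constructor
  · intro h k
    induction k generalizing a m q with
    | zero => exact symbolClass_bound h
    | succ k ih =>
      exact ⟨symbolClass_bound h, h.1.differentiable (by simp), fun j =>
        ⟨ih (partialX_mem_symbolClass h j), ih (partialXi_mem_symbolClass h j)⟩⟩
  · intro h
    refine ⟨contDiff_infty.mpr fun k => (h (k + 1)).contDiff, fun α β => ?_⟩
    have h1 : ∀ l : List (Fin n), ∀ k, FiniteSymbol σ ω k (m - ((l.map β).sum : ℕ)) q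
        (l.foldr (fun j g => (partialXi j)^[β j] g) a) := by
      intro l
      induction l with
      | nil => simpa using h
      | cons j l ih =>
        rw [List.foldr_cons, List.map_cons, List.sum_cons]
        generalize β j = i
        induction i with
        | zero => simpa using ih
        | succ i ihi =>
          intro k
          rw [Function.iterate_succ_apply']
          exact ((ihi (k + 1)).2.2 j).2.mono (by push_cast; linarith) le_rfl
    have h2 : ∀ l : List (Fin n), ∀ k, FiniteSymbol σ ω k (m - (multiLength β : ℕ))
        (q - ((l.map α).sum : ℕ)) (l.foldr (fun j g => (partialX j)^[α j] g) (derivXi β a)) := by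
      intro l
      induction l with
      | nil => simpa [multiLength_eq_sum_map β, derivXi] using h1 (List.finRange n)
      | cons j l ih =>
        rw [List.foldr_cons, List.map_cons, List.sum_cons]
        generalize α j = i
        induction i with
        | zero => simpa using ih
        | succ i ihi =>
          intro k
          rw [Function.iterate_succ_apply']
          exact ((ihi (k + 1)).2.2 j).1.mono le_rfl (by push_cast; linarith)
    rw [multiLength_eq_sum_map α]
    exact h2 (List.finRange n) 0

theorem symbolClass_mono (h : a ∈ symbolClass σ ω m q) (hm : m ≤ m') (hq : q ≤ q') :
    a ∈ symbolClass σ ω m' q' :=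
  mem_symbolClass_iff.mpr fun k => (mem_symbolClass_iff.mp h k).mono hm hq

theorem add_mem_symbolClass (ha : a ∈ symbolClass σ ω m q) (hb : b ∈ symbolClass σ ω m q) :
    a + b ∈ symbolClass σ ω m q :=
  mem_symbolClass_iff.mpr fun k => (mem_symbolClass_iff.mp ha k).add (mem_symbolClass_iff.mp hb k)

theorem smul_mem_symbolClass (ha : a ∈ symbolClass σ ω m q) (c : ℂ) :
    c • a ∈ symbolClass σ ω m q :=
  mem_symbolClass_iff.mpr fun k => (mem_symbolClass_iff.mp ha k).smul c

theorem mul_mem_symbolClass (ha : a ∈ symbolClass σ ω m q) (hb : b ∈ symbolClass σ ω m' q') :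
    a * b ∈ symbolClass σ ω (m + m') (q + q') :=
  mem_symbolClass_iff.mpr fun k => (mem_symbolClass_iff.mp ha k).mul (mem_symbolClass_iff.mp hb k)

theorem zero_mem_symbolClass : (0 : 𝔼 × 𝔼 → ℂ) ∈ symbolClass σ ω m q :=
  mem_symbolClass_iff.mpr fun _ => .zero

theorem sum_mem_symbolClass {ι : Type*} (s : Finset ι) {f : ι → 𝔼 × 𝔼 → ℂ}
    (h : ∀ i, f i ∈ symbolClass σ ω m q) : ∑ i ∈ s, f i ∈ symbolClass σ ω m q :=
  Finset.sum_induction f _ (fun _ _ => add_mem_symbolClass) zero_mem_symbolClass fun i _ => h i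

theorem one_mem_symbolClass : (1 : 𝔼 × 𝔼 → ℂ) ∈ symbolClass σ ω 0 0 :=
  mem_symbolClass_iff.mpr fun _ => .const 1

theorem differentiable_of_mem_symbolClass (h : a ∈ symbolClass σ ω m q) : Differentiable ℝ a :=
  h.1.differentiable (by simp)

/-- The symbol `ξ_j`. -/
def coordXi (j : Fin n) : 𝔼 × 𝔼 → ℂ := fun z => (z.2 j : ℂ)

/-- The symbol `⟨ξ⟩⁻²`. -/
noncomputable def invBracketSq : 𝔼 × 𝔼 → ℂ := fun z => (((1 + ‖z.2‖ ^ 2)⁻¹ : ℝ) : ℂ)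

theorem hasFDerivAt_coordXi (j : Fin n) (z : 𝔼 × 𝔼) :
    HasFDerivAt (coordXi j) (Complex.ofRealCLM ∘L
      (EuclideanSpace.proj j : 𝔼 →L[ℝ] ℝ) ∘L ContinuousLinearMap.snd ℝ 𝔼 𝔼) z :=
  (Complex.ofRealCLM ∘L
      (EuclideanSpace.proj j : 𝔼 →L[ℝ] ℝ) ∘L ContinuousLinearMap.snd ℝ 𝔼 𝔼).hasFDerivAt

theorem partialX_coordXi (i j : Fin n) : partialX i (coordXi (n := n) j) = 0 := by
  funext z; simp [partialX, (hasFDerivAt_coordXi j z).fderiv]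

theorem partialXi_coordXi (i j : Fin n) :
    partialXi i (coordXi (n := n) j) = fun _ => if i = j then 1 else 0 := by
  funext z
  simp only [partialXi, (hasFDerivAt_coordXi j z).fderiv]
  split_ifs with h
  · simp [h]
  · simp [Ne.symm h]

theorem coordXi_mem_symbolClass (j : Fin n) : coordXi j ∈ symbolClass σ ω 1 0 := by
  refine mem_symbolClass_iff.mpr fun k => ?_
  have hb : SymbolBound σ ω 1 0 (coordXi j) := by
    refine ⟨1, one_pos, fun x ξ => ?_⟩
    simpa [coordXi] using (PiLp.norm_apply_le ξ j).trans (norm_le_bracket ξ)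
  cases k with
  | zero => exact hb
  | succ k =>
    refine ⟨hb, fun z => (hasFDerivAt_coordXi j z).differentiableAt, fun i => ?_⟩
    rw [partialX_coordXi, partialXi_coordXi]
    exact ⟨.zero, (FiniteSymbol.const _).mono (by simp) le_rfl⟩

theorem hasFDerivAt_invBracketSq (z : 𝔼 × 𝔼) :
    HasFDerivAt invBracketSq (Complex.ofRealCLM ∘L ((-((1 + ‖z.2‖ ^ 2) ^ 2)⁻¹) •
      ((2 : ℝ) • (innerSL ℝ z.2 ∘L ContinuousLinearMap.snd ℝ 𝔼 𝔼)))) z := by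
  have h1 : HasFDerivAt (fun z : 𝔼 × 𝔼 => 1 + ‖z.2‖ ^ 2)
      ((2 : ℝ) • (innerSL ℝ z.2 ∘L ContinuousLinearMap.snd ℝ 𝔼 𝔼)) z := by
    have := (hasFDerivAt_snd (𝕜 := ℝ) (p := z)).norm_sq.const_add 1
    rwa [← Nat.cast_smul_eq_nsmul ℝ] at this
  have h2 := (hasDerivAt_inv (x := 1 + ‖z.2‖ ^ 2) (by positivity)).comp_hasFDerivAt z h1
  exact Complex.ofRealCLM.hasFDerivAt.comp z h2

theorem partialX_invBracketSq (j : Fin n) : partialX j (invBracketSq (n := n)) = 0 := by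
  funext z; simp [partialX, (hasFDerivAt_invBracketSq z).fderiv]

theorem partialXi_invBracketSq (j : Fin n) : partialXi j (invBracketSq (n := n)) =
    (-2 : ℂ) • (coordXi j * (invBracketSq * invBracketSq)) := by
  funext z
  simp only [partialXi, (hasFDerivAt_invBracketSq z).fderiv]
  simp [coordXi, invBracketSq, EuclideanSpace.inner_single_right, -mul_inv_rev]
  rw [← inv_pow]
  ring

theorem invBracketSq_mem_symbolClass : invBracketSq ∈ symbolClass σ ω (-2) 0 := by
  have hb : SymbolBound σ ω (-2) 0 invBracketSq := by
    refine ⟨1, one_pos, fun x ξ => le_of_eq ?_⟩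
    have h : bracket ξ ^ (-2 : ℝ) = (1 + ‖ξ‖ ^ 2)⁻¹ := by
      rw [Real.rpow_neg (bracket_pos ξ).le, ← bracket_sq]; norm_cast
    rw [h, invBracketSq, Complex.norm_real, Real.norm_of_nonneg (by positivity)]
    simp
  refine mem_symbolClass_iff.mpr fun k => ?_
  induction k with
  | zero => exact hb
  | succ k ih =>
    refine ⟨hb, fun z => (hasFDerivAt_invBracketSq z).differentiableAt, fun i => ?_⟩
    rw [partialX_invBracketSq, partialXi_invBracketSq]
    exact ⟨.zero, (((mem_symbolClass_iff.mp (coordXi_mem_symbolClass i) k).mul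
      (ih.mul ih)).smul _).mono (by norm_num) (by norm_num)⟩

theorem invBracketSq_pow_mem_symbolClass (M : ℕ) :
    invBracketSq ^ M ∈ symbolClass σ ω (-(2 * M)) 0 := by
  induction M with
  | zero => simpa using one_mem_symbolClass
  | succ M ih =>
    rw [pow_succ]
    exact symbolClass_mono (mul_mem_symbolClass ih invBracketSq_mem_symbolClass)
      (by push_cast; linarith) (by simp)

/-- The identity `⟨ξ⟩⁻² + ∑ ξ_j² ⟨ξ⟩⁻² = 1`, which drives the gain of decay in `ξ`. -/
theorem invBracketSq_add_sum :
    invBracketSq + ∑ j, coordXi j * (coordXi j * invBracketSq) = (1 : 𝔼 × 𝔼 → ℂ) := by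
  funext z
  have h : (1 + ‖z.2‖ ^ 2 : ℂ) ≠ 0 := by
    exact_mod_cast (by positivity : (1 + ‖z.2‖ ^ 2 : ℝ) ≠ 0)
  have h2 : (‖z.2‖ ^ 2 : ℂ) = ∑ j, (z.2 j : ℂ) * z.2 j := by
    rw [← Complex.ofReal_pow, EuclideanSpace.real_norm_sq_eq z.2]
    push_cast
    simp only [pow_two]
  simp only [Pi.add_apply, Finset.sum_apply, Pi.mul_apply, coordXi, invBracketSq, Pi.one_apply,
    ← mul_assoc, ← Finset.sum_mul, ← h2]
  push_cast
  field_simp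

end SymbolClass

/-! ### Parameter integrals and Fourier transforms in coordinates -/

section ParamIntegral

theorem integrable_smulRight {V Y : Type*} [NormedAddCommGroup V] [NormedSpace ℝ V]
    [MeasurableSpace Y] {μ : Measure Y} (φ : V →L[ℝ] ℝ) {f : Y → ℂ} (hf : Integrable f μ) :
    Integrable (fun y => φ.smulRight (f y)) μ := by
  let L : ℂ →L[ℝ] (V →L[ℝ] ℂ) := ContinuousLinearMap.smulRightL ℝ V ℂ φ
  exact L.integrable_comp hf

theorem integral_smulRight {V Y : Type*} [NormedAddCommGroup V] [NormedSpace ℝ V]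
    [MeasurableSpace Y] {μ : Measure Y} (φ : V →L[ℝ] ℝ) {f : Y → ℂ} (hf : Integrable f μ) :
    ∫ y, φ.smulRight (f y) ∂μ = φ.smulRight (∫ y, f y ∂μ) := by
  let L : ℂ →L[ℝ] (V →L[ℝ] ℂ) := ContinuousLinearMap.smulRightL ℝ V ℂ φ
  exact L.integral_comp_comm hf

theorem integrable_sum_normed {Y ι G : Type*} [NormedAddCommGroup G] [MeasurableSpace Y]
    {μ : Measure Y} (s : Finset ι) {F : ι → Y → G} (h : ∀ i, Integrable (F i) μ) :
    Integrable (fun y => ∑ i ∈ s, F i y) μ :=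
  integrable_finsetSum s fun i _ => h i

theorem integrable_sum_smulRight {V Y ι : Type*} [NormedAddCommGroup V] [NormedSpace ℝ V]
    [Fintype ι] [MeasurableSpace Y] {μ : Measure Y} (φ : ι → V →L[ℝ] ℝ) {F : ι → Y → ℂ}
    (h : ∀ i, Integrable (F i) μ) : Integrable (fun y => ∑ i, (φ i).smulRight (F i y)) μ :=
  integrable_sum_normed (G := V →L[ℝ] ℂ) Finset.univ (F := fun i y => (φ i).smulRight (F i y))
    fun i => integrable_smulRight (φ i) (h i)

theorem integral_sum_smulRight {V Y ι : Type*} [NormedAddCommGroup V] [NormedSpace ℝ V]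
    [Fintype ι] [MeasurableSpace Y] {μ : Measure Y} (φ : ι → V →L[ℝ] ℝ) {F : ι → Y → ℂ}
    (h : ∀ i, Integrable (F i) μ) :
    ∫ y, ∑ i, (φ i).smulRight (F i y) ∂μ = ∑ i, (φ i).smulRight (∫ y, F i y ∂μ) := by
  rw [integral_finsetSum (G := V →L[ℝ] ℂ) Finset.univ
    (f := fun i y => (φ i).smulRight (F i y)) fun i _ => integrable_smulRight (φ i) (h i)]
  exact Finset.sum_congr rfl fun i _ => integral_smulRight (φ i) (h i)

/-- Differentiation under the integral sign, with the differential expressed through partial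
derivatives `F' i` along finitely many linear functionals `φ i`. -/
theorem hasFDerivAt_integral_of_partials {V Y ι : Type*} [NormedAddCommGroup V] [NormedSpace ℝ V]
    [Fintype ι] [MeasurableSpace Y] {μ : Measure Y} (φ : ι → V →L[ℝ] ℝ) {F : V → Y → ℂ}
    {F' : ι → V → Y → ℂ} {g : Y → ℝ} {p₀ : V} {U : Set V} (hU : U ∈ nhds p₀)
    (hF : ∀ p ∈ U, ∀ y, HasFDerivAt (fun p => F p y) (∑ i, (φ i).smulRight (F' i p y)) p)
    (hmeas : ∀ p ∈ U, AEStronglyMeasurable (F p) μ) (hint : Integrable (F p₀) μ)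
    (hmeas' : ∀ i, AEStronglyMeasurable (F' i p₀) μ) (hg : Integrable g μ)
    (hb : ∀ i, ∀ p ∈ U, ∀ y, ‖F' i p y‖ ≤ g y) :
    HasFDerivAt (fun p => ∫ y, F p y ∂μ) (∑ i, (φ i).smulRight (∫ y, F' i p₀ y ∂μ)) p₀ := by
  have hint' : ∀ i, Integrable (F' i p₀) μ := fun i =>
    hg.mono' (hmeas' i) (Filter.Eventually.of_forall fun y => hb i p₀ (mem_of_mem_nhds hU) y)
  have key := hasFDerivAt_integral_of_dominated_of_fderiv_le (𝕜 := ℝ) (μ := μ) (F := F)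
    (F' := fun p y => ∑ i, (φ i).smulRight (F' i p y)) (bound := fun y => ∑ i, ‖φ i‖ * g y)
    hU (Filter.eventually_of_mem hU hmeas) hint
    (integrable_sum_smulRight φ hint').aestronglyMeasurable
    (Filter.Eventually.of_forall fun y p hp => (norm_sum_le _ _).trans
      (Finset.sum_le_sum fun i _ => by
        rw [ContinuousLinearMap.norm_smulRight_apply]
        gcongr
        exact hb i p hp y))
    (integrable_sum_normed _ fun i => hg.const_mul _)
    (Filter.Eventually.of_forall fun y p hp => hF p hp y)
  rwa [integral_sum_smulRight φ hint'] at key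

end ParamIntegral

section Fourier

variable {n : ℕ}

local notation "𝔼" => EuclideanSpace ℝ (Fin n)

theorem euclidean_sum_smul_single (x : 𝔼) : ∑ j, x j • EuclideanSpace.single j (1 : ℝ) = x := by
  ext i
  simp [Pi.single_apply]

/-- The continuous linear map `v ↦ ∑ j, v_j c_j`, i.e. the differential of a function on `ℝⁿ`
whose partial derivatives are the `c_j`. -/
noncomputable def gradientCLM (c : Fin n → ℂ) : 𝔼 →L[ℝ] ℂ :=
  ∑ j, (EuclideanSpace.proj j : 𝔼 →L[ℝ] ℝ).smulRight (c j)

theorem gradientCLM_apply (c : Fin n → ℂ) (v : 𝔼) : gradientCLM c v = ∑ j, (v j : ℂ) * c j := by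
  simp [gradientCLM]

@[simp]
theorem gradientCLM_single (c : Fin n → ℂ) (j : Fin n) :
    gradientCLM c (EuclideanSpace.single j 1) = c j := by
  rw [gradientCLM_apply, Finset.sum_eq_single j]
  · simp
  · intro i _ hi
    simp [hi]
  · simp

theorem eq_gradientCLM (L : 𝔼 →L[ℝ] ℂ) :
    L = gradientCLM fun j => L (EuclideanSpace.single j 1) := by
  ext v
  conv_lhs => rw [← euclidean_sum_smul_single v]
  simp [gradientCLM_apply, map_sum]

theorem integrable_gradientCLM {A : Fin n → 𝔼 → ℂ} (hA : ∀ j, Integrable (A j)) :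
    Integrable fun η => gradientCLM fun j => A j η := by
  exact integrable_sum_smulRight _ hA

theorem innerSL_single (y : 𝔼) (j : Fin n) :
    innerSL ℝ y (EuclideanSpace.single j 1) = y j := by
  have := EuclideanSpace.inner_single_right (𝕜 := ℝ) j 1 y
  simpa using this

theorem fourierSMulRight_innerSL_single (f : 𝔼 → ℂ) (y : 𝔼) (j : Fin n) :
    VectorFourier.fourierSMulRight (innerSL ℝ) f y (EuclideanSpace.single j 1) =
      -(2 * Real.pi * Complex.I) * ((y j : ℂ) * f y) := by
  rw [← innerSL_single, ← Complex.real_smul]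
  rfl

theorem fourierSMulRight_neg_innerSL_single (f : 𝔼 → ℂ) (y : 𝔼) (j : Fin n) :
    VectorFourier.fourierSMulRight (-innerSL ℝ) f y (EuclideanSpace.single j 1) =
      2 * Real.pi * Complex.I * y j * f y := by
  have : VectorFourier.fourierSMulRight (-innerSL ℝ) f y (EuclideanSpace.single j 1) =
      -(2 * Real.pi * Complex.I) * ((-innerSL ℝ y (EuclideanSpace.single j 1) : ℝ) * f y) := by
    rw [← Complex.real_smul]
    rfl
  rw [this, innerSL_single]
  push_cast
  ring

/-- The Fourier transform of a partial derivative, in terms of coordinates. -/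
theorem fourier_partial {A : 𝔼 → ℂ} {A' : Fin n → 𝔼 → ℂ} (hA : Integrable A)
    (hd : ∀ η, HasFDerivAt A (gradientCLM fun j => A' j η) η) (hA' : ∀ j, Integrable (A' j))
    (j : Fin n) (y : 𝔼) : 𝓕 (A' j) y = 2 * Real.pi * Complex.I * y j * 𝓕 A y := by
  have h1 : fderiv ℝ A = fun η => gradientCLM fun j => A' j η := funext fun η => (hd η).fderiv
  have h2 : Integrable (fderiv ℝ A) := by rw [h1]; exact integrable_gradientCLM hA'
  have h3 := congrFun (Real.fourier_fderiv hA (fun η => (hd η).differentiableAt) h2) y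
  have h4 := Real.fourier_continuousLinearMap_apply (a := EuclideanSpace.single j 1) (v := y) h2
  rw [h3, h1] at h4
  simp only [gradientCLM_single] at h4
  rw [← h4, fourierSMulRight_neg_innerSL_single]

theorem integrable_norm_mul_norm {A : 𝔼 → ℂ} (hA : AEStronglyMeasurable A)
    (h : ∀ j, Integrable fun η : 𝔼 => (η j : ℂ) * A η) :
    Integrable fun η : 𝔼 => ‖η‖ * ‖A η‖ := by
  refine (integrable_finsetSum Finset.univ fun j _ => (h j).norm).mono'
    (continuous_norm.aestronglyMeasurable.mul hA.norm) (Filter.Eventually.of_forall fun η => ?_)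
  have h1 : ‖η‖ ≤ ∑ j, ‖η j‖ := by
    conv_lhs => rw [← euclidean_sum_smul_single η]
    exact (norm_sum_le _ _).trans (Finset.sum_le_sum fun j _ => by simp [norm_smul])
  simp only [norm_mul, norm_norm, Complex.norm_real, ← Finset.sum_mul]
  gcongr

/-- The partial derivatives of a Fourier transform, in terms of coordinates. -/
theorem hasFDerivAt_fourier_gradientCLM {A : 𝔼 → ℂ} (hA : Integrable A)
    (h : ∀ j, Integrable fun η : 𝔼 => (η j : ℂ) * A η) (y : 𝔼) :
    HasFDerivAt (𝓕 A) (gradientCLM fun j =>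
      -(2 * Real.pi * Complex.I) * 𝓕 (fun η : 𝔼 => (η j : ℂ) * A η) y) y := by
  have hI := integrable_norm_mul_norm hA.aestronglyMeasurable h
  have key := Real.hasFDerivAt_fourier hA hI y
  suffices h : 𝓕 (VectorFourier.fourierSMulRight (innerSL ℝ) A) y = gradientCLM fun j =>
      -(2 * Real.pi * Complex.I) * 𝓕 (fun η : 𝔼 => (η j : ℂ) * A η) y by rwa [h] at key
  rw [eq_gradientCLM (𝓕 (VectorFourier.fourierSMulRight (innerSL ℝ) A) y)]
  congr 1
  funext j
  have hI' : Integrable (VectorFourier.fourierSMulRight (innerSL ℝ) A) := by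
    have h0 : ∀ η, VectorFourier.fourierSMulRight (innerSL ℝ) A η = gradientCLM fun j =>
        -(2 * Real.pi * Complex.I) * ((η j : ℂ) * A η) := by
      intro η
      rw [eq_gradientCLM (VectorFourier.fourierSMulRight (innerSL ℝ) A η)]
      congr 1
      funext j
      exact fourierSMulRight_innerSL_single A η j
    rw [funext h0]
    exact integrable_gradientCLM fun j => (h j).const_mul _
  rw [Real.fourier_continuousLinearMap_apply hI']
  simp only [Real.fourier_eq]
  rw [← integral_const_mul]
  congr 1
  funext η
  rw [fourierSMulRight_innerSL_single, Circle.smul_def, Circle.smul_def, smul_eq_mul, smul_eq_mul]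
  ring

/-- Integration by parts on `ℝⁿ` without boundary terms. -/
theorem integral_mul_partial {f g : 𝔼 → ℂ} {f' g' : Fin n → 𝔼 → ℂ}
    (hf : ∀ y, HasFDerivAt f (gradientCLM fun j => f' j y) y)
    (hg : ∀ y, HasFDerivAt g (gradientCLM fun j => g' j y) y) (j : Fin n)
    (h1 : Integrable fun y => f' j y * g y) (h2 : Integrable fun y => f y * g' j y)
    (h3 : Integrable fun y => f y * g y) :
    ∫ y, f y * g' j y = -∫ y, f' j y * g y := by
  have hf' : ∀ y, fderiv ℝ f y (EuclideanSpace.single j 1) = f' j y := fun y => by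
    rw [(hf y).fderiv, gradientCLM_single]
  have hg' : ∀ y, fderiv ℝ g y (EuclideanSpace.single j 1) = g' j y := fun y => by
    rw [(hg y).fderiv, gradientCLM_single]
  simp only [← hf', ← hg'] at h1 h2 ⊢
  exact integral_mul_fderiv_eq_neg_fderiv_mul_of_integrable h1 h2 h3
    (fun y _ => (hf y).differentiableAt) fun y _ => (hg y).differentiableAt

end Fourier

/-! ### The kernel of a symbol -/

section Kernel

variable {n : ℕ}

local notation "𝔼" => EuclideanSpace ℝ (Fin n)

/-- The condition on orders under which `a(x, ξ + tη) w(η)`, with `a` of order `m` and `w` of order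
`r`, is integrable in `η` with a bound `⟨ξ⟩^s` that is uniform for `t ∈ T`. The set `T` is kept
inside the bounded neighbourhood `[-2, 2]` of `[0, 1]`. -/
def Admissible (n : ℕ) (T : Set ℝ) (m r s : ℝ) : Prop :=
  T ⊆ Set.Icc (-2) 2 ∧ ∃ C : ℝ, 0 < C ∧ ∀ t ∈ T, ∀ ξ η : EuclideanSpace ℝ (Fin n),
    bracket (ξ + t • η) ^ m * bracket η ^ r ≤ C * bracket ξ ^ s * bracket η ^ (-((n : ℝ) + 1))

variable {T : Set ℝ} {m m' r r' s : ℝ}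

theorem Admissible.mono (h : Admissible n T m r s) (hm : m' ≤ m) (hr : r' ≤ r) :
    Admissible n T m' r' s := by
  obtain ⟨hT, C, hC, h⟩ := h
  refine ⟨hT, C, hC, fun t ht ξ η => le_trans ?_ (h t ht ξ η)⟩
  exact mul_le_mul (bracket_rpow_mono _ hm) (bracket_rpow_mono _ hr) (bracket_rpow_pos _ _).le
    (bracket_rpow_pos _ _).le

/-- A weight of very negative order absorbs the growth in `η` that Peetre's inequality allows. -/
theorem admissible_Icc (h : r ≤ -(|m| + n + 1)) : Admissible n (Set.Icc (-2) 2) m r m := by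
  refine ⟨le_rfl, 2 ^ |m| * 2 ^ |m|, by positivity, fun t ht ξ η => ?_⟩
  have h1 := bracket_add_rpow_le ξ (t • η) m
  have h2 : bracket (t • η) ≤ 2 * bracket η := by
    refine bracket_le_of_norm_le (by norm_num) ?_
    rw [norm_smul]
    have : ‖t‖ ≤ 2 := abs_le.mpr ht
    gcongr
  have h3 := bracket_rpow_le_of_le (by norm_num) h2 |m| (abs_nonneg m)
  have h4 := bracket_rpow_pos ξ m
  have h5 := bracket_rpow_pos η r
  calc bracket (ξ + t • η) ^ m * bracket η ^ r
      ≤ (2 ^ |m| * (bracket ξ ^ m * (2 ^ |m| * bracket η ^ |m|))) * bracket η ^ r := by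
        gcongr
        exact h1.trans (by gcongr)
    _ = 2 ^ |m| * 2 ^ |m| * bracket ξ ^ m * bracket η ^ (|m| + r) := by
        rw [bracket_rpow_add]; ring
    _ ≤ _ := by
        have := bracket_rpow_mono η (show |m| + r ≤ -((n : ℝ) + 1) by linarith)
        gcongr

/-- At `t = 1` a symbol `a` of sufficiently negative order needs no weight. -/
theorem admissible_singleton_one (hm : m ≤ -((n : ℝ) + 1)) (hr : r ≤ 0) :
    Admissible n {1} m r |m| := by
  refine ⟨by norm_num, 2 ^ |m|, by positivity, fun t ht ξ η => ?_⟩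
  rw [Set.mem_singleton_iff.mp ht, one_smul, add_comm ξ η]
  have h1 := bracket_add_rpow_le η ξ m
  have h2 : bracket η ^ r ≤ 1 := by simpa using bracket_rpow_mono η hr
  have h3 := bracket_rpow_mono η hm
  have h4 := bracket_rpow_pos ξ |m|
  have h5 := bracket_rpow_pos (η + ξ) m
  calc bracket (η + ξ) ^ m * bracket η ^ r ≤ bracket (η + ξ) ^ m * 1 := by gcongr
    _ ≤ 2 ^ |m| * (bracket η ^ m * bracket ξ ^ |m|) := by linarith
    _ ≤ 2 ^ |m| * (bracket η ^ (-((n : ℝ) + 1)) * bracket ξ ^ |m|) := by gcongr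
    _ = _ := by ring

theorem integrable_bracket_decay : Integrable fun y : 𝔼 => bracket y ^ (-((n : ℝ) + 1)) :=
  integrable_bracket_rpow _ (by simp)

/-- The function `η ↦ a(x, ξ + tη) w(0, η)` at the parameter `p = (t, (x, ξ))`. The weight `w` is a
symbol that only matters through its dependence on `ξ`. -/
def fiberAmp (a w : 𝔼 × 𝔼 → ℂ) (p : ℝ × (𝔼 × 𝔼)) (η : 𝔼) : ℂ :=
  a (p.2.1, p.2.2 + p.1 • η) * w (0, η)

/-- The kernel `∫ a(x, ξ + tη) w(η) e^{-2πi y·η} dη`. -/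
noncomputable def fiberKernel (a w : 𝔼 × 𝔼 → ℂ) (p : ℝ × (𝔼 × 𝔼)) (y : 𝔼) : ℂ :=
  𝓕 (fiberAmp a w p) y

variable {σ : EuclideanSpace ℝ (Fin n)} {ω q : ℝ}
  {a a' w w' : EuclideanSpace ℝ (Fin n) × EuclideanSpace ℝ (Fin n) → ℂ}

theorem fiberAmp_bound (ha : a ∈ symbolClass σ ω m q) (hw : w ∈ symbolClass σ ω r 0)
    (hT : Admissible n T m r s) : ∃ C : ℝ, 0 < C ∧ ∀ p : ℝ × (𝔼 × 𝔼), p.1 ∈ T → ∀ η : 𝔼,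
      ‖fiberAmp a w p η‖ ≤ C * bracket (inner ℝ σ p.2.1 + ω) ^ q * bracket p.2.2 ^ s *
        bracket η ^ (-((n : ℝ) + 1)) := by
  obtain ⟨C, hC, ha⟩ := symbolClass_bound ha
  obtain ⟨D, hD, hw⟩ := symbolClass_bound hw
  obtain ⟨-, K, hK, hT⟩ := hT
  refine ⟨C * D * K, by positivity, fun p hp η => ?_⟩
  have h1 := ha p.2.1 (p.2.2 + p.1 • η)
  have h2 := hw 0 η
  rw [Real.rpow_zero, mul_one] at h2
  have h3 := bracket_rpow_pos (inner ℝ σ p.2.1 + ω) q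
  calc ‖fiberAmp a w p η‖ = ‖a (p.2.1, p.2.2 + p.1 • η)‖ * ‖w (0, η)‖ := norm_mul _ _
    _ ≤ (C * bracket (inner ℝ σ p.2.1 + ω) ^ q * bracket (p.2.2 + p.1 • η) ^ m) *
        (D * bracket η ^ r) := mul_le_mul h1 h2 (norm_nonneg _) ((norm_nonneg _).trans h1)
    _ = C * D * bracket (inner ℝ σ p.2.1 + ω) ^ q *
        (bracket (p.2.2 + p.1 • η) ^ m * bracket η ^ r) := by ring
    _ ≤ C * D * bracket (inner ℝ σ p.2.1 + ω) ^ q *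
        (K * bracket p.2.2 ^ s * bracket η ^ (-((n : ℝ) + 1))) :=
      mul_le_mul_of_nonneg_left (hT _ hp _ _) (by positivity)
    _ = _ := by ring

theorem continuous_fiberAmp (ha : Continuous a) (hw : Continuous w) (p : ℝ × (𝔼 × 𝔼)) :
    Continuous (fiberAmp a w p) := by
  unfold fiberAmp; fun_prop

theorem integrable_fiberAmp (ha : a ∈ symbolClass σ ω m q) (hw : w ∈ symbolClass σ ω r 0)
    (hT : Admissible n T m r s) {p : ℝ × (𝔼 × 𝔼)} (hp : p.1 ∈ T) :
    Integrable (fiberAmp a w p) := by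
  obtain ⟨C, -, h⟩ := fiberAmp_bound ha hw hT
  exact (integrable_bracket_decay.const_mul _).mono'
    (continuous_fiberAmp ha.1.continuous hw.1.continuous p).aestronglyMeasurable
    (Filter.Eventually.of_forall (h p hp))

theorem hasFDerivAt_fiberAmp_right (ha : Differentiable ℝ a) (hw : Differentiable ℝ w)
    (p : ℝ × (𝔼 × 𝔼)) (η : 𝔼) : HasFDerivAt (fiberAmp a w p) (gradientCLM fun j =>
      p.1 * fiberAmp (partialXi j a) w p η + fiberAmp a (partialXi j w) p η) η := by
  have h1 : HasFDerivAt (fun η : 𝔼 => (p.2.1, p.2.2 + p.1 • η))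
      ((0 : 𝔼 →L[ℝ] 𝔼).prod (p.1 • ContinuousLinearMap.id ℝ 𝔼)) η :=
    (hasFDerivAt_const _ _).prodMk (((hasFDerivAt_id η).const_smul p.1).const_add _)
  have h2 : HasFDerivAt (fun η : 𝔼 => ((0 : 𝔼), η))
      ((0 : 𝔼 →L[ℝ] 𝔼).prod (ContinuousLinearMap.id ℝ 𝔼)) η :=
    (hasFDerivAt_const _ _).prodMk (hasFDerivAt_id η)
  have h3 : HasFDerivAt (fiberAmp a w p) _ η :=
    ((ha _).hasFDerivAt.comp η h1).mul ((hw _).hasFDerivAt.comp η h2)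
  refine h3.congr_fderiv (ContinuousLinearMap.ext fun v => ?_)
  rw [gradientCLM_apply]
  simp only [Function.comp, add_apply, smul_apply,
    ContinuousLinearMap.comp_apply, ContinuousLinearMap.prod_apply, zero_apply,
    ContinuousLinearMap.id_apply, fderiv_prod_eq_sum, smul_eq_mul, Finset.mul_sum,
    ← Finset.sum_add_distrib]
  refine Finset.sum_congr rfl fun j _ => ?_
  simp [fiberAmp]
  ring

theorem continuous_fourier {A : 𝔼 → ℂ} (hA : Integrable A) : Continuous (𝓕 A) :=
  VectorFourier.fourierIntegral_continuous Real.continuous_fourierChar continuous_inner hA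

theorem norm_fourier_le (A : 𝔼 → ℂ) (y : 𝔼) : ‖𝓕 A y‖ ≤ ∫ η, ‖A η‖ :=
  VectorFourier.norm_fourierIntegral_le_integral_norm _ _ _ _ _

theorem fourier_add_apply {A B : 𝔼 → ℂ} (hA : Integrable A) (hB : Integrable B) (y : 𝔼) :
    𝓕 (fun η => A η + B η) y = 𝓕 A y + 𝓕 B y := by
  simp only [Real.fourier_eq, smul_add]
  exact integral_add ((Real.fourierIntegral_convergent_iff y).2 hA)
    ((Real.fourierIntegral_convergent_iff y).2 hB)

theorem fourier_const_mul_apply (c : ℂ) (A : 𝔼 → ℂ) (y : 𝔼) :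
    𝓕 (fun η => c * A η) y = c * 𝓕 A y := by
  simp only [Real.fourier_eq]
  rw [← integral_const_mul]
  congr 1
  funext η
  rw [Circle.smul_def, Circle.smul_def, smul_eq_mul, smul_eq_mul]
  ring

theorem fourier_sum_apply {ι : Type*} (s : Finset ι) {A : ι → 𝔼 → ℂ}
    (hA : ∀ i, Integrable (A i)) (y : 𝔼) :
    𝓕 (fun η => ∑ i ∈ s, A i η) y = ∑ i ∈ s, 𝓕 (A i) y := by
  simp only [Real.fourier_eq, Finset.smul_sum]
  exact integral_finsetSum s fun i _ => (Real.fourierIntegral_convergent_iff y).2 (hA i)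

/-- Integration by parts in `η`: multiplying the kernel by `y_j` differentiates the amplitude. -/
theorem coord_mul_fiberKernel (ha : a ∈ symbolClass σ ω m q) (hw : w ∈ symbolClass σ ω r 0)
    (hT : Admissible n T m r s) {p : ℝ × (𝔼 × 𝔼)} (hp : p.1 ∈ T) (y : 𝔼) (j : Fin n) :
    2 * Real.pi * Complex.I * y j * fiberKernel a w p y =
      p.1 * fiberKernel (partialXi j a) w p y + fiberKernel a (partialXi j w) p y := by
  have h1 := fun j => integrable_fiberAmp (partialXi_mem_symbolClass ha j) hw
    (hT.mono (by linarith) le_rfl) hp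
  have h2 := fun j => integrable_fiberAmp ha (partialXi_mem_symbolClass hw j)
    (hT.mono le_rfl (by linarith)) hp
  have key := fourier_partial (integrable_fiberAmp ha hw hT hp)
    (hasFDerivAt_fiberAmp_right (differentiable_of_mem_symbolClass ha)
      (differentiable_of_mem_symbolClass hw) p) (fun j => ((h1 j).const_mul _).add (h2 j)) j y
  rw [fiberKernel, ← key, fourier_add_apply ((h1 j).const_mul _) (h2 j), fourier_const_mul_apply]
  rfl

/-- The kernel is rapidly decreasing in `y`. Differentiating the amplitude in `η` does not spoil its
bound, so each factor `y_j` costs nothing. -/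
theorem fiberKernel_decay_nat (ha : a ∈ symbolClass σ ω m q) (hw : w ∈ symbolClass σ ω r 0)
    (hT : Admissible n T m r s) (L : ℕ) : ∃ C : ℝ, 0 < C ∧ ∀ p : ℝ × (𝔼 × 𝔼), p.1 ∈ T → ∀ y : 𝔼,
      bracket y ^ L * ‖fiberKernel a w p y‖ ≤
        C * bracket (inner ℝ σ p.2.1 + ω) ^ q * bracket p.2.2 ^ s := by
  induction L generalizing a w m r with
  | zero =>
    obtain ⟨C, hC, h⟩ := fiberAmp_bound ha hw hT
    have hI : 0 ≤ ∫ η : 𝔼, bracket η ^ (-((n : ℝ) + 1)) :=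
      integral_nonneg fun η => (bracket_rpow_pos η _).le
    refine ⟨C * ((∫ η : 𝔼, bracket η ^ (-((n : ℝ) + 1))) + 1), by positivity, fun p hp y => ?_⟩
    have h3 := bracket_rpow_pos (inner ℝ σ p.2.1 + ω) q
    have h4 := bracket_rpow_pos p.2.2 s
    rw [pow_zero, one_mul]
    calc ‖fiberKernel a w p y‖ ≤ ∫ η, ‖fiberAmp a w p η‖ := norm_fourier_le _ _
      _ ≤ ∫ η, C * bracket (inner ℝ σ p.2.1 + ω) ^ q * bracket p.2.2 ^ s *
          bracket η ^ (-((n : ℝ) + 1)) :=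
        integral_mono (integrable_fiberAmp ha hw hT hp).norm
          (integrable_bracket_decay.const_mul _) (h p hp)
      _ = C * bracket (inner ℝ σ p.2.1 + ω) ^ q * bracket p.2.2 ^ s *
          ∫ η : 𝔼, bracket η ^ (-((n : ℝ) + 1)) := integral_const_mul _ _
      _ ≤ C * bracket (inner ℝ σ p.2.1 + ω) ^ q * bracket p.2.2 ^ s *
          ((∫ η : 𝔼, bracket η ^ (-((n : ℝ) + 1))) + 1) := by gcongr; linarith
      _ = _ := by ring
  | succ L ih =>
    obtain ⟨C, hC, h0⟩ := ih ha hw hT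
    choose D hD h1 using fun j => ih (symbolClass_mono (partialXi_mem_symbolClass ha j)
      (show m - 1 ≤ m by linarith) le_rfl) hw hT
    choose K hK h2 using fun j => ih ha (symbolClass_mono (partialXi_mem_symbolClass hw j)
      (show r - 1 ≤ r by linarith) le_rfl) hT
    have hS : 0 ≤ ∑ j, (2 * D j + K j) := Finset.sum_nonneg fun j _ => by
      have := hD j; have := hK j; positivity
    refine ⟨C + ∑ j, (2 * D j + K j), by positivity, fun p hp y => ?_⟩
    set W := bracket (inner ℝ σ p.2.1 + ω) ^ q * bracket p.2.2 ^ s with hW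
    have hL : 0 < bracket y ^ L := pow_pos (bracket_pos y) L
    have hy : bracket y ≤ 1 + ∑ j, ‖y j‖ := by
      refine (bracket_le_one_add_norm y).trans ?_
      gcongr
      conv_lhs => rw [← euclidean_sum_smul_single y]
      exact (norm_sum_le _ _).trans (Finset.sum_le_sum fun j _ => by simp [norm_smul])
    have hj : ∀ j, bracket y ^ L * (‖y j‖ * ‖fiberKernel a w p y‖) ≤ (2 * D j + K j) * W := by
      intro j
      have e := congrArg norm (coord_mul_fiberKernel ha hw hT hp y j)
      simp only [norm_mul, Complex.norm_I, Complex.norm_real, Complex.norm_ofNat, mul_one] at e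
      -- The factor `2π` from the differentiation is at least `1` and may be dropped.
      have hpi : 1 ≤ 2 * ‖Real.pi‖ := by
        rw [Real.norm_of_nonneg Real.pi_pos.le]; linarith [Real.pi_gt_three]
      have ht : ‖p.1‖ ≤ 2 := abs_le.mpr (hT.1 hp)
      have e2 : ‖y j‖ * ‖fiberKernel a w p y‖ ≤
          2 * ‖fiberKernel (partialXi j a) w p y‖ + ‖fiberKernel a (partialXi j w) p y‖ :=
        calc ‖y j‖ * ‖fiberKernel a w p y‖ ≤ 2 * ‖Real.pi‖ * (‖y j‖ * ‖fiberKernel a w p y‖) :=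
              le_mul_of_one_le_left (by positivity) hpi
          _ = _ := by rw [← mul_assoc, e]
          _ ≤ ‖(p.1 : ℂ) * fiberKernel (partialXi j a) w p y‖ +
              ‖fiberKernel a (partialXi j w) p y‖ := norm_add_le _ _
          _ ≤ _ := by rw [norm_mul, Complex.norm_real]; gcongr
      have := h1 j p hp y
      have := h2 j p hp y
      nlinarith
    calc bracket y ^ (L + 1) * ‖fiberKernel a w p y‖
        = bracket y ^ L * (bracket y * ‖fiberKernel a w p y‖) := by ring
      _ ≤ bracket y ^ L * ((1 + ∑ j, ‖y j‖) * ‖fiberKernel a w p y‖) := by gcongr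
      _ = bracket y ^ L * ‖fiberKernel a w p y‖ +
          ∑ j, bracket y ^ L * (‖y j‖ * ‖fiberKernel a w p y‖) := by
        rw [add_mul, one_mul, mul_add, Finset.sum_mul, Finset.mul_sum]
      _ ≤ C * W + ∑ j, (2 * D j + K j) * W :=
        add_le_add ((h0 p hp y).trans_eq (by rw [hW]; ring)) (Finset.sum_le_sum fun j _ => hj j)
      _ = _ := by rw [← Finset.sum_mul, hW]; ring

theorem fiberKernel_decay (ha : a ∈ symbolClass σ ω m q) (hw : w ∈ symbolClass σ ω r 0)
    (hT : Admissible n T m r s) (L : ℝ) : ∃ C : ℝ, 0 < C ∧ ∀ p : ℝ × (𝔼 × 𝔼), p.1 ∈ T → ∀ y : 𝔼,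
      ‖fiberKernel a w p y‖ ≤
        C * bracket (inner ℝ σ p.2.1 + ω) ^ q * bracket p.2.2 ^ s * bracket y ^ (-L) := by
  obtain ⟨N, hN⟩ := exists_nat_ge L
  obtain ⟨C, hC, h⟩ := fiberKernel_decay_nat ha hw hT N
  refine ⟨C, hC, fun p hp y => ?_⟩
  have h1 := h p hp y
  have h2 := bracket_rpow_mono y hN
  rw [Real.rpow_natCast] at h2
  rw [Real.rpow_neg (bracket_pos y).le, ← div_eq_mul_inv, le_div_iff₀ (bracket_rpow_pos y L),
    mul_comm]
  exact (mul_le_mul_of_nonneg_right h2 (norm_nonneg _)).trans h1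

theorem continuous_fiberKernel (ha : a ∈ symbolClass σ ω m q) (hw : w ∈ symbolClass σ ω r 0)
    (hT : Admissible n T m r s) {p : ℝ × (𝔼 × 𝔼)} (hp : p.1 ∈ T) :
    Continuous (fiberKernel a w p) :=
  continuous_fourier (integrable_fiberAmp ha hw hT hp)

end Kernel

/-! ### Dependence of the kernel on the parameters -/

section ParamDerivative

variable {n : ℕ}

local notation "𝔼" => EuclideanSpace ℝ (Fin n)

/-- The coordinates of the parameter `(t, (x, ξ))`. -/
noncomputable def paramCoord : Option (Fin n ⊕ Fin n) → (ℝ × (𝔼 × 𝔼)) →L[ℝ] ℝ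
  | none => ContinuousLinearMap.fst ℝ ℝ (𝔼 × 𝔼)
  | some (Sum.inl j) => (EuclideanSpace.proj j : 𝔼 →L[ℝ] ℝ) ∘L
      ContinuousLinearMap.fst ℝ 𝔼 𝔼 ∘L ContinuousLinearMap.snd ℝ ℝ (𝔼 × 𝔼)
  | some (Sum.inr j) => (EuclideanSpace.proj j : 𝔼 →L[ℝ] ℝ) ∘L
      ContinuousLinearMap.snd ℝ 𝔼 𝔼 ∘L ContinuousLinearMap.snd ℝ ℝ (𝔼 × 𝔼)

/-- The differential of a function of `(t, (x, ξ))` with prescribed partial derivatives. -/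
noncomputable def paramCLM (c : Option (Fin n ⊕ Fin n) → ℂ) : (ℝ × (𝔼 × 𝔼)) →L[ℝ] ℂ :=
  ∑ i, (paramCoord i).smulRight (c i)

theorem paramCLM_apply (c : Option (Fin n ⊕ Fin n) → ℂ) (v : ℝ × (𝔼 × 𝔼)) :
    paramCLM c v = v.1 * c none + (∑ j, (v.2.1 j : ℂ) * c (some (Sum.inl j)) +
      ∑ j, (v.2.2 j : ℂ) * c (some (Sum.inr j))) := by
  simp [paramCLM, Fintype.sum_option, Fintype.sum_sum_type, paramCoord]

/-- The effect of `∂_t`, `∂_{x_j}`, `∂_{ξ_j}` on an expression `G a w` formed bilinearly from the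
amplitude `a(x, ξ + tη) w(η)`. -/
noncomputable def paramPartial {X : Type*} [AddCommMonoid X]
    (G : (𝔼 × 𝔼 → ℂ) → (𝔼 × 𝔼 → ℂ) → X)
    (a w : 𝔼 × 𝔼 → ℂ) : Option (Fin n ⊕ Fin n) → X
  | none => ∑ j, G (partialXi j a) (coordXi j * w)
  | some (Sum.inl j) => G (partialX j a) w
  | some (Sum.inr j) => G (partialXi j a) w

variable {T : Set ℝ} {m m' r s : ℝ}
  {σ : EuclideanSpace ℝ (Fin n)} {ω q q' : ℝ}
  {a a' b b' w w' : EuclideanSpace ℝ (Fin n) × EuclideanSpace ℝ (Fin n) → ℂ}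

/-- By the chain rule `∂_t` brings out a factor `η_j` along with each `∂_{ξ_j} a`; it is absorbed
into the weight. -/
theorem hasFDerivAt_fiberAmp_param (ha : Differentiable ℝ a) (p : ℝ × (𝔼 × 𝔼)) (η : 𝔼) :
    HasFDerivAt (fun p => fiberAmp a w p η)
      (paramCLM fun i => paramPartial fiberAmp a w i p η) p := by
  have h1 : HasFDerivAt (fun p : ℝ × (𝔼 × 𝔼) => (p.2.1, p.2.2 + p.1 • η))
      ((ContinuousLinearMap.fst ℝ 𝔼 𝔼 ∘L ContinuousLinearMap.snd ℝ ℝ (𝔼 × 𝔼)).prod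
        (ContinuousLinearMap.snd ℝ 𝔼 𝔼 ∘L ContinuousLinearMap.snd ℝ ℝ (𝔼 × 𝔼) +
          (ContinuousLinearMap.fst ℝ ℝ (𝔼 × 𝔼)).smulRight η)) p :=
    ((ContinuousLinearMap.fst ℝ 𝔼 𝔼 ∘L ContinuousLinearMap.snd ℝ ℝ (𝔼 × 𝔼)).prod
        (ContinuousLinearMap.snd ℝ 𝔼 𝔼 ∘L ContinuousLinearMap.snd ℝ ℝ (𝔼 × 𝔼) +
          (ContinuousLinearMap.fst ℝ ℝ (𝔼 × 𝔼)).smulRight η)).hasFDerivAt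
  have h2 : HasFDerivAt (fun p => fiberAmp a w p η) _ p :=
    ((ha _).hasFDerivAt.comp p h1).mul_const (w (0, η))
  refine h2.congr_fderiv (ContinuousLinearMap.ext fun v => ?_)
  rw [paramCLM_apply]
  simp only [smul_apply, ContinuousLinearMap.comp_apply, fderiv_prod_eq_sum, smul_eq_mul,
    paramPartial, Finset.sum_apply, Finset.mul_sum, ← Finset.sum_add_distrib]
  refine Finset.sum_congr rfl fun j _ => ?_
  simp [fiberAmp, coordXi]
  ring

theorem coordXi_mul_mem_symbolClass (hw : w ∈ symbolClass σ ω r q) (j : Fin n) :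
    coordXi j * w ∈ symbolClass σ ω (r + 1) q :=
  symbolClass_mono (mul_mem_symbolClass (coordXi_mem_symbolClass j) hw) (by linarith) (by simp)

/-- A property that is closed under addition passes from `G a w` to its parameter derivatives; the
weight may grow by one order because of the `t`-derivative. -/
theorem paramPartial_induction {X : Type*} [AddCommMonoid X] {P : X → Prop} (h0 : P 0)
    (hadd : ∀ u v, P u → P v → P (u + v)) {G : (𝔼 × 𝔼 → ℂ) → (𝔼 × 𝔼 → ℂ) → X}
    (hG : ∀ a ∈ symbolClass σ ω m q, ∀ w ∈ symbolClass σ ω (r + 1) 0, P (G a w))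
    (ha : a ∈ symbolClass σ ω m q) (hw : w ∈ symbolClass σ ω r 0) (i : Option (Fin n ⊕ Fin n)) :
    P (paramPartial G a w i) := by
  have h1 := fun j => symbolClass_mono (partialXi_mem_symbolClass ha j)
    (show m - 1 ≤ m by linarith) le_rfl
  have h2 := fun j => symbolClass_mono (partialX_mem_symbolClass ha j)
    le_rfl (show q - 1 ≤ q by linarith)
  have h3 := symbolClass_mono hw (show r ≤ r + 1 by linarith) le_rfl
  match i with
  | none =>
    exact Finset.sum_induction _ P hadd h0 fun j _ =>
      hG _ (h1 j) _ (coordXi_mul_mem_symbolClass hw j)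
  | some (Sum.inl j) => exact hG _ (h2 j) _ h3
  | some (Sum.inr j) => exact hG _ (h1 j) _ h3

/-- A family `F` of functions on `ℝⁿ` indexed by the parameters `(t, (x, ξ))`, dominated by an
integrable function of `y` with a constant that is locally bounded in the parameters. -/
def DecayFamily (T : Set ℝ) (σ : 𝔼) (ω m q : ℝ) (F : ℝ × (𝔼 × 𝔼) → 𝔼 → ℂ) : Prop :=
  (∀ p : ℝ × (𝔼 × 𝔼), p.1 ∈ T → Continuous (F p)) ∧
  ∃ C : ℝ, 0 < C ∧ ∀ p : ℝ × (𝔼 × 𝔼), p.1 ∈ T → ∀ y : 𝔼, ‖F p y‖ ≤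
    C * bracket (inner ℝ σ p.2.1 + ω) ^ q * bracket p.2.2 ^ m * bracket y ^ (-((n : ℝ) + 1))

namespace DecayFamily

variable {F F₁ F₂ : ℝ × (EuclideanSpace ℝ (Fin n) × EuclideanSpace ℝ (Fin n)) →
  EuclideanSpace ℝ (Fin n) → ℂ}

theorem zero : DecayFamily T σ ω m q 0 := by
  refine ⟨fun _ _ => continuous_const, 1, one_pos, fun p _ y => ?_⟩
  have h3 := bracket_rpow_pos (inner ℝ σ p.2.1 + ω) q
  have h4 := bracket_rpow_pos p.2.2 m
  have h5 := bracket_rpow_pos y (-((n : ℝ) + 1))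
  simp only [Pi.zero_apply, norm_zero]
  positivity

theorem add (h₁ : DecayFamily T σ ω m q F₁) (h₂ : DecayFamily T σ ω m q F₂) :
    DecayFamily T σ ω m q (F₁ + F₂) := by
  obtain ⟨hc₁, C, hC, h₁⟩ := h₁
  obtain ⟨hc₂, D, hD, h₂⟩ := h₂
  refine ⟨fun p hp => (hc₁ p hp).add (hc₂ p hp), C + D, by positivity, fun p hp y => ?_⟩
  have := h₁ p hp y
  have := h₂ p hp y
  refine (norm_add_le _ _).trans ?_
  linarith

theorem integrable (h : DecayFamily T σ ω m q F) {p : ℝ × (𝔼 × 𝔼)} (hp : p.1 ∈ T) :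
    Integrable (F p) := by
  obtain ⟨hc, C, -, h⟩ := h
  exact (integrable_bracket_decay.const_mul _).mono' (hc p hp).aestronglyMeasurable
    (Filter.Eventually.of_forall (h p hp))

theorem exists_dominating (h : DecayFamily T σ ω m q F) {p₀ : ℝ × (𝔼 × 𝔼)} (hp : T ∈ nhds p₀.1) :
    ∃ U ∈ nhds p₀, (∀ p ∈ U, T ∈ nhds p.1) ∧ ∃ C : ℝ, 0 ≤ C ∧ ∀ p ∈ U, ∀ y : 𝔼,
      ‖F p y‖ ≤ C * bracket y ^ (-((n : ℝ) + 1)) := by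
  obtain ⟨-, C, hC, h⟩ := h
  have hcont : Continuous fun p : ℝ × (𝔼 × 𝔼) =>
      C * bracket (inner ℝ σ p.2.1 + ω) ^ q * bracket p.2.2 ^ m :=
    (continuous_const.mul ((continuous_bracket_rpow q).comp
      (f := fun p : ℝ × (𝔼 × 𝔼) => inner ℝ σ p.2.1 + ω) (by fun_prop))).mul
      ((continuous_bracket_rpow m).comp (f := fun p : ℝ × (𝔼 × 𝔼) => p.2.2) (by fun_prop))
  have h1 := hcont.continuousAt.eventually_lt_const
    (lt_add_one (C * bracket (inner ℝ σ p₀.2.1 + ω) ^ q * bracket p₀.2.2 ^ m))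
  have h2 : ∀ᶠ p : ℝ × (𝔼 × 𝔼) in nhds p₀, T ∈ nhds p.1 :=
    continuous_fst.continuousAt.eventually (eventually_mem_nhds_iff.mpr hp)
  refine ⟨_, h2.and h1, fun p hp => hp.1,
    C * bracket (inner ℝ σ p₀.2.1 + ω) ^ q * bracket p₀.2.2 ^ m + 1, ?_, fun p hp y => ?_⟩
  · have h3 := bracket_rpow_pos (inner ℝ σ p₀.2.1 + ω) q
    have h4 := bracket_rpow_pos p₀.2.2 m
    positivity
  · exact (h p (mem_of_mem_nhds hp.1) y).trans
      (mul_le_mul_of_nonneg_right hp.2.le (bracket_rpow_pos _ _).le)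

/-- Differentiation in `(t, (x, ξ))` under the integral sign, against a bounded factor `e`. -/
theorem hasFDerivAt_integral {F' : Option (Fin n ⊕ Fin n) → ℝ × (𝔼 × 𝔼) → 𝔼 → ℂ}
    (hF : DecayFamily T σ ω m q F) (hF' : ∀ i, DecayFamily T σ ω m q (F' i))
    (hd : ∀ p : ℝ × (𝔼 × 𝔼), T ∈ nhds p.1 → ∀ y,
      HasFDerivAt (fun p => F p y) (paramCLM fun i => F' i p y) p)
    {e : 𝔼 → ℂ} (he : Continuous e) (he' : ∀ y, ‖e y‖ ≤ 1)
    {p₀ : ℝ × (𝔼 × 𝔼)} (hp : T ∈ nhds p₀.1) :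
    HasFDerivAt (fun p => ∫ y, e y * F p y) (paramCLM fun i => ∫ y, e y * F' i p₀ y) p₀ := by
  choose U hU hUT C hC hb using fun i => (hF' i).exists_dominating hp
  have hUI : (⋂ i, U i) ∈ nhds p₀ := Filter.iInter_mem.mpr hU
  have hnhds : ∀ p ∈ ⋂ i, U i, T ∈ nhds p.1 := fun p hp => hUT none p (Set.mem_iInter.mp hp none)
  have hmem : ∀ p ∈ ⋂ i, U i, p.1 ∈ T := fun p hp => mem_of_mem_nhds (hnhds p hp)
  refine hasFDerivAt_integral_of_partials (ι := Option (Fin n ⊕ Fin n)) (φ := paramCoord)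
    (F := fun p y => e y * F p y) (F' := fun i p y => e y * F' i p y)
    (g := fun y => (∑ i, C i) * bracket y ^ (-((n : ℝ) + 1))) hUI ?_ ?_ ?_ ?_
    (integrable_bracket_decay.const_mul _) ?_
  · intro p hp y
    refine ((hd p (hnhds p hp) y).const_mul (e y)).congr_fderiv
      (ContinuousLinearMap.ext fun v => ?_)
    change _ = paramCLM (fun i => e y * F' i p y) v
    simp only [smul_apply, paramCLM_apply, smul_eq_mul, mul_add, Finset.mul_sum]
    congr 1
    · ring
    · congr 1 <;> exact Finset.sum_congr rfl fun j _ => by ring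
  · exact fun p hp => (he.mul (hF.1 p (hmem p hp))).aestronglyMeasurable
  · refine (hF.integrable (mem_of_mem_nhds hp)).norm.mono'
      (he.mul (hF.1 p₀ (mem_of_mem_nhds hp))).aestronglyMeasurable
      (Filter.Eventually.of_forall fun y => ?_)
    rw [norm_mul]
    exact mul_le_of_le_one_left (norm_nonneg _) (he' y)
  · exact fun i => (he.mul ((hF' i).1 p₀ (mem_of_mem_nhds hp))).aestronglyMeasurable
  · intro i p hp y
    rw [norm_mul]
    refine (mul_le_of_le_one_left (norm_nonneg _) (he' y)).trans
      ((hb i p (Set.mem_iInter.mp hp i) y).trans ?_)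
    exact mul_le_mul_of_nonneg_right
      (Finset.single_le_sum (f := C) (fun i _ => hC i) (Finset.mem_univ i))
      (bracket_rpow_pos _ _).le

end DecayFamily

theorem decayFamily_fiberAmp (ha : a ∈ symbolClass σ ω m q) (hw : w ∈ symbolClass σ ω r 0)
    (hT : Admissible n T m r s) : DecayFamily T σ ω s q (fiberAmp a w) :=
  ⟨fun p _ => continuous_fiberAmp ha.1.continuous hw.1.continuous p, fiberAmp_bound ha hw hT⟩

theorem paramPartial_fiberKernel (ha : a ∈ symbolClass σ ω m q) (hw : w ∈ symbolClass σ ω r 0)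
    (hT : Admissible n T m (r + 1) s) {p : ℝ × (𝔼 × 𝔼)} (hp : p.1 ∈ T) (y : 𝔼)
    (i : Option (Fin n ⊕ Fin n)) :
    𝓕 (paramPartial fiberAmp a w i p) y = paramPartial fiberKernel a w i p y := by
  match i with
  | none =>
    simp only [paramPartial, Finset.sum_apply]
    have h1 : ∑ j, fiberAmp (partialXi j a) (coordXi j * w) p = fun η =>
        ∑ j, fiberAmp (partialXi j a) (coordXi j * w) p η := by
      funext η; simp [Finset.sum_apply]
    rw [h1, fourier_sum_apply _ fun j => integrable_fiberAmp (partialXi_mem_symbolClass ha j)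
      (coordXi_mul_mem_symbolClass hw j) (hT.mono (by linarith) le_rfl) hp]
    rfl
  | some (Sum.inl j) => rfl
  | some (Sum.inr j) => rfl

theorem hasFDerivAt_fiberKernel_param (ha : a ∈ symbolClass σ ω m q)
    (hw : w ∈ symbolClass σ ω r 0) (hT : Admissible n T m (r + 1) s) {p : ℝ × (𝔼 × 𝔼)}
    (hp : T ∈ nhds p.1) (y : 𝔼) : HasFDerivAt (fun p => fiberKernel a w p y)
      (paramCLM fun i => paramPartial fiberKernel a w i p y) p := by
  have key := (decayFamily_fiberAmp ha hw (hT.mono le_rfl (by linarith))).hasFDerivAt_integral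
    (F' := paramPartial fiberAmp a w)
    (paramPartial_induction .zero (fun _ _ => .add)
      (fun a ha w hw => decayFamily_fiberAmp ha hw hT) ha hw)
    (fun p _ η => hasFDerivAt_fiberAmp_param (differentiable_of_mem_symbolClass ha) p η)
    (e := fun η => ((Real.fourierChar (-inner ℝ η y) : Circle) : ℂ)) (by fun_prop)
    (fun η => (Circle.norm_coe _).le) hp
  simp only [← paramPartial_fiberKernel ha hw hT (mem_of_mem_nhds hp), fiberKernel,
    Real.fourier_eq, Circle.smul_def, smul_eq_mul]
  exact key

end ParamDerivative

/-! ### Composition with an integrable weight -/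

section WeightedComp

variable {n : ℕ}

local notation "𝔼" => EuclideanSpace ℝ (Fin n)

variable {T : Set ℝ} {m₁ m₂ r s : ℝ}
  {σ : EuclideanSpace ℝ (Fin n)} {ω q₁ q₂ : ℝ}
  {a a' b b' w w' : EuclideanSpace ℝ (Fin n) × EuclideanSpace ℝ (Fin n) → ℂ}

/-- The integrand of `weightedComp`. -/
noncomputable def compIntegrand (b a w : 𝔼 × 𝔼 → ℂ) (p : ℝ × (𝔼 × 𝔼)) (y : 𝔼) : ℂ :=
  fiberKernel a w p y * b (p.2.1 + y, p.2.2)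

/-- The iterated integral `∫∫ a(x, ξ + tη) w(η) b(x + y, ξ) e^{-2πi y·η} dη dy` at the parameter
`p = (t, (x, ξ))`. The second symbol comes first so that `weightedComp b` is bilinear in the
amplitude `a(x, ξ + tη) w(η)`. -/
noncomputable def weightedComp (b a w : 𝔼 × 𝔼 → ℂ) (p : ℝ × (𝔼 × 𝔼)) : ℂ :=
  ∫ y, compIntegrand b a w p y

/-- The decay of the kernel in `y` pays for replacing the weight `⟨σ·(x + y) + ω⟩` of the second
symbol by `⟨σ·x + ω⟩`. -/
theorem decayFamily_compIntegrand (ha : a ∈ symbolClass σ ω m₁ q₁)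
    (hb : b ∈ symbolClass σ ω m₂ q₂) (hw : w ∈ symbolClass σ ω r 0)
    (hT : Admissible n T m₁ r s) :
    DecayFamily T σ ω (s + m₂) (q₁ + q₂) (compIntegrand b a w) := by
  refine ⟨fun p hp => (continuous_fiberKernel ha hw hT hp).mul
    (hb.1.continuous.comp (by fun_prop)), ?_⟩
  obtain ⟨C, hC, h1⟩ := fiberKernel_decay ha hw hT (|q₂| + (n + 1))
  obtain ⟨D, hD, h2⟩ := symbolClass_bound hb
  obtain ⟨K, hK, h3⟩ := exists_bracket_inner_add_rpow_le σ ω q₂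
  refine ⟨C * D * K, by positivity, fun p hp y => ?_⟩
  have h4 := bracket_rpow_pos (inner ℝ σ p.2.1 + ω) q₁
  have h5 := bracket_rpow_pos p.2.2 s
  have h6 := bracket_rpow_pos p.2.2 m₂
  have h7 := bracket_rpow_pos y (-(|q₂| + ((n : ℝ) + 1)))
  calc ‖compIntegrand b a w p y‖ = ‖fiberKernel a w p y‖ * ‖b (p.2.1 + y, p.2.2)‖ := norm_mul _ _
    _ ≤ (C * bracket (inner ℝ σ p.2.1 + ω) ^ q₁ * bracket p.2.2 ^ s *
          bracket y ^ (-(|q₂| + ((n : ℝ) + 1)))) *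
        (D * bracket (inner ℝ σ (p.2.1 + y) + ω) ^ q₂ * bracket p.2.2 ^ m₂) :=
      mul_le_mul (h1 p hp y) (h2 _ _) (norm_nonneg _) (by positivity)
    _ ≤ (C * bracket (inner ℝ σ p.2.1 + ω) ^ q₁ * bracket p.2.2 ^ s *
          bracket y ^ (-(|q₂| + ((n : ℝ) + 1)))) *
        (D * (K * (bracket (inner ℝ σ p.2.1 + ω) ^ q₂ * bracket y ^ |q₂|)) *
          bracket p.2.2 ^ m₂) := by
      gcongr
      exact h3 _ _
    _ = C * D * K * (bracket (inner ℝ σ p.2.1 + ω) ^ q₁ * bracket (inner ℝ σ p.2.1 + ω) ^ q₂) *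
        (bracket p.2.2 ^ s * bracket p.2.2 ^ m₂) *
        (bracket y ^ (-(|q₂| + ((n : ℝ) + 1))) * bracket y ^ |q₂|) := by ring
    _ = _ := by
      rw [← bracket_rpow_add, ← bracket_rpow_add, ← bracket_rpow_add]
      congr 2
      ring

theorem integrable_compIntegrand (ha : a ∈ symbolClass σ ω m₁ q₁)
    (hb : b ∈ symbolClass σ ω m₂ q₂) (hw : w ∈ symbolClass σ ω r 0)
    (hT : Admissible n T m₁ r s) {p : ℝ × (𝔼 × 𝔼)} (hp : p.1 ∈ T) :
    Integrable (compIntegrand b a w p) :=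
  (decayFamily_compIntegrand ha hb hw hT).integrable hp

theorem weightedComp_bound (ha : a ∈ symbolClass σ ω m₁ q₁)
    (hb : b ∈ symbolClass σ ω m₂ q₂) (hw : w ∈ symbolClass σ ω r 0)
    (hT : Admissible n T m₁ r s) : ∃ C : ℝ, 0 < C ∧ ∀ p : ℝ × (𝔼 × 𝔼), p.1 ∈ T →
      ‖weightedComp b a w p‖ ≤
        C * bracket (inner ℝ σ p.2.1 + ω) ^ (q₁ + q₂) * bracket p.2.2 ^ (s + m₂) := by
  obtain ⟨hc, C, hC, h⟩ := decayFamily_compIntegrand ha hb hw hT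
  have hI : 0 ≤ ∫ η : 𝔼, bracket η ^ (-((n : ℝ) + 1)) :=
    integral_nonneg fun η => (bracket_rpow_pos η _).le
  refine ⟨C * ((∫ η : 𝔼, bracket η ^ (-((n : ℝ) + 1))) + 1), by positivity, fun p hp => ?_⟩
  have h3 := bracket_rpow_pos (inner ℝ σ p.2.1 + ω) (q₁ + q₂)
  have h4 := bracket_rpow_pos p.2.2 (s + m₂)
  calc ‖weightedComp b a w p‖ ≤ ∫ y, ‖compIntegrand b a w p y‖ := norm_integral_le_integral_norm _
    _ ≤ ∫ y, C * bracket (inner ℝ σ p.2.1 + ω) ^ (q₁ + q₂) * bracket p.2.2 ^ (s + m₂) *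
        bracket y ^ (-((n : ℝ) + 1)) :=
      integral_mono (integrable_compIntegrand ha hb hw hT hp).norm
        (integrable_bracket_decay.const_mul _) (h p hp)
    _ = C * bracket (inner ℝ σ p.2.1 + ω) ^ (q₁ + q₂) * bracket p.2.2 ^ (s + m₂) *
        ∫ η : 𝔼, bracket η ^ (-((n : ℝ) + 1)) := integral_const_mul _ _
    _ ≤ C * bracket (inner ℝ σ p.2.1 + ω) ^ (q₁ + q₂) * bracket p.2.2 ^ (s + m₂) *
        ((∫ η : 𝔼, bracket η ^ (-((n : ℝ) + 1))) + 1) := by gcongr; linarith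
    _ = _ := by ring

/-- The effect of `∂_t`, `∂_{x_j}`, `∂_{ξ_j}` on the factor `b(x + y, ξ)` of an expression
`G b`. -/
noncomputable def secondPartial {X : Type*} [Zero X] (G : (𝔼 × 𝔼 → ℂ) → X) (b : 𝔼 × 𝔼 → ℂ) :
    Option (Fin n ⊕ Fin n) → X
  | none => 0
  | some (Sum.inl j) => G (partialX j b)
  | some (Sum.inr j) => G (partialXi j b)

theorem hasFDerivAt_compIntegrand (ha : a ∈ symbolClass σ ω m₁ q₁)
    (hb : Differentiable ℝ b) (hw : w ∈ symbolClass σ ω r 0)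
    (hT : Admissible n T m₁ (r + 1) s) {p : ℝ × (𝔼 × 𝔼)} (hp : T ∈ nhds p.1) (y : 𝔼) :
    HasFDerivAt (fun p => compIntegrand b a w p y)
      (paramCLM fun i => (paramPartial (compIntegrand b) a w i +
        secondPartial (fun b => compIntegrand b a w) b i) p y) p := by
  have h1 : HasFDerivAt (fun p : ℝ × (𝔼 × 𝔼) => (p.2.1 + y, p.2.2))
      (ContinuousLinearMap.snd ℝ ℝ (𝔼 × 𝔼)) p := by
    have := (ContinuousLinearMap.snd ℝ ℝ (𝔼 × 𝔼)).hasFDerivAt (x := p) |>.add_const (y, 0)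
    refine this.congr_of_eventuallyEq (Filter.Eventually.of_forall fun p => ?_)
    exact Prod.ext rfl (add_zero _).symm
  have h2 : HasFDerivAt (fun p => compIntegrand b a w p y) _ p :=
    (hasFDerivAt_fiberKernel_param ha hw hT hp y).mul ((hb _).hasFDerivAt.comp p h1)
  refine h2.congr_fderiv (ContinuousLinearMap.ext fun v => ?_)
  simp only [add_apply, smul_apply, ContinuousLinearMap.comp_apply, paramCLM_apply,
    fderiv_prod_eq_sum, smul_eq_mul, paramPartial, secondPartial, compIntegrand,
    Pi.add_apply, Pi.zero_apply, Finset.sum_apply, mul_add, Finset.sum_add_distrib,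
    Finset.mul_sum, ContinuousLinearMap.coe_snd']
  simp only [mul_zero, add_zero]
  have e : ∀ (f g : Fin n → ℂ), (∀ j, f j = g j) → ∑ j, f j = ∑ j, g j :=
    fun f g h => Finset.sum_congr rfl fun j _ => h j
  have e1 := e (fun j => b (p.2.1 + y, p.2.2) *
    ((v.1 : ℂ) * fiberKernel (partialXi j a) (coordXi j * w) p y)) (fun j => (v.1 : ℂ) *
    (fiberKernel (partialXi j a) (coordXi j * w) p y * b (p.2.1 + y, p.2.2))) fun j => by ring
  have e2 := e (fun j => b (p.2.1 + y, p.2.2) *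
    ((v.2.1 j : ℂ) * fiberKernel (partialX j a) w p y)) (fun j => (v.2.1 j : ℂ) *
    (fiberKernel (partialX j a) w p y * b (p.2.1 + y, p.2.2))) fun j => by ring
  have e3 := e (fun j => b (p.2.1 + y, p.2.2) *
    ((v.2.2 j : ℂ) * fiberKernel (partialXi j a) w p y)) (fun j => (v.2.2 j : ℂ) *
    (fiberKernel (partialXi j a) w p y * b (p.2.1 + y, p.2.2))) fun j => by ring
  have e4 := e (fun j => fiberKernel a w p y * ((v.2.1 j : ℂ) *
    partialX j b (p.2.1 + y, p.2.2))) (fun j => (v.2.1 j : ℂ) * (fiberKernel a w p y *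
    partialX j b (p.2.1 + y, p.2.2))) fun j => by ring
  have e5 := e (fun j => fiberKernel a w p y * ((v.2.2 j : ℂ) *
    partialXi j b (p.2.1 + y, p.2.2))) (fun j => (v.2.2 j : ℂ) * (fiberKernel a w p y *
    partialXi j b (p.2.1 + y, p.2.2))) fun j => by ring
  simp only [e1, e2, e3, e4, e5]
  ring

theorem decayFamily_partial_compIntegrand (ha : a ∈ symbolClass σ ω m₁ q₁)
    (hb : b ∈ symbolClass σ ω m₂ q₂) (hw : w ∈ symbolClass σ ω r 0)
    (hT : Admissible n T m₁ (r + 1) s) (i : Option (Fin n ⊕ Fin n)) :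
    DecayFamily T σ ω (s + m₂) (q₁ + q₂) (paramPartial (compIntegrand b) a w i) :=
  paramPartial_induction .zero (fun _ _ => .add)
    (fun _ ha _ hw => decayFamily_compIntegrand ha hb hw hT) ha hw i

theorem decayFamily_second_compIntegrand (ha : a ∈ symbolClass σ ω m₁ q₁)
    (hb : b ∈ symbolClass σ ω m₂ q₂) (hw : w ∈ symbolClass σ ω r 0)
    (hT : Admissible n T m₁ r s) (i : Option (Fin n ⊕ Fin n)) :
    DecayFamily T σ ω (s + m₂) (q₁ + q₂) (secondPartial (fun b => compIntegrand b a w) b i) :=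
  match i with
  | none => .zero
  | some (Sum.inl j) => decayFamily_compIntegrand ha (symbolClass_mono
      (partialX_mem_symbolClass hb j) le_rfl (by linarith)) hw hT
  | some (Sum.inr j) => decayFamily_compIntegrand ha (symbolClass_mono
      (partialXi_mem_symbolClass hb j) (by linarith) le_rfl) hw hT

theorem hasFDerivAt_weightedComp (ha : a ∈ symbolClass σ ω m₁ q₁)
    (hb : b ∈ symbolClass σ ω m₂ q₂) (hw : w ∈ symbolClass σ ω r 0)
    (hT : Admissible n T m₁ (r + 1) s) {p : ℝ × (𝔼 × 𝔼)} (hp : T ∈ nhds p.1) :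
    HasFDerivAt (weightedComp b a w) (paramCLM fun i => paramPartial (weightedComp b) a w i p +
      secondPartial (fun b => weightedComp b a w) b i p) p := by
  have hT' := hT.mono le_rfl (show r ≤ r + 1 by linarith)
  have hp' := mem_of_mem_nhds hp
  have d1 := decayFamily_partial_compIntegrand ha hb hw hT
  have d2 := decayFamily_second_compIntegrand ha hb hw hT'
  have key := (decayFamily_compIntegrand ha hb hw hT').hasFDerivAt_integral
    (F' := fun i => paramPartial (compIntegrand b) a w i +
      secondPartial (fun b => compIntegrand b a w) b i)
    (fun i => (d1 i).add (d2 i))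
    (fun p hp y => hasFDerivAt_compIntegrand ha (differentiable_of_mem_symbolClass hb) hw hT hp y)
    (e := fun _ => 1) continuous_const (by simp) hp
  simp only [one_mul] at key
  refine key.congr_fderiv ?_
  congr 1
  funext i
  rw [show (fun y => (paramPartial (compIntegrand b) a w i +
      secondPartial (fun b => compIntegrand b a w) b i) p y) = fun y =>
      paramPartial (compIntegrand b) a w i p y +
      secondPartial (fun b => compIntegrand b a w) b i p y from rfl,
    integral_add ((d1 i).integrable hp') ((d2 i).integrable hp')]
  congr 1
  · match i with
    | none =>
      simp only [paramPartial, Finset.sum_apply]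
      exact integral_finsetSum _ fun j _ => integrable_compIntegrand
        (partialXi_mem_symbolClass ha j) hb (coordXi_mul_mem_symbolClass hw j)
        (hT.mono (by linarith) le_rfl) hp'
    | some (Sum.inl j) => rfl
    | some (Sum.inr j) => rfl
  · match i with
    | none => simp [secondPartial]
    | some (Sum.inl j) => rfl
    | some (Sum.inr j) => rfl

theorem fiberKernel_add_left (ha : a ∈ symbolClass σ ω m₁ q₁) (ha' : a' ∈ symbolClass σ ω m₁ q₁)
    (hw : w ∈ symbolClass σ ω r 0) (hT : Admissible n T m₁ r s) {p : ℝ × (𝔼 × 𝔼)} (hp : p.1 ∈ T) :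
    fiberKernel (a + a') w p = fiberKernel a w p + fiberKernel a' w p := by
  funext y
  rw [Pi.add_apply, fiberKernel, fiberKernel, fiberKernel, ← fourier_add_apply
    (integrable_fiberAmp ha hw hT hp) (integrable_fiberAmp ha' hw hT hp)]
  exact congrArg (fun A : 𝔼 → ℂ => 𝓕 A y) (funext fun η => add_mul _ _ _)

theorem fiberKernel_add_right (ha : a ∈ symbolClass σ ω m₁ q₁) (hw : w ∈ symbolClass σ ω r 0)
    (hw' : w' ∈ symbolClass σ ω r 0) (hT : Admissible n T m₁ r s) {p : ℝ × (𝔼 × 𝔼)}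
    (hp : p.1 ∈ T) : fiberKernel a (w + w') p = fiberKernel a w p + fiberKernel a w' p := by
  funext y
  rw [Pi.add_apply, fiberKernel, fiberKernel, fiberKernel, ← fourier_add_apply
    (integrable_fiberAmp ha hw hT hp) (integrable_fiberAmp ha hw' hT hp)]
  exact congrArg (fun A : 𝔼 → ℂ => 𝓕 A y) (funext fun η => mul_add _ _ _)

theorem weightedComp_add_left (ha : a ∈ symbolClass σ ω m₁ q₁) (ha' : a' ∈ symbolClass σ ω m₁ q₁)
    (hb : b ∈ symbolClass σ ω m₂ q₂) (hw : w ∈ symbolClass σ ω r 0)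
    (hT : Admissible n T m₁ r s) {p : ℝ × (𝔼 × 𝔼)} (hp : p.1 ∈ T) :
    weightedComp b (a + a') w p = weightedComp b a w p + weightedComp b a' w p := by
  rw [weightedComp, weightedComp, weightedComp, ← integral_add
    (integrable_compIntegrand ha hb hw hT hp) (integrable_compIntegrand ha' hb hw hT hp)]
  congr 1
  funext y
  rw [compIntegrand, fiberKernel_add_left ha ha' hw hT hp]
  exact add_mul _ _ _

theorem weightedComp_add_weight (ha : a ∈ symbolClass σ ω m₁ q₁)
    (hb : b ∈ symbolClass σ ω m₂ q₂) (hw : w ∈ symbolClass σ ω r 0)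
    (hw' : w' ∈ symbolClass σ ω r 0)
    (hT : Admissible n T m₁ r s) {p : ℝ × (𝔼 × 𝔼)} (hp : p.1 ∈ T) :
    weightedComp b a (w + w') p = weightedComp b a w p + weightedComp b a w' p := by
  rw [weightedComp, weightedComp, weightedComp, ← integral_add
    (integrable_compIntegrand ha hb hw hT hp) (integrable_compIntegrand ha hb hw' hT hp)]
  congr 1
  funext y
  rw [compIntegrand, fiberKernel_add_right ha hw hw' hT hp]
  exact add_mul _ _ _

theorem weightedComp_add_right (ha : a ∈ symbolClass σ ω m₁ q₁)
    (hb : b ∈ symbolClass σ ω m₂ q₂) (hb' : b' ∈ symbolClass σ ω m₂ q₂)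
    (hw : w ∈ symbolClass σ ω r 0)
    (hT : Admissible n T m₁ r s) {p : ℝ × (𝔼 × 𝔼)} (hp : p.1 ∈ T) :
    weightedComp (b + b') a w p = weightedComp b a w p + weightedComp b' a w p := by
  rw [weightedComp, weightedComp, weightedComp, ← integral_add
    (integrable_compIntegrand ha hb hw hT hp) (integrable_compIntegrand ha hb' hw hT hp)]
  congr 1
  funext y
  exact mul_add _ _ _

theorem weightedComp_smul_right (c : ℂ) (p : ℝ × (𝔼 × 𝔼)) :
    weightedComp (c • b) a w p = c * weightedComp b a w p := by
  rw [weightedComp, weightedComp, ← integral_const_mul]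
  congr 1
  funext y
  simp only [compIntegrand, Pi.smul_apply, smul_eq_mul]
  ring

theorem weightedComp_zero_right (p : ℝ × (𝔼 × 𝔼)) : weightedComp 0 a w p = 0 := by
  simp [weightedComp, compIntegrand]

theorem weightedComp_zero_weight (p : ℝ × (𝔼 × 𝔼)) : weightedComp b a 0 p = 0 := by
  have h : fiberAmp a 0 p = fun _ => 0 := by funext η; simp [fiberAmp]
  simp [weightedComp, compIntegrand, fiberKernel, h, Real.fourier_eq]

theorem weightedComp_sum_right {ι : Type*} (S : Finset ι) {f : ι → 𝔼 × 𝔼 → ℂ}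
    (ha : a ∈ symbolClass σ ω m₁ q₁) (hf : ∀ i, f i ∈ symbolClass σ ω m₂ q₂)
    (hw : w ∈ symbolClass σ ω r 0)
    (hT : Admissible n T m₁ r s) {p : ℝ × (𝔼 × 𝔼)} (hp : p.1 ∈ T) :
    weightedComp (∑ i ∈ S, f i) a w p = ∑ i ∈ S, weightedComp (f i) a w p := by
  classical
  induction S using Finset.induction_on with
  | empty => simpa using weightedComp_zero_right p
  | insert i S hi ih =>
    rw [Finset.sum_insert hi, Finset.sum_insert hi,
      weightedComp_add_right ha (hf i) (sum_mem_symbolClass S hf) hw hT hp, ih]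

theorem weightedComp_sum_weight {ι : Type*} (S : Finset ι) {f : ι → 𝔼 × 𝔼 → ℂ}
    (ha : a ∈ symbolClass σ ω m₁ q₁) (hb : b ∈ symbolClass σ ω m₂ q₂)
    (hf : ∀ i, f i ∈ symbolClass σ ω r 0)
    (hT : Admissible n T m₁ r s) {p : ℝ × (𝔼 × 𝔼)} (hp : p.1 ∈ T) :
    weightedComp b a (∑ i ∈ S, f i) p = ∑ i ∈ S, weightedComp b a (f i) p := by
  classical
  induction S using Finset.induction_on with
  | empty => simpa using weightedComp_zero_weight p
  | insert i S hi ih =>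
    rw [Finset.sum_insert hi, Finset.sum_insert hi,
      weightedComp_add_weight ha hb (hf i) (sum_mem_symbolClass S hf) hT hp, ih]

/-- The operator `D_{x_j} = (2πi)⁻¹ ∂_{x_j}`. -/
noncomputable def dX (j : Fin n) (b : 𝔼 × 𝔼 → ℂ) : 𝔼 × 𝔼 → ℂ :=
  (2 * Real.pi * Complex.I)⁻¹ • partialX j b

theorem dX_mem_symbolClass (hb : b ∈ symbolClass σ ω m₂ q₂) (j : Fin n) :
    dX j b ∈ symbolClass σ ω m₂ (q₂ - 1) :=
  smul_mem_symbolClass (partialX_mem_symbolClass hb j) _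

theorem dX_mem_symbolClass' (hb : b ∈ symbolClass σ ω m₂ q₂) (j : Fin n) :
    dX j b ∈ symbolClass σ ω m₂ q₂ :=
  symbolClass_mono (dX_mem_symbolClass hb j) le_rfl (by linarith)

theorem hasFDerivAt_translate (hb : Differentiable ℝ b) (x ξ y : 𝔼) :
    HasFDerivAt (fun y => b (x + y, ξ)) (gradientCLM fun j => partialX j b (x + y, ξ)) y := by
  have h1 : HasFDerivAt (fun y : 𝔼 => (x + y, ξ))
      ((ContinuousLinearMap.id ℝ 𝔼).prod (0 : 𝔼 →L[ℝ] 𝔼)) y :=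
    ((hasFDerivAt_id y).const_add x).prodMk (hasFDerivAt_const _ _)
  refine ((hb _).hasFDerivAt.comp y h1).congr_fderiv (ContinuousLinearMap.ext fun v => ?_)
  rw [gradientCLM_apply, ContinuousLinearMap.comp_apply, fderiv_prod_eq_sum]
  simp

/-- Integration by parts in `y`: a factor `η_j` in the weight can be traded for `D_{x_j}` acting on
the second symbol. -/
theorem weightedComp_coordXi_mul (ha : a ∈ symbolClass σ ω m₁ q₁)
    (hb : b ∈ symbolClass σ ω m₂ q₂) (hw : w ∈ symbolClass σ ω r 0)
    (hT : Admissible n T m₁ (r + 1) s) {p : ℝ × (𝔼 × 𝔼)} (hp : p.1 ∈ T) (j : Fin n) :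
    weightedComp b a (coordXi j * w) p = weightedComp (dX j b) a w p := by
  have hT' := hT.mono le_rfl (show r ≤ r + 1 by linarith)
  have hw' := fun j => coordXi_mul_mem_symbolClass hw j
  have e : ∀ j, (fun η : 𝔼 => (η j : ℂ) * fiberAmp a w p η) = fiberAmp a (coordXi j * w) p := by
    intro j
    funext η
    simp only [fiberAmp, Pi.mul_apply, coordXi]
    ring
  have h1 := hasFDerivAt_fourier_gradientCLM (integrable_fiberAmp ha hw hT' hp) (fun j => by
    rw [e j]; exact integrable_fiberAmp ha (hw' j) hT hp)
  have i1 := integrable_compIntegrand ha hb (hw' j) hT hp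
  have i2 := integrable_compIntegrand ha (partialX_mem_symbolClass hb j) hw hT' hp
  have i3 := integrable_compIntegrand ha hb hw hT' hp
  have key := integral_mul_partial h1
    (hasFDerivAt_translate (differentiable_of_mem_symbolClass hb) p.2.1 p.2.2) j
    (by
      rw [e j]
      refine (i1.const_mul (-(2 * Real.pi * Complex.I))).congr
        (Filter.Eventually.of_forall fun y => ?_)
      exact (mul_assoc _ _ _).symm) i2 i3
  rw [e j] at key
  have h2 : weightedComp (partialX j b) a w p =
      2 * Real.pi * Complex.I * weightedComp b a (coordXi j * w) p := by
    refine key.trans ?_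
    rw [weightedComp, ← integral_const_mul, ← integral_neg]
    congr 1
    funext y
    simp only [compIntegrand, fiberKernel]
    ring
  rw [dX, weightedComp_smul_right, h2, ← mul_assoc, inv_mul_cancel₀ Complex.two_pi_I_ne_zero,
    one_mul]

end WeightedComp

/-! ### The oscillatory integral for the composed symbol -/

section Regularized

variable {n : ℕ}

local notation "𝔼" => EuclideanSpace ℝ (Fin n)

variable {T : Set ℝ} {m₁ m₂ r s : ℝ}
  {σ : EuclideanSpace ℝ (Fin n)} {ω q₁ q₂ : ℝ}
  {a a' b b' w w' : EuclideanSpace ℝ (Fin n) × EuclideanSpace ℝ (Fin n) → ℂ}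

theorem contDiff_dX (hb : ContDiff ℝ (⊤ : ℕ∞) b) (j : Fin n) : ContDiff ℝ (⊤ : ℕ∞) (dX j b) :=
  contDiff_const.smul (contDiff_partialX hb j)

theorem partialX_dX (hb : ContDiff ℝ (⊤ : ℕ∞) b) (i j : Fin n) :
    partialX i (dX j b) = dX j (partialX i b) := by
  rw [dX, partialX_smul ((contDiff_partialX hb j).differentiable (by simp)),
    partialX_partialX_comm hb]
  rfl

theorem partialXi_dX (hb : ContDiff ℝ (⊤ : ℕ∞) b) (i j : Fin n) :
    partialXi i (dX j b) = dX j (partialXi i b) := by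
  rw [dX, partialXi_smul ((contDiff_partialX hb j).differentiable (by simp)),
    partialXi_partialX_comm hb]
  rfl

theorem dX_dX_comm (hb : ContDiff ℝ (⊤ : ℕ∞) b) (i j : Fin n) :
    dX i (dX j b) = dX j (dX i b) := by
  rw [dX, partialX_dX hb, dX, dX, dX, partialX_smul
    ((contDiff_partialX hb i).differentiable (by simp))]

theorem dX_add (hb : Differentiable ℝ b) (hb' : Differentiable ℝ b') (j : Fin n) :
    dX j (b + b') = dX j b + dX j b' := by
  rw [dX, partialX_add hb hb', smul_add]; rfl

theorem dX_sum {ι : Type*} (S : Finset ι) {f : ι → 𝔼 × 𝔼 → ℂ}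
    (hf : ∀ i, Differentiable ℝ (f i)) (j : Fin n) :
    dX j (∑ i ∈ S, f i) = ∑ i ∈ S, dX j (f i) := by
  rw [dX, partialX_sum S hf, Finset.smul_sum]; rfl

theorem dX_coordXi_mul (hb : Differentiable ℝ b) (i j : Fin n) :
    dX i (coordXi j * b) = coordXi j * dX i b := by
  rw [dX, partialX_mul (fun z => (hasFDerivAt_coordXi j z).differentiableAt) hb, partialX_coordXi,
    zero_mul, zero_add, dX, mul_smul_comm]

/-- The operator `1 - Δ_x / 4π²`. -/
noncomputable def besselX (b : 𝔼 × 𝔼 → ℂ) : 𝔼 × 𝔼 → ℂ := b + ∑ j, dX j (dX j b)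

theorem besselX_mem_symbolClass (hb : b ∈ symbolClass σ ω m₂ q₂) :
    besselX b ∈ symbolClass σ ω m₂ q₂ :=
  add_mem_symbolClass hb (sum_mem_symbolClass _ fun j =>
    dX_mem_symbolClass' (dX_mem_symbolClass' hb j) j)

theorem besselX_iterate_mem_symbolClass (hb : b ∈ symbolClass σ ω m₂ q₂) (M : ℕ) :
    besselX^[M] b ∈ symbolClass σ ω m₂ q₂ := by
  induction M with
  | zero => exact hb
  | succ M ih => rw [Function.iterate_succ_apply']; exact besselX_mem_symbolClass ih

theorem contDiff_besselX (hb : ContDiff ℝ (⊤ : ℕ∞) b) : ContDiff ℝ (⊤ : ℕ∞) (besselX b) := by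
  unfold besselX
  refine hb.add ?_
  have : ∑ j, dX j (dX j b) = fun z => ∑ j, dX j (dX j b) z := by
    funext z; simp [Finset.sum_apply]
  rw [this]
  exact ContDiff.sum fun j _ => contDiff_dX (contDiff_dX hb j) j

/-- An additive operator that commutes with every `D_{x_j}` commutes with powers of `besselX`. -/
theorem besselX_iterate_comm {Q : (𝔼 × 𝔼 → ℂ) → 𝔼 × 𝔼 → ℂ}
    (hadd : ∀ b b', ContDiff ℝ (⊤ : ℕ∞) b → ContDiff ℝ (⊤ : ℕ∞) b' → Q (b + b') = Q b + Q b')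
    (hsum : ∀ f : Fin n → 𝔼 × 𝔼 → ℂ, (∀ j, ContDiff ℝ (⊤ : ℕ∞) (f j)) →
      Q (∑ j, f j) = ∑ j, Q (f j))
    (hc : ∀ b, ContDiff ℝ (⊤ : ℕ∞) b → ∀ j, Q (dX j b) = dX j (Q b))
    (hb : ContDiff ℝ (⊤ : ℕ∞) b) (M : ℕ) : besselX^[M] (Q b) = Q (besselX^[M] b) := by
  induction M generalizing b with
  | zero => rfl
  | succ M ih =>
    rw [Function.iterate_succ_apply, Function.iterate_succ_apply, ← ih (contDiff_besselX hb)]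
    congr 1
    have h1 := fun j => contDiff_dX hb j
    have h2 := fun j => contDiff_dX (h1 j) j
    rw [besselX, besselX, show b + ∑ j, dX j (dX j b) = b + (besselX b - b) by
      rw [besselX]; abel]
    have h3 : besselX b - b = ∑ j, dX j (dX j b) := by rw [besselX]; abel
    rw [hadd _ _ hb (by rw [h3, ← h3]; exact (contDiff_besselX hb).sub hb), h3, hsum _ h2]
    simp only [hc _ (h1 _), hc _ hb]

theorem partialX_besselX_iterate (hb : ContDiff ℝ (⊤ : ℕ∞) b) (M : ℕ) (j : Fin n) :
    besselX^[M] (partialX j b) = partialX j (besselX^[M] b) :=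
  besselX_iterate_comm (Q := partialX j)
    (fun _ _ h h' => partialX_add (h.differentiable (by simp)) (h'.differentiable (by simp)) j)
    (fun _ h => partialX_sum _ (fun i => (h i).differentiable (by simp)) j)
    (fun _ h i => partialX_dX h j i) hb M

theorem partialXi_besselX_iterate (hb : ContDiff ℝ (⊤ : ℕ∞) b) (M : ℕ) (j : Fin n) :
    besselX^[M] (partialXi j b) = partialXi j (besselX^[M] b) :=
  besselX_iterate_comm (Q := partialXi j)
    (fun _ _ h h' => partialXi_add (h.differentiable (by simp)) (h'.differentiable (by simp)) j)
    (fun _ h => partialXi_sum _ (fun i => (h i).differentiable (by simp)) j)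
    (fun _ h i => partialXi_dX h j i) hb M

theorem dX_besselX_iterate (hb : ContDiff ℝ (⊤ : ℕ∞) b) (M : ℕ) (j : Fin n) :
    besselX^[M] (dX j b) = dX j (besselX^[M] b) :=
  besselX_iterate_comm (Q := dX j)
    (fun _ _ h h' => dX_add (h.differentiable (by simp)) (h'.differentiable (by simp)) j)
    (fun _ h => dX_sum _ (fun i => (h i).differentiable (by simp)) j)
    (fun _ h i => dX_dX_comm h j i) hb M

theorem coordXi_mul_besselX_iterate (hb : ContDiff ℝ (⊤ : ℕ∞) b) (M : ℕ) (j : Fin n) :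
    besselX^[M] (coordXi j * b) = coordXi j * besselX^[M] b :=
  besselX_iterate_comm (Q := fun b => coordXi j * b)
    (fun _ _ _ _ => mul_add _ _ _) (fun _ _ => Finset.mul_sum _ _ _)
    (fun _ h i => (dX_coordXi_mul (h.differentiable (by simp)) i j).symm) hb M

theorem besselX_iterate_add (hb : ContDiff ℝ (⊤ : ℕ∞) b) (hb' : ContDiff ℝ (⊤ : ℕ∞) b') (M : ℕ) :
    besselX^[M] (b + b') = besselX^[M] b + besselX^[M] b' := by
  induction M generalizing b b' with
  | zero => rfl
  | succ M ih =>
    simp only [Function.iterate_succ_apply]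
    rw [← ih (contDiff_besselX hb) (contDiff_besselX hb')]
    congr 1
    have h1 := fun j => dX_add (hb.differentiable (by simp)) (hb'.differentiable (by simp)) j
    have h2 := fun j => dX_add ((contDiff_dX hb j).differentiable (by simp))
      ((contDiff_dX hb' j).differentiable (by simp)) j
    simp only [besselX, h1, h2, Finset.sum_add_distrib]
    abel

/-- Trading a factor `⟨η⟩⁻²` in the weight for `1 - Δ_x / 4π²` on the second symbol leaves the
integral unchanged, since `⟨η⟩⁻² + ∑ η_j² ⟨η⟩⁻² = 1`. -/
theorem weightedComp_besselX (ha : a ∈ symbolClass σ ω m₁ q₁)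
    (hb : b ∈ symbolClass σ ω m₂ q₂) (hw : w ∈ symbolClass σ ω r 0)
    (hT : Admissible n T m₁ r s) {p : ℝ × (𝔼 × 𝔼)} (hp : p.1 ∈ T) :
    weightedComp (besselX b) a (invBracketSq * w) p = weightedComp b a w p := by
  have hv : invBracketSq * w ∈ symbolClass σ ω (r - 2) 0 :=
    symbolClass_mono (mul_mem_symbolClass invBracketSq_mem_symbolClass hw) (by linarith) (by simp)
  set v := invBracketSq * w with hv_def
  have h1 := fun j => coordXi_mul_mem_symbolClass hv j
  have h2 := fun j => symbolClass_mono (coordXi_mul_mem_symbolClass (h1 j) j)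
    (show r - 2 + 1 + 1 ≤ r by linarith) le_rfl
  have hv' := symbolClass_mono hv (show r - 2 ≤ r by linarith) le_rfl
  have e : w = v + ∑ j, coordXi j * (coordXi j * v) := by
    have := congrArg (· * w) (invBracketSq_add_sum (n := n))
    simp only [add_mul, Finset.sum_mul, one_mul, mul_assoc] at this
    exact this.symm
  conv_rhs => rw [e]
  rw [weightedComp_add_weight ha hb hv' (sum_mem_symbolClass _ h2) hT hp,
    weightedComp_sum_weight _ ha hb h2 hT hp, besselX,
    weightedComp_add_right ha hb (sum_mem_symbolClass _ fun j =>
      dX_mem_symbolClass' (dX_mem_symbolClass' hb j) j) hv' hT hp,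
    weightedComp_sum_right _ ha (fun j => dX_mem_symbolClass' (dX_mem_symbolClass' hb j) j)
      hv' hT hp]
  congr 1
  refine Finset.sum_congr rfl fun j _ => ?_
  rw [weightedComp_coordXi_mul ha hb (h1 j) (hT.mono le_rfl (by linarith)) hp,
    weightedComp_coordXi_mul ha (dX_mem_symbolClass' hb j) hv (hT.mono le_rfl (by linarith)) hp]

/-- The oscillatory integral `∫∫ a(x, ξ + tη) b(x + y, ξ) e^{-2πi y·η} dη dy`, regularized by
trading `⟨η⟩^{-2M}` for `(1 - Δ_x / 4π²)^M` acting on `b`. -/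
noncomputable def regComp (M : ℕ) (a b : 𝔼 × 𝔼 → ℂ) (p : ℝ × (𝔼 × 𝔼)) : ℂ :=
  weightedComp (besselX^[M] b) a (invBracketSq ^ M) p

theorem regComp_succ (ha : a ∈ symbolClass σ ω m₁ q₁)
    (hb : b ∈ symbolClass σ ω m₂ q₂) {M : ℕ} (hT : Admissible n T m₁ (-(2 * M)) s)
    {p : ℝ × (𝔼 × 𝔼)} (hp : p.1 ∈ T) : regComp (M + 1) a b p = regComp M a b p := by
  rw [regComp, Function.iterate_succ_apply', pow_succ']
  exact weightedComp_besselX ha (besselX_iterate_mem_symbolClass hb M)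
    (invBracketSq_pow_mem_symbolClass M) hT hp

theorem regComp_eq_of_le (ha : a ∈ symbolClass σ ω m₁ q₁)
    (hb : b ∈ symbolClass σ ω m₂ q₂) {M N : ℕ} (hMN : M ≤ N)
    (hT : Admissible n T m₁ (-(2 * M)) s) {p : ℝ × (𝔼 × 𝔼)} (hp : p.1 ∈ T) :
    regComp N a b p = regComp M a b p := by
  induction N, hMN using Nat.le_induction with
  | base => rfl
  | succ N hN ih =>
    rw [regComp_succ ha hb (hT.mono le_rfl ?_) hp, ih]
    have : (M : ℝ) ≤ N := by exact_mod_cast hN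
    linarith

/-- The symbol `∫∫ a(x, ξ + tη) b(x + y, ξ) e^{-2πi y·η} dη dy`, understood as an oscillatory
integral: the value that the regularized integrals `regComp M` take for all large `M`. For `t = 1`
it is the symbol of `Ψ_a Ψ_b`, for `t = 0` it is the product `a b`. -/
noncomputable def symbolComp (t : ℝ) (a b : 𝔼 × 𝔼 → ℂ) (z : 𝔼 × 𝔼) : ℂ :=
  Filter.limUnder Filter.atTop fun M => regComp M a b (t, z)

theorem symbolComp_eq_regComp (ha : a ∈ symbolClass σ ω m₁ q₁)
    (hb : b ∈ symbolClass σ ω m₂ q₂) {M : ℕ} (hT : Admissible n T m₁ (-(2 * M)) s)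
    {t : ℝ} (ht : t ∈ T) (z : 𝔼 × 𝔼) : symbolComp t a b z = regComp M a b (t, z) := by
  refine Filter.Tendsto.limUnder_eq (tendsto_const_nhds.congr' ?_)
  filter_upwards [Filter.eventually_ge_atTop M] with N hN
  exact (regComp_eq_of_le ha hb hN hT ht).symm

/-- The bound is uniform in `t`; this is what the Taylor expansion in `t` rests on. -/
theorem symbolComp_bound (ha : a ∈ symbolClass σ ω m₁ q₁) (hb : b ∈ symbolClass σ ω m₂ q₂) :
    ∃ C : ℝ, 0 < C ∧ ∀ t ∈ Set.Icc (-2 : ℝ) 2, ∀ x ξ : 𝔼, ‖symbolComp t a b (x, ξ)‖ ≤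
      C * bracket (inner ℝ σ x + ω) ^ (q₁ + q₂) * bracket ξ ^ (m₁ + m₂) := by
  obtain ⟨M, hM⟩ := exists_nat_ge (|m₁| + n + 1)
  have hT : Admissible n (Set.Icc (-2) 2) m₁ (-(2 * M)) m₁ :=
    admissible_Icc (by linarith [(Nat.cast_nonneg M : (0 : ℝ) ≤ M)])
  obtain ⟨C, hC, h⟩ := weightedComp_bound ha (besselX_iterate_mem_symbolClass hb M)
    (invBracketSq_pow_mem_symbolClass M) hT
  refine ⟨C, hC, fun t ht x ξ => ?_⟩
  rw [symbolComp_eq_regComp ha hb hT ht]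
  exact h (t, (x, ξ)) ht

theorem symbolComp_add_left (ha : a ∈ symbolClass σ ω m₁ q₁) (ha' : a' ∈ symbolClass σ ω m₁ q₁)
    (hb : b ∈ symbolClass σ ω m₂ q₂) {t : ℝ} (ht : t ∈ Set.Icc (-2 : ℝ) 2) :
    symbolComp t (a + a') b = symbolComp t a b + symbolComp t a' b := by
  obtain ⟨M, hM⟩ := exists_nat_ge (|m₁| + n + 1)
  have hT : Admissible n (Set.Icc (-2) 2) m₁ (-(2 * M)) m₁ :=
    admissible_Icc (by linarith [(Nat.cast_nonneg M : (0 : ℝ) ≤ M)])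
  funext z
  rw [Pi.add_apply, symbolComp_eq_regComp (add_mem_symbolClass ha ha') hb hT ht,
    symbolComp_eq_regComp ha hb hT ht, symbolComp_eq_regComp ha' hb hT ht]
  exact weightedComp_add_left ha ha' (besselX_iterate_mem_symbolClass hb M)
    (invBracketSq_pow_mem_symbolClass M) hT ht

/-- The partial derivatives of `(t, (x, ξ)) ↦ symbolComp t a b (x, ξ)`. -/
noncomputable def symbolCompPartial (a b : 𝔼 × 𝔼 → ℂ) (t : ℝ) (z : 𝔼 × 𝔼) :
    Option (Fin n ⊕ Fin n) → ℂ
  | none => ∑ j, symbolComp t (partialXi j a) (dX j b) z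
  | some (Sum.inl j) => symbolComp t (partialX j a) b z + symbolComp t a (partialX j b) z
  | some (Sum.inr j) => symbolComp t (partialXi j a) b z + symbolComp t a (partialXi j b) z

/-- All parameter derivatives of `symbolComp` at once. The factors `η_j` brought out by `∂_t` become
`D_{x_j}` on the second symbol, by integration by parts in `y`. -/
theorem hasFDerivAt_symbolComp (ha : a ∈ symbolClass σ ω m₁ q₁)
    (hb : b ∈ symbolClass σ ω m₂ q₂) {p : ℝ × (𝔼 × 𝔼)} (hp : p.1 ∈ Set.Ioo (-2 : ℝ) 2) :
    HasFDerivAt (fun p => symbolComp p.1 a b p.2)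
      (paramCLM (symbolCompPartial a b p.1 p.2)) p := by
  -- Two more orders than for absolute convergence: one for the factor `η_j`, one because
  -- `partialXi j a` has order `m₁ - 1`, whose absolute value may be `|m₁| + 1`.
  obtain ⟨M, hM⟩ := exists_nat_ge (|m₁| + n + 3)
  have hM0 : (0 : ℝ) ≤ M := Nat.cast_nonneg M
  have hT1 : Admissible n (Set.Icc (-2) 2) m₁ (-(2 * M) + 1) m₁ :=
    admissible_Icc (by linarith)
  have hT : Admissible n (Set.Icc (-2) 2) m₁ (-(2 * M)) m₁ := hT1.mono le_rfl (by linarith)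
  have habs : |m₁ - 1| ≤ |m₁| + 1 := (abs_sub _ _).trans (by simp)
  have hT' : Admissible n (Set.Icc (-2) 2) (m₁ - 1) (-(2 * M)) (m₁ - 1) :=
    admissible_Icc (by linarith)
  have hn : Set.Icc (-2 : ℝ) 2 ∈ nhds p.1 := Icc_mem_nhds hp.1 hp.2
  have hp' := mem_of_mem_nhds hn
  have hJ := besselX_iterate_mem_symbolClass hb M
  have hW := invBracketSq_pow_mem_symbolClass (σ := σ) (ω := ω) M
  have key := hasFDerivAt_weightedComp ha hJ hW hT1 hn
  have hev : (fun p : ℝ × (𝔼 × 𝔼) => symbolComp p.1 a b p.2) =ᶠ[nhds p]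
      weightedComp (besselX^[M] b) a (invBracketSq ^ M) := by
    filter_upwards [continuous_fst.continuousAt.eventually hn] with u hu
    exact symbolComp_eq_regComp ha hb hT hu u.2
  refine (key.congr_of_eventuallyEq hev).congr_fderiv ?_
  congr 1
  funext i
  match i with
  | none =>
    simp only [paramPartial, secondPartial, symbolCompPartial, Finset.sum_apply, Pi.zero_apply,
      add_zero]
    refine Finset.sum_congr rfl fun j _ => ?_
    rw [symbolComp_eq_regComp (partialXi_mem_symbolClass ha j) (dX_mem_symbolClass hb j) hT' hp',
      regComp, dX_besselX_iterate hb.1]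
    exact weightedComp_coordXi_mul (partialXi_mem_symbolClass ha j) hJ hW
      (hT1.mono (by linarith) le_rfl) hp' j
  | some (Sum.inl j) =>
    simp only [paramPartial, secondPartial, symbolCompPartial]
    rw [symbolComp_eq_regComp (partialX_mem_symbolClass ha j) hb hT hp',
      symbolComp_eq_regComp ha (partialX_mem_symbolClass hb j) hT hp', regComp, regComp,
      partialX_besselX_iterate hb.1]
  | some (Sum.inr j) =>
    simp only [paramPartial, secondPartial, symbolCompPartial]
    rw [symbolComp_eq_regComp (partialXi_mem_symbolClass ha j) hb hT' hp',
      symbolComp_eq_regComp ha (partialXi_mem_symbolClass hb j) hT hp', regComp, regComp,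
      partialXi_besselX_iterate hb.1]

theorem hasFDerivAt_symbolComp_snd (ha : a ∈ symbolClass σ ω m₁ q₁)
    (hb : b ∈ symbolClass σ ω m₂ q₂) {t : ℝ} (ht : t ∈ Set.Ioo (-2 : ℝ) 2) (z : 𝔼 × 𝔼) :
    HasFDerivAt (symbolComp t a b)
      (paramCLM (symbolCompPartial a b t z) ∘L ContinuousLinearMap.inr ℝ ℝ (𝔼 × 𝔼)) z :=
  (hasFDerivAt_symbolComp ha hb (p := (t, z)) ht).comp z (hasFDerivAt_prodMk_right t z)

theorem differentiable_symbolComp (ha : a ∈ symbolClass σ ω m₁ q₁)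
    (hb : b ∈ symbolClass σ ω m₂ q₂) {t : ℝ} (ht : t ∈ Set.Ioo (-2 : ℝ) 2) :
    Differentiable ℝ (symbolComp t a b) :=
  fun z => (hasFDerivAt_symbolComp_snd ha hb ht z).differentiableAt

theorem sum_single_mul (c : Fin n → ℂ) (j : Fin n) :
    ∑ i, ((Pi.single j (1 : ℝ) : Fin n → ℝ) i : ℂ) * c i = c j :=
  (gradientCLM_apply c (EuclideanSpace.single j 1)).symm.trans (gradientCLM_single c j)

theorem partialX_symbolComp (ha : a ∈ symbolClass σ ω m₁ q₁)
    (hb : b ∈ symbolClass σ ω m₂ q₂) {t : ℝ} (ht : t ∈ Set.Ioo (-2 : ℝ) 2) (j : Fin n) :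
    partialX j (symbolComp t a b) =
      symbolComp t (partialX j a) b + symbolComp t a (partialX j b) := by
  funext z
  rw [partialX, (hasFDerivAt_symbolComp_snd ha hb ht z).fderiv, ContinuousLinearMap.comp_apply,
    paramCLM_apply]
  simpa [symbolCompPartial, -PiLp.single_apply] using sum_single_mul _ j

theorem partialXi_symbolComp (ha : a ∈ symbolClass σ ω m₁ q₁)
    (hb : b ∈ symbolClass σ ω m₂ q₂) {t : ℝ} (ht : t ∈ Set.Ioo (-2 : ℝ) 2) (j : Fin n) :
    partialXi j (symbolComp t a b) =
      symbolComp t (partialXi j a) b + symbolComp t a (partialXi j b) := by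
  funext z
  rw [partialXi, (hasFDerivAt_symbolComp_snd ha hb ht z).fderiv, ContinuousLinearMap.comp_apply,
    paramCLM_apply]
  simpa [symbolCompPartial, -PiLp.single_apply] using sum_single_mul _ j

/-- Differentiation in `t`, which drives the asymptotic expansion: each `t`-derivative lowers both
orders of the symbol by one. -/
theorem hasDerivAt_symbolComp (ha : a ∈ symbolClass σ ω m₁ q₁)
    (hb : b ∈ symbolClass σ ω m₂ q₂) {t : ℝ} (ht : t ∈ Set.Ioo (-2 : ℝ) 2) (z : 𝔼 × 𝔼) :
    HasDerivAt (fun t => symbolComp t a b z)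
      (∑ j, symbolComp t (partialXi j a) (dX j b) z) t := by
  have h := (hasFDerivAt_symbolComp ha hb (p := (t, z)) ht).comp_hasDerivAt t
    ((hasDerivAt_id t).prodMk (hasDerivAt_const t z))
  refine h.congr_deriv ?_
  simp [paramCLM_apply, symbolCompPartial]

/-- The symbolic form of `Ψ_{ξ_j a} = Ψ_a D_j`. -/
theorem symbolComp_coordXi_mul (ha : a ∈ symbolClass σ ω m₁ q₁)
    (hb : b ∈ symbolClass σ ω m₂ q₂) (j : Fin n) :
    symbolComp 1 (coordXi j * a) b = symbolComp 1 a (coordXi j * b + dX j b) := by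
  obtain ⟨M, hM⟩ := exists_nat_ge (|m₁| + n + 3)
  have hM0 : (0 : ℝ) ≤ M := Nat.cast_nonneg M
  have hT1 : Admissible n (Set.Icc (-2) 2) m₁ (-(2 * M) + 1) m₁ :=
    admissible_Icc (by linarith)
  have hT : Admissible n (Set.Icc (-2) 2) m₁ (-(2 * M)) m₁ := hT1.mono le_rfl (by linarith)
  have habs : |m₁ + 1| ≤ |m₁| + 1 := (abs_add_le _ _).trans (by simp)
  have hT' : Admissible n (Set.Icc (-2) 2) (m₁ + 1) (-(2 * M)) (m₁ + 1) :=
    admissible_Icc (by linarith)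
  have h1 : (1 : ℝ) ∈ Set.Icc (-2 : ℝ) 2 := by norm_num
  have ha' : coordXi j * a ∈ symbolClass σ ω (m₁ + 1) q₁ :=
    symbolClass_mono (mul_mem_symbolClass (coordXi_mem_symbolClass j) ha) (by linarith) (by simp)
  have hb' : coordXi j * b ∈ symbolClass σ ω (m₂ + 1) q₂ :=
    symbolClass_mono (mul_mem_symbolClass (coordXi_mem_symbolClass j) hb) (by linarith) (by simp)
  have hd := symbolClass_mono (dX_mem_symbolClass' hb j) (show m₂ ≤ m₂ + 1 by linarith) le_rfl
  have hJ := besselX_iterate_mem_symbolClass hb M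
  have hW := invBracketSq_pow_mem_symbolClass (σ := σ) (ω := ω) M
  have hW' := coordXi_mul_mem_symbolClass hW j
  funext z
  rw [symbolComp_eq_regComp ha' hb hT' h1, symbolComp_eq_regComp ha (add_mem_symbolClass hb' hd)
    hT h1, regComp, regComp, besselX_iterate_add hb'.1 hd.1,
    weightedComp_add_right ha (besselX_iterate_mem_symbolClass hb' M)
      (besselX_iterate_mem_symbolClass hd M) hW hT h1, coordXi_mul_besselX_iterate hb.1,
    dX_besselX_iterate hb.1, ← weightedComp_coordXi_mul ha hJ hW hT1 h1]
  -- At `t = 1` the factor splits as `(ξ + η)_j = ξ_j + η_j`.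
  have hJ' : coordXi j * besselX^[M] b ∈ symbolClass σ ω (m₂ + 1) q₂ :=
    symbolClass_mono (mul_mem_symbolClass (coordXi_mem_symbolClass j) hJ) (by linarith) (by simp)
  rw [weightedComp, weightedComp, weightedComp, ← integral_add
    (integrable_compIntegrand ha hJ' hW hT h1) (integrable_compIntegrand ha hJ hW' hT1 h1)]
  congr 1
  funext y
  have e : fiberAmp (coordXi j * a) (invBracketSq ^ M) (1, z) = fun η =>
      (z.2 j : ℂ) * fiberAmp a (invBracketSq ^ M) (1, z) η +
        fiberAmp a (coordXi j * invBracketSq ^ M) (1, z) η := by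
    funext η
    simp [fiberAmp, coordXi]
    ring
  simp only [compIntegrand, fiberKernel]
  rw [e, fourier_add_apply ((integrable_fiberAmp ha hW hT h1).const_mul _)
    (integrable_fiberAmp ha hW' hT1 h1), fourier_const_mul_apply]
  simp [coordXi]
  ring

end Regularized

/-! ### Action on the Schwartz space -/

section OscInt

variable {n : ℕ}

local notation "𝔼" => EuclideanSpace ℝ (Fin n)

variable {m q : ℝ} {σ : EuclideanSpace ℝ (Fin n)} {ω : ℝ}
  {c c' : EuclideanSpace ℝ (Fin n) × EuclideanSpace ℝ (Fin n) → ℂ}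

/-- The integral `∫ c(x, ξ) e^{2πi x·ξ} dξ`. For `c(x, ξ) = a(x, ξ) 𝓕 f(ξ)` it is `Ψ_a f(x)`. -/
noncomputable def oscInt (c : 𝔼 × 𝔼 → ℂ) (x : 𝔼) : ℂ :=
  ∫ ξ : 𝔼, c (x, ξ) * Complex.exp (2 * Real.pi * Complex.I * (inner ℝ x ξ : ℝ))

/-- The oscillatory integral is a `fiberKernel`, hence inherits its rapid decay. -/
theorem oscInt_eq_fiberKernel (c : 𝔼 × 𝔼 → ℂ) (x : 𝔼) :
    oscInt c x = fiberKernel c 1 (1, (x, 0)) (-x) := by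
  rw [oscInt, fiberKernel, Real.fourier_eq']
  congr 1
  funext ξ
  simp only [fiberAmp, zero_add, one_smul, Pi.one_apply, mul_one, smul_eq_mul, inner_neg_right,
    real_inner_comm x ξ]
  rw [mul_comm]
  congr 2
  push_cast
  ring

theorem oscInt_decay (hc : c ∈ symbolClass σ ω m q) (hm : m ≤ -((n : ℝ) + 1)) (L : ℝ) :
    ∃ C : ℝ, 0 < C ∧ ∀ x : 𝔼, ‖oscInt c x‖ ≤ C * bracket x ^ (-L) := by
  obtain ⟨C, hC, h1⟩ := fiberKernel_decay hc one_mem_symbolClass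
    (admissible_singleton_one hm le_rfl) (L + |q|)
  obtain ⟨D, hD, h2⟩ := exists_bracket_inner_rpow_le σ ω q
  refine ⟨C * D, by positivity, fun x => ?_⟩
  have h3 := h1 (1, (x, 0)) rfl (-x)
  have h4 := bracket_rpow_pos x (-(L + |q|))
  rw [oscInt_eq_fiberKernel]
  refine h3.trans ?_
  rw [bracket_neg, show bracket (0 : 𝔼) = 1 by simp [bracket], Real.one_rpow, mul_one]
  calc C * bracket (inner ℝ σ x + ω) ^ q * bracket x ^ (-(L + |q|))
      ≤ C * (D * bracket x ^ |q|) * bracket x ^ (-(L + |q|)) := by gcongr; exact h2 x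
    _ = C * D * (bracket x ^ |q| * bracket x ^ (-(L + |q|))) := by ring
    _ = _ := by rw [← bracket_rpow_add]; congr 2; ring

/-- The integrand of `oscInt`, as a function of parameters `(t, (x, ξ))` of which only `x`
matters. -/
noncomputable def oscAmp (c : 𝔼 × 𝔼 → ℂ) (p : ℝ × (𝔼 × 𝔼)) (y : 𝔼) : ℂ :=
  c (p.2.1, y) * Complex.exp (2 * Real.pi * Complex.I * (inner ℝ p.2.1 y : ℝ))

theorem norm_exp_two_pi_I_mul (r : ℝ) : ‖Complex.exp (2 * Real.pi * Complex.I * r)‖ = 1 := by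
  rw [show (2 * Real.pi * Complex.I * r : ℂ) = ((2 * Real.pi * r : ℝ) : ℂ) * Complex.I by
    push_cast; ring]
  exact Complex.norm_exp_ofReal_mul_I _

theorem decayFamily_oscAmp (hc : c ∈ symbolClass σ ω m q) (hm : m ≤ -((n : ℝ) + 1)) :
    DecayFamily Set.univ σ ω 0 q (oscAmp c) := by
  have hcont := hc.1.continuous
  refine ⟨fun p _ => by unfold oscAmp; fun_prop, ?_⟩
  obtain ⟨C, hC, h⟩ := symbolClass_bound (symbolClass_mono hc hm le_rfl)
  refine ⟨C, hC, fun p _ y => ?_⟩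
  rw [oscAmp, norm_mul, norm_exp_two_pi_I_mul, mul_one, Real.rpow_zero, mul_one]
  exact h _ _

theorem integrable_oscInt (hc : c ∈ symbolClass σ ω m q) (hm : m ≤ -((n : ℝ) + 1)) (x : 𝔼) :
    Integrable fun ξ : 𝔼 =>
      c (x, ξ) * Complex.exp (2 * Real.pi * Complex.I * (inner ℝ x ξ : ℝ)) :=
  (decayFamily_oscAmp hc hm).integrable (p := (0, (x, 0))) trivial

/-- The symbol of `D_j Ψ_c`. -/
theorem coordXi_mul_add_dX_mem (hc : c ∈ symbolClass σ ω m q) (j : Fin n) :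
    coordXi j * c + dX j c ∈ symbolClass σ ω (m + 1) q :=
  add_mem_symbolClass (coordXi_mul_mem_symbolClass hc j)
    (symbolClass_mono (dX_mem_symbolClass' hc j) (by linarith) le_rfl)

/-- Differentiation under the integral: `D_j` turns the amplitude `c` into `ξ_j c + D_{x_j} c`. -/
theorem hasFDerivAt_oscInt (hc : c ∈ symbolClass σ ω m q) (hm : m ≤ -((n : ℝ) + 2)) (x : 𝔼) :
    HasFDerivAt (oscInt c) (gradientCLM fun j =>
      2 * Real.pi * Complex.I * oscInt (coordXi j * c + dX j c) x) x := by
  set F' : Option (Fin n ⊕ Fin n) → ℝ × (𝔼 × 𝔼) → 𝔼 → ℂ := fun i => match i with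
    | none => 0
    | some (Sum.inl j) => oscAmp ((2 * Real.pi * Complex.I) • (coordXi j * c + dX j c))
    | some (Sum.inr j) => 0 with hF'
  have hd : ∀ p : ℝ × (𝔼 × 𝔼), ∀ y,
      HasFDerivAt (fun p => oscAmp c p y) (paramCLM fun i => F' i p y) p := by
    intro p y
    have h1 : HasFDerivAt (fun p : ℝ × (𝔼 × 𝔼) => (p.2.1, y))
        ((ContinuousLinearMap.fst ℝ 𝔼 𝔼 ∘L ContinuousLinearMap.snd ℝ ℝ (𝔼 × 𝔼)).prod 0) p :=
      (ContinuousLinearMap.fst ℝ 𝔼 𝔼 ∘L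
        ContinuousLinearMap.snd ℝ ℝ (𝔼 × 𝔼)).hasFDerivAt.prodMk (hasFDerivAt_const _ _)
    have h2 : HasFDerivAt (fun p : ℝ × (𝔼 × 𝔼) => inner ℝ p.2.1 y)
        ((innerSL ℝ y) ∘L ContinuousLinearMap.fst ℝ 𝔼 𝔼 ∘L
          ContinuousLinearMap.snd ℝ ℝ (𝔼 × 𝔼)) p := by
      simp only [real_inner_comm y]
      exact ((innerSL ℝ y) ∘L ContinuousLinearMap.fst ℝ 𝔼 𝔼 ∘L
          ContinuousLinearMap.snd ℝ ℝ (𝔼 × 𝔼)).hasFDerivAt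
    have h3 := ((Complex.ofRealCLM.hasFDerivAt.comp p h2).const_mul
      (2 * Real.pi * Complex.I)).cexp
    have h4 : HasFDerivAt (fun p => oscAmp c p y) _ p :=
      ((differentiable_of_mem_symbolClass hc _).hasFDerivAt.comp p h1).mul h3
    refine h4.congr_fderiv (ContinuousLinearMap.ext fun v => ?_)
    have h5 : inner ℝ y v.2.1 = ∑ j, v.2.1 j * y j := by
      simp [PiLp.inner_apply]
    rw [paramCLM_apply]
    simp only [hF', add_apply, smul_apply, ContinuousLinearMap.comp_apply, fderiv_prod_eq_sum,
      smul_eq_mul, Pi.zero_apply, mul_zero, Finset.sum_const_zero, add_zero, zero_add,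
      ContinuousLinearMap.prod_apply, zero_apply, Complex.ofRealCLM_apply,
      ContinuousLinearMap.coe_fst', ContinuousLinearMap.coe_snd', innerSL_apply_apply, h5,
      Complex.ofReal_sum, Finset.mul_sum, ← Finset.sum_add_distrib, Function.comp]
    refine Finset.sum_congr rfl fun j _ => ?_
    have h6 : (2 * Real.pi * Complex.I) * (2 * Real.pi * Complex.I)⁻¹ = 1 :=
      mul_inv_cancel₀ Complex.two_pi_I_ne_zero
    simp only [oscAmp, Pi.smul_apply, Pi.add_apply, Pi.mul_apply, dX, coordXi, smul_eq_mul,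
      mul_add, ← mul_assoc, h6, one_mul, PiLp.zero_apply, Complex.ofReal_zero, zero_mul, add_zero]
    push_cast
    ring
  have hc' := fun j => smul_mem_symbolClass (coordXi_mul_add_dX_mem hc j)
    (2 * Real.pi * Complex.I)
  have key := (decayFamily_oscAmp hc (by linarith)).hasFDerivAt_integral (F' := F')
    (fun i => match i with
      | none => .zero
      | some (Sum.inl j) => decayFamily_oscAmp (hc' j) (by linarith)
      | some (Sum.inr j) => .zero) (fun p _ y => hd p y) (e := fun _ => 1) continuous_const
    (by simp) (p₀ := (0, (x, 0))) Filter.univ_mem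
  simp only [one_mul] at key
  have h7 : HasFDerivAt (fun x : 𝔼 => ((0, (x, 0)) : ℝ × (𝔼 × 𝔼)))
      (ContinuousLinearMap.inr ℝ ℝ (𝔼 × 𝔼) ∘L ContinuousLinearMap.inl ℝ 𝔼 𝔼) x :=
    (ContinuousLinearMap.inr ℝ ℝ (𝔼 × 𝔼) ∘L ContinuousLinearMap.inl ℝ 𝔼 𝔼).hasFDerivAt
  refine (key.comp x h7).congr_fderiv (ContinuousLinearMap.ext fun v => ?_)
  rw [ContinuousLinearMap.comp_apply, paramCLM_apply, gradientCLM_apply]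
  simp only [hF', Pi.zero_apply, integral_zero, mul_zero, zero_add, add_zero,
    Finset.sum_const_zero, ContinuousLinearMap.comp_apply, ContinuousLinearMap.inl_apply,
    ContinuousLinearMap.inr_apply]
  refine Finset.sum_congr rfl fun j _ => congrArg _ ?_
  rw [oscInt, ← integral_const_mul]
  refine integral_congr_ae (Filter.Eventually.of_forall fun y => ?_)
  simp only [oscAmp, Pi.smul_apply, smul_eq_mul, mul_assoc]

theorem oscInt_add (hc : c ∈ symbolClass σ ω m q) (hc' : c' ∈ symbolClass σ ω m q)
    (hm : m ≤ -((n : ℝ) + 1)) : oscInt (c + c') = oscInt c + oscInt c' := by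
  funext x
  rw [Pi.add_apply, oscInt, oscInt, oscInt, ← integral_add (integrable_oscInt hc hm x)
    (integrable_oscInt hc' hm x)]
  congr 1
  funext ξ
  exact add_mul _ _ _

/-- Rapid decay of all derivatives, by induction on their order: the first derivatives are again
oscillatory integrals of the same kind. -/
theorem norm_iteratedFDeriv_oscInt (k : ℕ) (hc : ∀ m, c ∈ symbolClass σ ω m q) :
    ContDiff ℝ k (oscInt c) ∧ ∀ L : ℝ, ∃ C : ℝ, 0 < C ∧ ∀ x : 𝔼,
      ‖iteratedFDeriv ℝ k (oscInt c) x‖ ≤ C * bracket x ^ (-L) := by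
  induction k generalizing c with
  | zero =>
    have hd : Differentiable ℝ (oscInt c) := fun x =>
      (hasFDerivAt_oscInt (hc _) le_rfl x).differentiableAt
    refine ⟨contDiff_zero.mpr hd.continuous, fun L => ?_⟩
    simpa only [norm_iteratedFDeriv_zero] using oscInt_decay (hc _) le_rfl L
  | succ k ih =>
    have hc' : ∀ j, ∀ m, coordXi j * c + dX j c ∈ symbolClass σ ω m q := fun j m => by
      simpa using coordXi_mul_add_dX_mem (hc (m - 1)) j
    have ih' := fun j => ih (hc' j)
    have hf : fderiv ℝ (oscInt c) = fun x => ∑ j, ((ContinuousLinearMap.smulRightL ℝ 𝔼 ℂ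
        (EuclideanSpace.proj j)) ∘ ((2 * Real.pi * Complex.I) •
          oscInt (coordXi j * c + dX j c))) x :=
      funext fun x => (hasFDerivAt_oscInt (hc _) le_rfl x).fderiv
    have hs : ∀ j, ContDiff ℝ k ((2 * Real.pi * Complex.I) • oscInt (coordXi j * c + dX j c)) :=
      fun j => contDiff_const.smul (ih' j).1
    have hL : ∀ j, ContDiff ℝ k ((ContinuousLinearMap.smulRightL ℝ 𝔼 ℂ
        (EuclideanSpace.proj j)) ∘ ((2 * Real.pi * Complex.I) •
          oscInt (coordXi j * c + dX j c))) := fun j =>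
      (ContinuousLinearMap.smulRightL ℝ 𝔼 ℂ (EuclideanSpace.proj j)).contDiff.comp (hs j)
    constructor
    · rw [Nat.cast_succ, contDiff_succ_iff_fderiv]
      refine ⟨fun x => (hasFDerivAt_oscInt (hc _) le_rfl x).differentiableAt, by simp, ?_⟩
      rw [hf]
      exact ContDiff.sum fun j _ => hL j
    · intro L
      choose C hC h using fun j => (ih' j).2 L
      set K : Fin n → ℝ := fun j => ‖ContinuousLinearMap.smulRightL ℝ 𝔼 ℂ
        (EuclideanSpace.proj j)‖ * (‖(2 * Real.pi * Complex.I : ℂ)‖ * C j) with hK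
      have hK0 : ∀ j, 0 ≤ K j := fun j => by have := hC j; positivity
      have hS := Finset.sum_nonneg fun j (_ : j ∈ Finset.univ) => hK0 j
      refine ⟨∑ j, K j + 1, by linarith, fun x => ?_⟩
      rw [← norm_iteratedFDeriv_fderiv, hf, iteratedFDeriv_fun_sum_apply
        fun j _ => (hL j).contDiffAt]
      have hx := bracket_rpow_pos x (-L)
      calc _ ≤ ∑ j, K j * bracket x ^ (-L) := by
            refine (norm_sum_le _ _).trans (Finset.sum_le_sum fun j _ => ?_)
            refine ((ContinuousLinearMap.smulRightL ℝ 𝔼 ℂ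
              (EuclideanSpace.proj j)).norm_iteratedFDeriv_comp_left (hs j).contDiffAt
              le_rfl).trans ?_
            rw [iteratedFDeriv_const_smul_apply (ih' j).1.contDiffAt, norm_smul]
            refine (mul_le_mul_of_nonneg_left (mul_le_mul_of_nonneg_left (h j x)
              (norm_nonneg _)) (norm_nonneg _)).trans_eq ?_
            simp only [hK]
            ring
        _ ≤ _ := by rw [← Finset.sum_mul]; gcongr; linarith

/-- If `c` is rapidly decreasing in `ξ` together with its derivatives, then `oscInt c` is a
Schwartz function. -/
theorem exists_schwartz_eq_oscInt (hc : ∀ m, c ∈ symbolClass σ ω m q) :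
    ∃ g : 𝓢(𝔼, ℂ), ⇑g = oscInt c := by
  refine ⟨⟨oscInt c, contDiff_infty.mpr fun k => (norm_iteratedFDeriv_oscInt k hc).1,
    fun l k => ?_⟩, rfl⟩
  obtain ⟨C, hC, h⟩ := (norm_iteratedFDeriv_oscInt k hc).2 l
  refine ⟨C, fun x => ?_⟩
  have h1 : ‖x‖ ^ l ≤ bracket x ^ l := pow_le_pow_left₀ (norm_nonneg x) (norm_le_bracket x) l
  have h2 := pow_pos (bracket_pos x) l
  calc ‖x‖ ^ l * ‖iteratedFDeriv ℝ k (oscInt c) x‖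
      ≤ bracket x ^ l * (C * bracket x ^ (-(l : ℝ))) := by gcongr; exact h x
    _ = C := by
      rw [Real.rpow_neg (bracket_pos x).le, Real.rpow_natCast]
      field_simp

theorem schwartz_decay (u : 𝓢(𝔼, ℂ)) (L : ℝ) :
    ∃ C : ℝ, 0 < C ∧ ∀ ξ, ‖u ξ‖ ≤ C * bracket ξ ^ L := by
  obtain ⟨N, hN⟩ := exists_nat_ge (-L)
  set C := 2 ^ N * (Finset.Iic (N, 0)).sup (fun m => SchwartzMap.seminorm ℝ m.1 m.2) u with hC
  have h := fun ξ => SchwartzMap.one_add_le_sup_seminorm_apply (𝕜 := ℝ) (m := (N, 0)) (k := N)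
    (n := 0) le_rfl le_rfl u ξ
  have hC0 : 0 ≤ C := le_trans (by positivity) (h 0)
  refine ⟨C + 1, by positivity, fun ξ => ?_⟩
  have h1 := h ξ
  rw [norm_iteratedFDeriv_zero] at h1
  have h2 : bracket ξ ^ (-L) ≤ (1 + ‖ξ‖) ^ N := by
    refine (bracket_rpow_mono ξ hN).trans ?_
    rw [Real.rpow_natCast]
    exact pow_le_pow_left₀ (bracket_pos ξ).le (bracket_le_one_add_norm ξ) N
  have h3 : bracket ξ ^ (-L) * ‖u ξ‖ ≤ C :=
    (mul_le_mul_of_nonneg_right h2 (norm_nonneg _)).trans h1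
  have h4 := bracket_rpow_pos ξ L
  rw [Real.rpow_neg (bracket_pos ξ).le] at h3
  have h5 : ‖u ξ‖ ≤ C * bracket ξ ^ L := by
    rwa [inv_mul_le_iff₀ h4, mul_comm] at h3
  refine h5.trans ?_
  gcongr
  linarith

/-- A Schwartz function of `ξ` is a symbol of every order. -/
theorem schwartz_mem_symbolClass (u : 𝓢(𝔼, ℂ)) (m : ℝ) :
    (fun z : 𝔼 × 𝔼 => u z.2) ∈ symbolClass σ ω m 0 := by
  refine mem_symbolClass_iff.mpr fun k => ?_
  induction k generalizing u m with
  | zero =>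
    obtain ⟨C, hC, h⟩ := schwartz_decay u m
    exact ⟨C, hC, fun x ξ => by simpa using h ξ⟩
  | succ k ih =>
    have hd : ∀ z : 𝔼 × 𝔼, HasFDerivAt (fun z : 𝔼 × 𝔼 => u z.2)
        (fderiv ℝ u z.2 ∘L ContinuousLinearMap.snd ℝ 𝔼 𝔼) z := fun z =>
      (u.differentiableAt.hasFDerivAt).comp z hasFDerivAt_snd
    refine ⟨(ih u m).bound, fun z => (hd z).differentiableAt, fun j => ⟨?_, ?_⟩⟩
    · have : partialX j (fun z : 𝔼 × 𝔼 => u z.2) = 0 := by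
        funext z; simp [partialX, (hd z).fderiv]
      rw [this]
      exact .zero
    · convert ih (LineDeriv.lineDerivOp (EuclideanSpace.single j (1 : ℝ)) u) (m - 1) using 1
      funext z
      simp [partialXi, (hd z).fderiv, SchwartzMap.lineDerivOp_apply_eq_fderiv]

theorem mul_schwartz_mem_symbolClass (hc : c ∈ symbolClass σ ω m q) (u : 𝓢(𝔼, ℂ)) (m' : ℝ) :
    (c * fun z => u z.2) ∈ symbolClass σ ω m' q :=
  symbolClass_mono (mul_mem_symbolClass hc (schwartz_mem_symbolClass u (m' - m)))
    (by linarith) (by simp)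

theorem psiDO_eq_oscInt (a : 𝔼 × 𝔼 → ℂ) (f : 𝔼 → ℂ) :
    psiDO a f = oscInt (a * fun z => 𝓕 f z.2) := rfl

/-- Pseudo-differential operators map the Schwartz space to itself. -/
theorem exists_schwartz_eq_psiDO (hc : c ∈ symbolClass σ ω m q) (f : 𝓢(𝔼, ℂ)) :
    ∃ g : 𝓢(𝔼, ℂ), ⇑g = psiDO c f :=
  exists_schwartz_eq_oscInt (mul_schwartz_mem_symbolClass hc (𝓕 f))

end OscInt

/-! ### Composition of operators -/

section Composition

variable {n : ℕ}

local notation "𝔼" => EuclideanSpace ℝ (Fin n)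

variable {m m₁ m₂ q q₁ q₂ : ℝ} {σ : EuclideanSpace ℝ (Fin n)} {ω : ℝ}
  {a a' b c c' : EuclideanSpace ℝ (Fin n) × EuclideanSpace ℝ (Fin n) → ℂ}

/-- A bilinear operation on symbols that obeys the Leibniz rule maps symbol classes to symbol
classes as soon as it satisfies the zeroth order bounds. -/
theorem mem_symbolClass_of_leibniz {Q : (𝔼 × 𝔼 → ℂ) → (𝔼 × 𝔼 → ℂ) → 𝔼 × 𝔼 → ℂ} {d : ℝ}
    (hbound : ∀ {a b : 𝔼 × 𝔼 → ℂ} {m₁ q₁ m₂ q₂ : ℝ}, a ∈ symbolClass σ ω m₁ q₁ →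
      b ∈ symbolClass σ ω m₂ q₂ → SymbolBound σ ω (m₁ + m₂ - d) (q₁ + q₂ - d) (Q a b))
    (hdiff : ∀ {a b : 𝔼 × 𝔼 → ℂ} {m₁ q₁ m₂ q₂ : ℝ}, a ∈ symbolClass σ ω m₁ q₁ →
      b ∈ symbolClass σ ω m₂ q₂ → Differentiable ℝ (Q a b))
    (hX : ∀ {a b : 𝔼 × 𝔼 → ℂ} {m₁ q₁ m₂ q₂ : ℝ}, a ∈ symbolClass σ ω m₁ q₁ →
      b ∈ symbolClass σ ω m₂ q₂ → ∀ j,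
        partialX j (Q a b) = Q (partialX j a) b + Q a (partialX j b))
    (hXi : ∀ {a b : 𝔼 × 𝔼 → ℂ} {m₁ q₁ m₂ q₂ : ℝ}, a ∈ symbolClass σ ω m₁ q₁ →
      b ∈ symbolClass σ ω m₂ q₂ → ∀ j,
        partialXi j (Q a b) = Q (partialXi j a) b + Q a (partialXi j b))
    (ha : a ∈ symbolClass σ ω m₁ q₁) (hb : b ∈ symbolClass σ ω m₂ q₂) :
    Q a b ∈ symbolClass σ ω (m₁ + m₂ - d) (q₁ + q₂ - d) := by
  refine mem_symbolClass_iff.mpr fun k => ?_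
  induction k generalizing a b m₁ q₁ m₂ q₂ with
  | zero => exact hbound ha hb
  | succ k ih =>
    refine ⟨hbound ha hb, hdiff ha hb, fun j => ⟨?_, ?_⟩⟩
    · rw [hX ha hb]
      exact ((ih (partialX_mem_symbolClass ha j) hb).mono le_rfl (by linarith)).add
        ((ih ha (partialX_mem_symbolClass hb j)).mono le_rfl (by linarith))
    · rw [hXi ha hb]
      exact ((ih (partialXi_mem_symbolClass ha j) hb).mono (by linarith) le_rfl).add
        ((ih ha (partialXi_mem_symbolClass hb j)).mono (by linarith) le_rfl)

theorem symbolComp_mem_symbolClass (ha : a ∈ symbolClass σ ω m₁ q₁)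
    (hb : b ∈ symbolClass σ ω m₂ q₂) {t : ℝ} (ht : t ∈ Set.Ioo (-2 : ℝ) 2) :
    symbolComp t a b ∈ symbolClass σ ω (m₁ + m₂) (q₁ + q₂) := by
  have := mem_symbolClass_of_leibniz (σ := σ) (ω := ω) (Q := symbolComp t) (d := 0)
    (fun ha hb => by
      obtain ⟨C, hC, h⟩ := symbolComp_bound ha hb
      refine ⟨C, hC, fun x ξ => ?_⟩
      simpa using h t ⟨ht.1.le, ht.2.le⟩ x ξ)
    (fun ha hb => differentiable_symbolComp ha hb ht)
    (fun ha hb => partialX_symbolComp ha hb ht) (fun ha hb => partialXi_symbolComp ha hb ht) ha hb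
  simpa using this

theorem sub_mem_symbolClass (ha : a ∈ symbolClass σ ω m q) (ha' : a' ∈ symbolClass σ ω m q) :
    a - a' ∈ symbolClass σ ω m q := by
  have := add_mem_symbolClass ha (smul_mem_symbolClass ha' (-1))
  rwa [neg_one_smul, ← sub_eq_add_neg] at this

theorem psiDO_zero (f : 𝔼 → ℂ) : psiDO 0 f = 0 := by
  funext x
  simp [psiDO]

theorem psiDO_add (ha : a ∈ symbolClass σ ω m q) (ha' : a' ∈ symbolClass σ ω m q) (f : 𝓢(𝔼, ℂ)) :
    psiDO (a + a') f = psiDO a f + psiDO a' f := by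
  rw [psiDO_eq_oscInt, add_mul]
  exact oscInt_add (mul_schwartz_mem_symbolClass ha (𝓕 f) (-((n : ℝ) + 1)))
    (mul_schwartz_mem_symbolClass ha' (𝓕 f) _) le_rfl

theorem psiDO_sub (ha : a ∈ symbolClass σ ω m q) (ha' : a' ∈ symbolClass σ ω m q) (f : 𝓢(𝔼, ℂ)) :
    psiDO (a - a') f = psiDO a f - psiDO a' f := by
  rw [eq_sub_iff_add_eq, ← psiDO_add (sub_mem_symbolClass ha ha') ha', sub_add_cancel]

/-- The Fourier inversion formula. -/
theorem psiDO_one (g : 𝓢(𝔼, ℂ)) : psiDO 1 g = g := by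
  funext x
  have h := congrArg (fun f : 𝓢(𝔼, ℂ) => f x)
    (FourierTransform.fourierInv_fourier_eq (F := 𝓢(𝔼, ℂ)) g)
  simp only [SchwartzMap.fourierInv_coe, SchwartzMap.fourier_coe] at h
  rw [← h, Real.fourierInv_eq', psiDO]
  refine integral_congr_ae (Filter.Eventually.of_forall fun ξ => ?_)
  simp only [Pi.one_apply, one_mul, smul_eq_mul, real_inner_comm x ξ]
  rw [mul_comm]
  congr 2
  push_cast
  ring

/-- A continuous symbol is determined by its operator, because every Schwartz function is a
Fourier transform. -/
theorem eq_of_psiDO_eq (hc : Continuous c) (hc' : Continuous c')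
    (h : ∀ f : 𝓢(𝔼, ℂ), psiDO c f = psiDO c' f) : c = c' := by
  funext ⟨x, ξ⟩
  set e : 𝔼 → ℂ := fun ξ => Complex.exp (2 * Real.pi * Complex.I * (inner ℝ x ξ : ℝ)) with he
  have hec : Continuous e := by fun_prop
  have h1 : Continuous fun ξ => c (x, ξ) * e ξ := by fun_prop
  have h2 : Continuous fun ξ => c' (x, ξ) * e ξ := by fun_prop
  have h3 := ae_eq_of_integral_contDiff_smul_eq (μ := volume) h1.locallyIntegrable
    h2.locallyIntegrable fun g hg hgs => by
      have hs : HasCompactSupport fun y => (g y : ℂ) := hgs.comp_left (g := Complex.ofReal) rfl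
      have hd : ContDiff ℝ (⊤ : ℕ∞) fun y => (g y : ℂ) := Complex.ofRealCLM.contDiff.comp hg
      have h4 := congrFun (h (𝓕⁻ (hs.toSchwartzMap hd))) x
      have h5 := FourierTransform.fourier_fourierInv_eq (F := 𝓢(𝔼, ℂ)) (hs.toSchwartzMap hd)
      have h6 : 𝓕 (⇑(𝓕⁻ (hs.toSchwartzMap hd) : 𝓢(𝔼, ℂ))) = fun y => (g y : ℂ) := by
        rw [← SchwartzMap.fourier_coe, h5]; rfl
      simp only [psiDO, h6] at h4
      simp only [Complex.real_smul]
      convert h4 using 3 <;> ring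
  have h7 := congrFun ((Continuous.ae_eq_iff_eq volume h1 h2).mp h3) ξ
  exact mul_right_cancel₀ (Complex.exp_ne_zero _) h7

/-- The symbolic form of `D_j Ψ_b = Ψ_{ξ_j b + D_j b}`, on the Fourier side. -/
theorem fourier_psiDO (hb : b ∈ symbolClass σ ω m q) (f : 𝓢(𝔼, ℂ)) (j : Fin n) (ξ : 𝔼) :
    𝓕 (psiDO (coordXi j * b + dX j b) f) ξ = ξ j * 𝓕 (psiDO b f) ξ := by
  have hc := fun m => mul_schwartz_mem_symbolClass hb (𝓕 f) m
  set u : 𝔼 × 𝔼 → ℂ := fun z => 𝓕 f z.2 with hu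
  have hud : Differentiable ℝ u :=
    differentiable_of_mem_symbolClass (schwartz_mem_symbolClass (σ := 0) (ω := 0) (𝓕 f) 0)
  have hu0 : ∀ i, partialX i u = 0 := fun i => by
    funext z
    have : HasFDerivAt u (fderiv ℝ (⇑(𝓕 f : 𝓢(𝔼, ℂ))) z.2 ∘L ContinuousLinearMap.snd ℝ 𝔼 𝔼) z :=
      ((𝓕 f).differentiableAt.hasFDerivAt).comp z hasFDerivAt_snd
    simp [partialX, this.fderiv]
  have e : ∀ i, (coordXi i * b + dX i b) * u = coordXi i * (b * u) + dX i (b * u) := fun i => by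
    rw [dX, dX, partialX_mul (differentiable_of_mem_symbolClass hb) hud, hu0, mul_zero, add_zero,
      add_mul, mul_assoc, smul_mul_assoc]
  have h1 : ∀ i, Integrable fun x => 2 * Real.pi * Complex.I *
      oscInt (coordXi i * (b * u) + dX i (b * u)) x := fun i => by
    obtain ⟨g, hg⟩ := exists_schwartz_eq_oscInt (c := coordXi i * (b * u) + dX i (b * u))
      (σ := σ) (ω := ω) (q := q) fun m => by
        simpa using coordXi_mul_add_dX_mem (hc (m - 1)) i
    rw [← hg]
    exact g.integrable.const_mul _
  obtain ⟨g, hg⟩ := exists_schwartz_eq_oscInt hc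
  have h2 := fourier_partial (hg ▸ g.integrable)
    (fun x => hasFDerivAt_oscInt (hc _) le_rfl x) h1 j ξ
  rw [fourier_const_mul_apply, mul_assoc _ (ξ j : ℂ)] at h2
  have h3 := mul_left_cancel₀ Complex.two_pi_I_ne_zero h2
  exact (congrArg (fun A => 𝓕 (oscInt A) ξ) (e j)).trans h3

theorem psiDO_coordXi_mul (a : 𝔼 × 𝔼 → ℂ) (hb : b ∈ symbolClass σ ω m q) (f : 𝓢(𝔼, ℂ))
    (j : Fin n) :
    psiDO (coordXi j * a) (psiDO b f) = psiDO a (psiDO (coordXi j * b + dX j b) f) := by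
  funext x
  refine integral_congr_ae (Filter.Eventually.of_forall fun ξ => ?_)
  simp only [fourier_psiDO hb f j ξ, Pi.mul_apply, coordXi]
  ring

/-- Translation in frequency is modulation of the kernel. -/
theorem fiberKernel_translate (a : 𝔼 × 𝔼 → ℂ) (x ξ y : 𝔼) :
    fiberKernel a 1 (1, (x, ξ)) y =
      fiberKernel a 1 (1, (x, 0)) y *
        Complex.exp (2 * Real.pi * Complex.I * (inner ℝ y ξ : ℝ)) := by
  rw [fiberKernel, fiberKernel, Real.fourier_eq', Real.fourier_eq', ← integral_mul_const]
  rw [← integral_add_left_eq_self _ (-ξ)]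
  refine integral_congr_ae (Filter.Eventually.of_forall fun η => ?_)
  simp only [fiberAmp, one_smul, zero_add, Pi.one_apply, mul_one, smul_eq_mul, inner_add_left,
    inner_neg_left, add_neg_cancel_left, real_inner_comm ξ y]
  rw [mul_right_comm (Complex.exp _), ← Complex.exp_add]
  congr 2
  push_cast
  ring

/-- For integrable symbols, `Ψ_a` is an integral operator with a rapidly decreasing kernel. -/
theorem psiDO_eq_integral_kernel (ha : a ∈ symbolClass σ ω m q) (hm : m ≤ -((n : ℝ) + 1))
    (g : 𝓢(𝔼, ℂ)) (x : 𝔼) :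
    psiDO a g x = ∫ y, fiberKernel a 1 (1, (x, 0)) y * g (x + y) := by
  have hG := integrable_oscInt ha hm x
  have h1 := VectorFourier.integral_fourierIntegral_smul_eq_flip (μ := volume) (ν := volume)
    (L := innerₗ 𝔼) Real.continuous_fourierChar (by exact continuous_inner) g.integrable hG
  rw [flip_innerₗ] at h1
  have h2 : psiDO a g x = ∫ ξ, VectorFourier.fourierIntegral Real.fourierChar volume (innerₗ 𝔼)
      g ξ • (a (x, ξ) * Complex.exp (2 * Real.pi * Complex.I * (inner ℝ x ξ : ℝ))) := by
    refine integral_congr_ae (Filter.Eventually.of_forall fun ξ => ?_)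
    simp only [smul_eq_mul]
    rw [mul_right_comm, mul_comm]
    rfl
  rw [h2, h1, ← integral_add_left_eq_self _ x]
  refine integral_congr_ae (Filter.Eventually.of_forall fun y => ?_)
  simp only [smul_eq_mul]
  rw [mul_comm, fiberKernel, Real.fourier_eq']
  congr 1
  refine integral_congr_ae (Filter.Eventually.of_forall fun ξ => ?_)
  simp only [fiberAmp, one_smul, zero_add, Pi.one_apply, mul_one, smul_eq_mul,
    Circle.smul_def, Real.fourierChar_apply, innerₗ_apply_apply, inner_add_right]
  rw [mul_left_comm, ← Complex.exp_add, mul_comm, real_inner_comm x ξ]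
  congr 2
  push_cast
  ring

/-- The composition formula for integrable first symbols, by Fubini's theorem. -/
theorem psiDO_psiDO_of_order_le (ha : a ∈ symbolClass σ ω m₁ q₁) (hm : m₁ ≤ -((n : ℝ) + 1))
    (hb : b ∈ symbolClass σ ω m₂ q₂) (f : 𝓢(𝔼, ℂ)) :
    psiDO a (psiDO b f) = psiDO (symbolComp 1 a b) f := by
  funext x
  obtain ⟨g, hg⟩ := exists_schwartz_eq_psiDO hb f
  have hT := admissible_singleton_one hm le_rfl
  have hc := mul_schwartz_mem_symbolClass hb (𝓕 f) (-((n : ℝ) + 1))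
  set K := fiberKernel a 1 (1, (x, 0)) with hK
  have hKc : Continuous K := continuous_fiberKernel ha one_mem_symbolClass hT rfl
  have hbc := hb.1.continuous
  have huc : Continuous (𝓕 (f : 𝔼 → ℂ)) := (𝓕 f).continuous
  set F : 𝔼 → 𝔼 → ℂ := fun y ξ => K y * (b (x + y, ξ) * 𝓕 (f : 𝔼 → ℂ) ξ *
    Complex.exp (2 * Real.pi * Complex.I * (inner ℝ (x + y) ξ : ℝ))) with hF
  have hint : Integrable (Function.uncurry F) (volume.prod volume) := by
    obtain ⟨C, hC, h1⟩ := fiberKernel_decay ha one_mem_symbolClass hT (|q₂| + (n + 1))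
    obtain ⟨D, hD, h2⟩ := symbolClass_bound hc
    obtain ⟨M, hM, h3⟩ := exists_bracket_inner_add_rpow_le σ ω q₂
    set A := C * bracket (inner ℝ σ x + ω) ^ q₁ with hA
    set B := D * (M * bracket (inner ℝ σ x + ω) ^ q₂) with hB
    have hA0 : 0 < A := mul_pos hC (bracket_rpow_pos _ _)
    have hB0 : 0 < B := mul_pos hD (mul_pos hM (bracket_rpow_pos _ _))
    refine ((integrable_bracket_decay.const_mul A).mul_prod
      (integrable_bracket_decay.const_mul B)).mono' ?_ (Filter.Eventually.of_forall fun p => ?_)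
    · refine Continuous.aestronglyMeasurable ?_
      unfold Function.uncurry
      fun_prop
    · obtain ⟨y, ξ⟩ := p
      have h4 := h1 (1, (x, 0)) rfl y
      rw [show bracket (0 : 𝔼) = 1 by simp [bracket], Real.one_rpow, mul_one] at h4
      have h5 := h2 (x + y) ξ
      have h6 := h3 x y
      have h7 := bracket_rpow_pos y (-(|q₂| + ((n : ℝ) + 1)))
      have h8 := bracket_rpow_pos ξ (-((n : ℝ) + 1))
      calc ‖F y ξ‖ = ‖K y‖ * ‖b (x + y, ξ) * 𝓕 (f : 𝔼 → ℂ) ξ‖ := by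
            simp only [hF, norm_mul, norm_exp_two_pi_I_mul, mul_one]
        _ ≤ (A * bracket y ^ (-(|q₂| + ((n : ℝ) + 1)))) *
            (D * bracket (inner ℝ σ (x + y) + ω) ^ q₂ * bracket ξ ^ (-((n : ℝ) + 1))) :=
          mul_le_mul h4 ((congrArg norm rfl).trans_le h5) (norm_nonneg _) (by positivity)
        _ ≤ (A * bracket y ^ (-(|q₂| + ((n : ℝ) + 1)))) *
            (D * (M * (bracket (inner ℝ σ x + ω) ^ q₂ * bracket y ^ |q₂|)) *
              bracket ξ ^ (-((n : ℝ) + 1))) := by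
          refine mul_le_mul_of_nonneg_left ?_ (by positivity)
          refine mul_le_mul_of_nonneg_right ?_ h8.le
          exact mul_le_mul_of_nonneg_left h6 hD.le
        _ = A * (bracket y ^ (-(|q₂| + ((n : ℝ) + 1))) * bracket y ^ |q₂|) *
            (B * bracket ξ ^ (-((n : ℝ) + 1))) := by rw [hB]; ring
        _ = _ := by
          rw [← bracket_rpow_add]
          congr 3
          ring
  rw [← hg, psiDO_eq_integral_kernel ha hm, hg]
  calc ∫ y, K y * psiDO b f (x + y) = ∫ y, ∫ ξ, F y ξ := by
        simp only [psiDO, hF, ← integral_const_mul]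
    _ = ∫ ξ, ∫ y, F y ξ := integral_integral_swap hint
    _ = _ := by
      refine integral_congr_ae (Filter.Eventually.of_forall fun ξ => ?_)
      simp only
      rw [symbolComp_eq_regComp (M := 0) ha hb (T := {1}) (s := |m₁|) (by simpa using hT) rfl,
        regComp, Function.iterate_zero, id, pow_zero, weightedComp, ← integral_mul_const,
        ← integral_mul_const]
      refine integral_congr_ae (Filter.Eventually.of_forall fun y => ?_)
      simp only [hF, compIntegrand, fiberKernel_translate a x ξ y, ← hK, inner_add_left]
      push_cast
      rw [mul_add, Complex.exp_add]
      ring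

/-- `Ψ_a Ψ_b` is the pseudo-differential operator with symbol `symbolComp 1 a b`. The case of
integrable symbols `a` is the Fubini computation; the order of `a` is then raised in steps of two
with `a = ⟨ξ⟩⁻² a + ∑ ξ_j² ⟨ξ⟩⁻² a`. -/
theorem psiDO_psiDO (ha : a ∈ symbolClass σ ω m₁ q₁) (hb : b ∈ symbolClass σ ω m₂ q₂)
    (f : 𝓢(𝔼, ℂ)) : psiDO a (psiDO b f) = psiDO (symbolComp 1 a b) f := by
  have h1 : (1 : ℝ) ∈ Set.Ioo (-2 : ℝ) 2 := by norm_num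
  have h1' : (1 : ℝ) ∈ Set.Icc (-2 : ℝ) 2 := by norm_num
  obtain ⟨k, hk⟩ := exists_nat_ge (m₁ + n + 1)
  replace hk : m₁ ≤ -((n : ℝ) + 1) + 2 * k := by
    have : (0 : ℝ) ≤ k := Nat.cast_nonneg k
    linarith
  induction k generalizing a b m₁ m₂ with
  | zero => exact psiDO_psiDO_of_order_le ha (by simpa using hk) hb f
  | succ k ih =>
    have ha' : invBracketSq * a ∈ symbolClass σ ω (m₁ - 2) q₁ :=
      symbolClass_mono (mul_mem_symbolClass invBracketSq_mem_symbolClass ha) (by linarith) (by simp)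
    set a' := invBracketSq * a with ha'_def
    have hx : ∀ j, coordXi j * (coordXi j * a') ∈ symbolClass σ ω m₁ q₁ := fun j =>
      symbolClass_mono (coordXi_mul_mem_symbolClass (coordXi_mul_mem_symbolClass ha' j) j)
        (by linarith) le_rfl
    have hk' : m₁ - 2 ≤ -((n : ℝ) + 1) + 2 * k := by push_cast at hk; linarith
    have hstep : ∀ j, psiDO (coordXi j * (coordXi j * a')) (psiDO b f) =
        psiDO (symbolComp 1 (coordXi j * (coordXi j * a')) b) f := fun j => by
      have hb' := coordXi_mul_add_dX_mem hb j
      rw [psiDO_coordXi_mul _ hb, psiDO_coordXi_mul _ hb',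
        symbolComp_coordXi_mul (coordXi_mul_mem_symbolClass ha' j) hb,
        symbolComp_coordXi_mul ha' hb']
      exact ih ha' (coordXi_mul_add_dX_mem hb' j) hk'
    obtain ⟨g, hg⟩ := exists_schwartz_eq_psiDO hb f
    have hadd : ∀ {d e}, d ∈ symbolClass σ ω m₁ q₁ → e ∈ symbolClass σ ω m₁ q₁ →
        psiDO d (psiDO b f) = psiDO (symbolComp 1 d b) f →
        psiDO e (psiDO b f) = psiDO (symbolComp 1 e b) f →
        psiDO (d + e) (psiDO b f) = psiDO (symbolComp 1 (d + e) b) f := by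
      intro d e hd he h h'
      rw [symbolComp_add_left hd he hb h1', psiDO_add (symbolComp_mem_symbolClass hd hb h1)
        (symbolComp_mem_symbolClass he hb h1), ← h, ← h', ← hg, psiDO_add hd he]
    have hzero : psiDO 0 (psiDO b f) = psiDO (symbolComp 1 0 b) f := by
      have h0 := symbolComp_add_left (zero_mem_symbolClass (σ := σ) (ω := ω) (m := m₁) (q := q₁))
        zero_mem_symbolClass hb h1'
      rw [add_zero, left_eq_add] at h0
      rw [h0, psiDO_zero, psiDO_zero]
    have hsum : (∑ j, coordXi j * (coordXi j * a')) ∈ symbolClass σ ω m₁ q₁ ∧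
        psiDO (∑ j, coordXi j * (coordXi j * a')) (psiDO b f) =
          psiDO (symbolComp 1 (∑ j, coordXi j * (coordXi j * a')) b) f :=
      Finset.sum_induction _ (fun d => d ∈ symbolClass σ ω m₁ q₁ ∧
          psiDO d (psiDO b f) = psiDO (symbolComp 1 d b) f)
        (fun d e hd he => ⟨add_mem_symbolClass hd.1 he.1, hadd hd.1 he.1 hd.2 he.2⟩)
        ⟨zero_mem_symbolClass, hzero⟩ fun j _ => ⟨hx j, hstep j⟩
    have e : a = a' + ∑ j, coordXi j * (coordXi j * a') := by
      have := congrArg (· * a) (invBracketSq_add_sum (n := n))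
      simp only [add_mul, Finset.sum_mul, one_mul, mul_assoc] at this
      exact this.symm
    have h := hadd (symbolClass_mono ha' (by linarith) le_rfl) hsum.1 (ih ha' hb hk') hsum.2
    rwa [← e] at h

/-- Since `Ψ_1` is the identity, composing with it does not change the symbol. -/
theorem symbolComp_one_one_left (hb : b ∈ symbolClass σ ω m₂ q₂) : symbolComp 1 1 b = b := by
  have h1 := one_mem_symbolClass (σ := σ) (ω := ω)
  refine eq_of_psiDO_eq (differentiable_symbolComp h1 hb (by norm_num)).continuous
    hb.1.continuous fun f => ?_
  obtain ⟨g, hg⟩ := exists_schwartz_eq_psiDO hb f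
  rw [← psiDO_psiDO h1 hb, ← hg, psiDO_one]

/-- At `t = 0` the amplitude no longer depends on `η`, and `symbolComp` is the product. -/
theorem symbolComp_zero (ha : a ∈ symbolClass σ ω m₁ q₁) (hb : b ∈ symbolClass σ ω m₂ q₂) :
    symbolComp 0 a b = a * b := by
  obtain ⟨M, hM⟩ := exists_nat_ge (|m₁| + n + 1)
  have hM0 : (0 : ℝ) ≤ M := Nat.cast_nonneg M
  have hT : Admissible n (Set.Icc (-2) 2) m₁ (-(2 * M)) m₁ := admissible_Icc (by linarith)
  have hT' : Admissible n (Set.Icc (-2) 2) 0 (-(2 * M)) 0 :=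
    admissible_Icc (by rw [abs_zero]; linarith [abs_nonneg m₁])
  funext z
  have h1 := congrFun (symbolComp_one_one_left hb) z
  rw [symbolComp_eq_regComp (q₁ := 0) one_mem_symbolClass hb hT' (by norm_num)] at h1
  rw [symbolComp_eq_regComp ha hb hT (by norm_num), Pi.mul_apply, ← h1, regComp, regComp,
    weightedComp, weightedComp, ← integral_const_mul]
  refine integral_congr_ae (Filter.Eventually.of_forall fun y => ?_)
  simp only [compIntegrand, fiberKernel]
  rw [← mul_assoc, ← fourier_const_mul_apply]
  congr 1
  exact congrArg (fun A : 𝔼 → ℂ => 𝓕 A y) (funext fun η => by simp [fiberAmp])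

end Composition

/-! ### The asymptotic expansion -/

section Expansion

variable {n : ℕ}

local notation "𝔼" => EuclideanSpace ℝ (Fin n)

variable {m m₁ m₂ q q₁ q₂ : ℝ} {σ : EuclideanSpace ℝ (Fin n)} {ω : ℝ}
  {a a' b c c' : EuclideanSpace ℝ (Fin n) × EuclideanSpace ℝ (Fin n) → ℂ}

/-- The `k`-th power of the bidifferential operator `∑ j, ∂_{ξ_j} ⊗ D_{x_j}` applied to `(a, b)`,
evaluated on the diagonal. It is the `k`-th `t`-derivative of `symbolComp t a b` at `t = 0`. -/
noncomputable def bidiffPow : ℕ → (𝔼 × 𝔼 → ℂ) → (𝔼 × 𝔼 → ℂ) → 𝔼 × 𝔼 → ℂ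
  | 0, a, b => a * b
  | k + 1, a, b => ∑ j, bidiffPow k (partialXi j a) (dX j b)

theorem bidiffPow_mem_symbolClass (ha : a ∈ symbolClass σ ω m₁ q₁)
    (hb : b ∈ symbolClass σ ω m₂ q₂) (k : ℕ) :
    bidiffPow k a b ∈ symbolClass σ ω (m₁ + m₂ - k) (q₁ + q₂ - k) := by
  induction k generalizing a b m₁ q₂ with
  | zero => simpa [bidiffPow] using mul_mem_symbolClass ha hb
  | succ k ih =>
    refine sum_mem_symbolClass _ fun j => symbolClass_mono
      (ih (partialXi_mem_symbolClass ha j) (dX_mem_symbolClass hb j)) ?_ ?_ <;>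
    · push_cast; linarith

theorem partialX_bidiffPow (ha : a ∈ symbolClass σ ω m₁ q₁)
    (hb : b ∈ symbolClass σ ω m₂ q₂) (k : ℕ) (i : Fin n) :
    partialX i (bidiffPow k a b) =
      bidiffPow k (partialX i a) b + bidiffPow k a (partialX i b) := by
  induction k generalizing a b m₁ q₂ with
  | zero =>
    exact partialX_mul (differentiable_of_mem_symbolClass ha)
      (differentiable_of_mem_symbolClass hb) i
  | succ k ih =>
    simp only [bidiffPow]
    rw [partialX_sum _ fun j => differentiable_of_mem_symbolClass (bidiffPow_mem_symbolClass
      (partialXi_mem_symbolClass ha j) (dX_mem_symbolClass hb j) k), ← Finset.sum_add_distrib]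
    refine Finset.sum_congr rfl fun j _ => ?_
    rw [ih (partialXi_mem_symbolClass ha j) (dX_mem_symbolClass hb j), partialX_dX hb.1,
      partialXi_partialX_comm ha.1]

theorem partialXi_bidiffPow (ha : a ∈ symbolClass σ ω m₁ q₁)
    (hb : b ∈ symbolClass σ ω m₂ q₂) (k : ℕ) (i : Fin n) :
    partialXi i (bidiffPow k a b) =
      bidiffPow k (partialXi i a) b + bidiffPow k a (partialXi i b) := by
  induction k generalizing a b m₁ q₂ with
  | zero =>
    exact partialXi_mul (differentiable_of_mem_symbolClass ha)
      (differentiable_of_mem_symbolClass hb) i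
  | succ k ih =>
    simp only [bidiffPow]
    rw [partialXi_sum _ fun j => differentiable_of_mem_symbolClass (bidiffPow_mem_symbolClass
      (partialXi_mem_symbolClass ha j) (dX_mem_symbolClass hb j) k), ← Finset.sum_add_distrib]
    refine Finset.sum_congr rfl fun j _ => ?_
    rw [ih (partialXi_mem_symbolClass ha j) (dX_mem_symbolClass hb j), partialXi_dX hb.1,
      partialXi_partialXi_comm ha.1]

/-- The Taylor remainder of `t ↦ symbolComp t a b` at `t = 0`. -/
noncomputable def compRemainder (N : ℕ) (t : ℝ) (a b : 𝔼 × 𝔼 → ℂ) : 𝔼 × 𝔼 → ℂ :=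
  symbolComp t a b - ∑ k ∈ Finset.range N, ((t ^ k / k.factorial : ℝ) : ℂ) • bidiffPow k a b

theorem compRemainder_apply (N : ℕ) (t : ℝ) (a b : 𝔼 × 𝔼 → ℂ) (z : 𝔼 × 𝔼) :
    compRemainder N t a b z = symbolComp t a b z -
      ∑ k ∈ Finset.range N, ((t ^ k / k.factorial : ℝ) : ℂ) * bidiffPow k a b z := by
  simp [compRemainder, Finset.sum_apply]

theorem compRemainder_succ_zero (ha : a ∈ symbolClass σ ω m₁ q₁)
    (hb : b ∈ symbolClass σ ω m₂ q₂) (N : ℕ) (z : 𝔼 × 𝔼) : compRemainder (N + 1) 0 a b z = 0 := by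
  rw [compRemainder_apply, Finset.sum_range_succ', symbolComp_zero ha hb]
  simp [bidiffPow]

/-- The remainders form a ladder: the derivative of one is the previous one for the symbols
`∂_{ξ_j} a` and `D_{x_j} b`. -/
theorem hasDerivAt_compRemainder (ha : a ∈ symbolClass σ ω m₁ q₁)
    (hb : b ∈ symbolClass σ ω m₂ q₂) {t : ℝ} (ht : t ∈ Set.Ioo (-2 : ℝ) 2) (N : ℕ) (z : 𝔼 × 𝔼) :
    HasDerivAt (fun t => compRemainder (N + 1) t a b z)
      (∑ j, compRemainder N t (partialXi j a) (dX j b) z) t := by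
  have h1 : ∀ k : ℕ, HasDerivAt
      (fun t : ℝ => ((t ^ (k + 1) / (k + 1).factorial : ℝ) : ℂ) * bidiffPow (k + 1) a b z)
      (((t ^ k / k.factorial : ℝ) : ℂ) * bidiffPow (k + 1) a b z) t := by
    intro k
    have h : HasDerivAt (fun t : ℝ => t ^ (k + 1) / (k + 1).factorial) (t ^ k / k.factorial) t := by
      refine ((hasDerivAt_pow (k + 1) t).div_const _).congr_deriv ?_
      have hk : (k.factorial : ℝ) ≠ 0 := by exact_mod_cast k.factorial_ne_zero
      rw [Nat.factorial_succ]
      push_cast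
      field_simp
    exact h.ofReal_comp.mul_const _
  have h2 := (hasDerivAt_symbolComp ha hb ht z).sub
    ((HasDerivAt.fun_sum (u := Finset.range N) fun k _ => h1 k).add_const (bidiffPow 0 a b z))
  refine (h2.congr_deriv ?_).congr_of_eventuallyEq (Filter.Eventually.of_forall fun t => ?_)
  · simp only [compRemainder_apply, Finset.sum_sub_distrib]
    rw [Finset.sum_comm]
    simp only [← Finset.mul_sum, bidiffPow, Finset.sum_apply]
  · simp only [compRemainder_apply, Finset.sum_range_succ', Pi.sub_apply]
    simp

/-- Each Taylor coefficient that is subtracted improves both orders by one. -/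
theorem compRemainder_bound (ha : a ∈ symbolClass σ ω m₁ q₁) (hb : b ∈ symbolClass σ ω m₂ q₂)
    (N : ℕ) : ∃ C : ℝ, 0 < C ∧ ∀ t ∈ Set.Icc (0 : ℝ) 1, ∀ x ξ : 𝔼,
      ‖compRemainder N t a b (x, ξ)‖ ≤
        C * bracket (inner ℝ σ x + ω) ^ (q₁ + q₂ - N) * bracket ξ ^ (m₁ + m₂ - N) := by
  induction N generalizing a b m₁ q₂ with
  | zero =>
    obtain ⟨C, hC, h⟩ := symbolComp_bound ha hb
    refine ⟨C, hC, fun t ht x ξ => ?_⟩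
    simpa [compRemainder] using h t ⟨by linarith [ht.1], by linarith [ht.2]⟩ x ξ
  | succ N ih =>
    choose C hC h using fun j =>
      ih (partialXi_mem_symbolClass ha j) (dX_mem_symbolClass hb j)
    have hS := Finset.sum_nonneg fun j (_ : j ∈ Finset.univ) => (hC j).le
    refine ⟨∑ j, C j + 1, by linarith, fun t ht x ξ => ?_⟩
    have hW := mul_pos (bracket_rpow_pos (inner ℝ σ x + ω) (q₁ + q₂ - (N + 1 : ℕ)))
      (bracket_rpow_pos ξ (m₁ + m₂ - (N + 1 : ℕ)))
    have hI : Set.Icc (0 : ℝ) 1 ⊆ Set.Ioo (-2) 2 := fun s hs =>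
      ⟨by linarith [hs.1], by linarith [hs.2]⟩
    -- The mean value inequality on `[0, 1]`, for a remainder that vanishes at `t = 0`.
    have key := norm_image_sub_le_of_norm_deriv_le_segment' (a := 0) (b := 1)
      (f := fun t => compRemainder (N + 1) t a b (x, ξ))
      (C := (∑ j, C j) * (bracket (inner ℝ σ x + ω) ^ (q₁ + q₂ - (N + 1 : ℕ)) *
        bracket ξ ^ (m₁ + m₂ - (N + 1 : ℕ))))
      (fun s hs => (hasDerivAt_compRemainder ha hb (hI hs) N (x, ξ)).hasDerivWithinAt)
      (fun s hs => by
        rw [Finset.sum_mul]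
        refine (norm_sum_le _ _).trans (Finset.sum_le_sum fun j _ => ?_)
        refine (h j s ⟨hs.1, hs.2.le⟩ x ξ).trans_eq ?_
        rw [mul_assoc]
        push_cast
        congr 3 <;> ring) t ht
    rw [compRemainder_succ_zero ha hb, sub_zero, sub_zero] at key
    calc _ ≤ _ := key
      _ ≤ (∑ j, C j) * (bracket (inner ℝ σ x + ω) ^ (q₁ + q₂ - (N + 1 : ℕ)) *
        bracket ξ ^ (m₁ + m₂ - (N + 1 : ℕ))) := mul_le_of_le_one_right (by positivity) ht.2
      _ ≤ _ := by rw [mul_assoc]; gcongr; linarith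

theorem differentiable_smul_bidiffPow (ha : a ∈ symbolClass σ ω m₁ q₁)
    (hb : b ∈ symbolClass σ ω m₂ q₂) (r : ℕ → ℂ) (k : ℕ) : Differentiable ℝ (r k • bidiffPow k a b) :=
  (differentiable_of_mem_symbolClass (bidiffPow_mem_symbolClass ha hb k)).const_smul (r k)

/-- All derivatives of the remainder are covered because it obeys the Leibniz rule. -/
theorem compRemainder_mem_symbolClass (ha : a ∈ symbolClass σ ω m₁ q₁)
    (hb : b ∈ symbolClass σ ω m₂ q₂) (N : ℕ) :
    compRemainder N 1 a b ∈ symbolClass σ ω (m₁ + m₂ - N) (q₁ + q₂ - N) := by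
  have ht : (1 : ℝ) ∈ Set.Ioo (-2 : ℝ) 2 := by norm_num
  set r : ℕ → ℂ := fun k => (((1 : ℝ) ^ k / k.factorial : ℝ) : ℂ) with hr
  have hsum : ∀ {a b : 𝔼 × 𝔼 → ℂ} {m₁ q₁ m₂ q₂ : ℝ}, a ∈ symbolClass σ ω m₁ q₁ →
      b ∈ symbolClass σ ω m₂ q₂ →
      Differentiable ℝ (∑ k ∈ Finset.range N, r k • bidiffPow k a b) := fun ha hb =>
    Differentiable.sum fun k _ => differentiable_smul_bidiffPow ha hb r k
  refine mem_symbolClass_of_leibniz (Q := compRemainder N 1) (d := N) (fun ha hb => ?_)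
    (fun ha hb => (differentiable_symbolComp ha hb ht).sub (hsum ha hb))
    (fun {a b _ _ _ _} ha hb j => ?_) (fun {a b _ _ _ _} ha hb j => ?_) ha hb
  · obtain ⟨C, hC, h⟩ := compRemainder_bound ha hb N
    exact ⟨C, hC, h 1 ⟨zero_le_one, le_rfl⟩⟩
  · have h1 : partialX j (∑ k ∈ Finset.range N, r k • bidiffPow k a b) =
        ∑ k ∈ Finset.range N, r k • bidiffPow k (partialX j a) b +
          ∑ k ∈ Finset.range N, r k • bidiffPow k a (partialX j b) := by
      rw [partialX_sum _ (differentiable_smul_bidiffPow ha hb r), ← Finset.sum_add_distrib]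
      refine Finset.sum_congr rfl fun k _ => ?_
      rw [partialX_smul (differentiable_of_mem_symbolClass (bidiffPow_mem_symbolClass ha hb k)),
        partialX_bidiffPow ha hb, smul_add]
    have h2 : partialX j (compRemainder N 1 a b) = partialX j (symbolComp 1 a b) -
        partialX j (∑ k ∈ Finset.range N, r k • bidiffPow k a b) := by
      funext z
      simp only [partialX, compRemainder]
      rw [fderiv_sub (differentiable_symbolComp ha hb ht z) (hsum ha hb z)]
      rfl
    rw [h2, h1, partialX_symbolComp ha hb ht]
    simp only [compRemainder]
    abel
  · have h1 : partialXi j (∑ k ∈ Finset.range N, r k • bidiffPow k a b) =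
        ∑ k ∈ Finset.range N, r k • bidiffPow k (partialXi j a) b +
          ∑ k ∈ Finset.range N, r k • bidiffPow k a (partialXi j b) := by
      rw [partialXi_sum _ (differentiable_smul_bidiffPow ha hb r), ← Finset.sum_add_distrib]
      refine Finset.sum_congr rfl fun k _ => ?_
      rw [partialXi_smul (differentiable_of_mem_symbolClass (bidiffPow_mem_symbolClass ha hb k)),
        partialXi_bidiffPow ha hb, smul_add]
    have h2 : partialXi j (compRemainder N 1 a b) = partialXi j (symbolComp 1 a b) -
        partialXi j (∑ k ∈ Finset.range N, r k • bidiffPow k a b) := by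
      funext z
      simp only [partialXi, compRemainder]
      rw [fderiv_sub (differentiable_symbolComp ha hb ht z) (hsum ha hb z)]
      rfl
    rw [h2, h1, partialXi_symbolComp ha hb ht]
    simp only [compRemainder]
    abel

end Expansion

/-! ### Multi-index form of the expansion -/

section MultiIndex

variable {n : ℕ}

local notation "𝔼" => EuclideanSpace ℝ (Fin n)

variable {a b : EuclideanSpace ℝ (Fin n) × EuclideanSpace ℝ (Fin n) → ℂ}

theorem derivX_smul (hb : ContDiff ℝ (⊤ : ℕ∞) b) (c : ℂ) (β : Fin n → ℕ) :
    derivX β (c • b) = c • derivX β b :=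
  foldr_iterate_comm (S := {a | ContDiff ℝ (⊤ : ℕ∞) a}) (Q := fun b => c • b)
    (fun j _ hf => contDiff_partialX hf j)
    (fun i f (hf : ContDiff ℝ (⊤ : ℕ∞) f) => partialX_smul (hf.differentiable (by simp)) c i)
    _ β hb

theorem mem_piAntidiag_iff_multiLength {k : ℕ} {β : Fin n → ℕ} :
    β ∈ Finset.piAntidiag Finset.univ k ↔ multiLength β = k := by
  simp [multiLength]

theorem multiFactorial_add_single (β : Fin n → ℕ) (j : Fin n) :
    multiFactorial (β + Pi.single j 1) = (β j + 1) * multiFactorial β := by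
  rw [multiFactorial, multiFactorial, ← Finset.mul_prod_erase _ _ (Finset.mem_univ j),
    ← Finset.mul_prod_erase _ (fun i => (β i).factorial) (Finset.mem_univ j), ← mul_assoc]
  congr 1
  · simp [Nat.factorial_succ]
  · refine Finset.prod_congr rfl fun i hi => ?_
    simp [Finset.ne_of_mem_erase hi]

/-- Reindexing by `γ = β + e_j`, where `1 / β! = γ_j / γ!`. -/
theorem sum_piAntidiag_add_single (k : ℕ) (j : Fin n) (F : (Fin n → ℕ) → ℂ) :
    ∑ β ∈ Finset.piAntidiag Finset.univ k,
        (multiFactorial β : ℂ)⁻¹ * F (β + Pi.single j 1) =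
      ∑ γ ∈ Finset.piAntidiag Finset.univ (k + 1),
        (γ j : ℂ) * ((multiFactorial γ : ℂ)⁻¹ * F γ) := by
  have h : ∀ γ ∈ Finset.piAntidiag Finset.univ (k + 1), γ ∉ Finset.image
      (fun β : Fin n → ℕ => β + Pi.single j 1) (Finset.piAntidiag Finset.univ k) →
      (γ j : ℂ) * ((multiFactorial γ : ℂ)⁻¹ * F γ) = 0 := by
    intro γ hγ hn
    by_cases h0 : γ j = 0
    · simp [h0]
    · refine absurd (Finset.mem_image.mpr ⟨γ - Pi.single j 1, ?_, ?_⟩) hn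
      all_goals
        have e : γ - Pi.single j 1 + Pi.single j 1 = γ := by
          refine tsub_add_cancel_of_le fun i => ?_
          by_cases hi : i = j
          · subst hi; simp; omega
          · simp [hi]
      · rw [mem_piAntidiag_iff_multiLength] at hγ ⊢
        rw [← e, multiLength_add_single] at hγ
        omega
      · exact e
  rw [← Finset.sum_subset (fun γ hγ => ?_) h, Finset.sum_image fun _ _ _ _ h => add_right_cancel h]
  · refine Finset.sum_congr rfl fun β _ => ?_
    rw [multiFactorial_add_single, ← mul_assoc]
    have h1 : ((β j + 1 : ℕ) : ℂ) ≠ 0 := by exact_mod_cast (β j).succ_ne_zero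
    simp only [Pi.add_apply, Pi.single_eq_same, Nat.cast_mul, mul_inv]
    rw [← mul_assoc, mul_inv_cancel₀ h1, one_mul]
  · obtain ⟨β, hβ, rfl⟩ := Finset.mem_image.mp hγ
    rw [mem_piAntidiag_iff_multiLength] at hβ ⊢
    rw [multiLength_add_single, hβ]

/-- The multinomial form of the powers of the bidifferential operator. -/
theorem bidiffPow_eq_sum (ha : ContDiff ℝ (⊤ : ℕ∞) a) (hb : ContDiff ℝ (⊤ : ℕ∞) b) (k : ℕ)
    (z : 𝔼 × 𝔼) : bidiffPow k a b z = k.factorial * ∑ β ∈ Finset.piAntidiag Finset.univ k,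
      (multiFactorial β : ℂ)⁻¹ *
        (((2 * Real.pi * Complex.I) ^ k)⁻¹ * (derivXi β a z * derivX β b z)) := by
  induction k generalizing a b with
  | zero => simp [bidiffPow, multiFactorial]
  | succ k ih =>
    simp only [bidiffPow, Finset.sum_apply]
    have h1 : ∀ j, bidiffPow k (partialXi j a) (dX j b) z = k.factorial *
        ∑ γ ∈ Finset.piAntidiag Finset.univ (k + 1), (γ j : ℂ) * ((multiFactorial γ : ℂ)⁻¹ *
          (((2 * Real.pi * Complex.I) ^ (k + 1))⁻¹ * (derivXi γ a z * derivX γ b z))) := by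
      intro j
      rw [ih (contDiff_partialXi ha j) (contDiff_dX hb j), ← sum_piAntidiag_add_single]
      congr 1
      refine Finset.sum_congr rfl fun β _ => ?_
      rw [derivXi_add_single ha, derivX_add_single hb, dX, derivX_smul (contDiff_partialX hb j),
        pow_succ, mul_inv, Pi.smul_apply, smul_eq_mul]
      ring
    simp only [h1]
    rw [← Finset.mul_sum, Finset.sum_comm, Nat.factorial_succ, Nat.cast_mul,
      mul_comm ((k + 1 : ℕ) : ℂ), mul_assoc (k.factorial : ℂ)]
    refine congrArg _ ?_
    rw [Finset.mul_sum]
    refine Finset.sum_congr rfl fun γ hγ => ?_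
    rw [← Finset.sum_mul, ← mem_piAntidiag_iff_multiLength.mp hγ, multiLength]
    push_cast
    rfl

/-- The sum over `0 < |β| < N`, arranged by the length of `β`. The term `β = 0` may be included
because it vanishes. -/
theorem sum_commutatorTerm (ha : ContDiff ℝ (⊤ : ℕ∞) a) (hb : ContDiff ℝ (⊤ : ℕ∞) b) (N : ℕ) :
    ∑ β ∈ multiIndicesBelow n N, commutatorTerm a b β =
      ∑ k ∈ Finset.range N, (((1 : ℝ) ^ k / k.factorial : ℝ) : ℂ) • bidiffPow k a b -
        ∑ k ∈ Finset.range N, (((1 : ℝ) ^ k / k.factorial : ℝ) : ℂ) • bidiffPow k b a := by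
  rw [← Finset.sum_sub_distrib, ← Finset.sum_fiberwise_of_maps_to (g := multiLength)
    fun β hβ => Finset.mem_range.mpr (mem_multiIndicesBelow.mp hβ).2]
  refine Finset.sum_congr rfl fun k hk => ?_
  have h0 : commutatorTerm a b 0 = 0 := by
    funext z
    simp [commutatorTerm, mul_comm]
  rw [Finset.sum_subset (s₂ := Finset.piAntidiag Finset.univ k)
    (fun β hβ => mem_piAntidiag_iff_multiLength.mpr (Finset.mem_filter.mp hβ).2) fun β hβ hn => ?_]
  · funext z
    have hk : (k.factorial : ℂ) ≠ 0 := by exact_mod_cast k.factorial_ne_zero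
    simp only [Finset.sum_apply, Pi.sub_apply, Pi.smul_apply, smul_eq_mul,
      bidiffPow_eq_sum ha hb, bidiffPow_eq_sum hb ha, one_pow]
    push_cast
    rw [← mul_assoc, ← mul_assoc, one_div, inv_mul_cancel₀ hk, one_mul, one_mul,
      ← Finset.sum_sub_distrib]
    refine Finset.sum_congr rfl fun β hβ => ?_
    rw [commutatorTerm, mem_piAntidiag_iff_multiLength.mp hβ, one_div, mul_inv]
    ring
  · rw [mem_piAntidiag_iff_multiLength] at hβ
    have h1 : multiLength β = 0 := by
      by_contra h1
      refine hn (Finset.mem_filter.mpr ⟨mem_multiIndicesBelow.mpr ⟨Nat.pos_of_ne_zero h1, ?_⟩, hβ⟩)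
      rw [hβ]
      exact Finset.mem_range.mp hk
    have h2 : β = 0 := funext fun i =>
      Finset.sum_eq_zero_iff.mp h1 i (Finset.mem_univ i)
    rw [h2, h0]

end MultiIndex

/-! ### The commutator -/

theorem proposition2p1 (n : ℕ) (σ : EuclideanSpace ℝ (Fin n)) (m₁ m₂ ω q₁ q₂ : ℝ)
    (a b : EuclideanSpace ℝ (Fin n) × EuclideanSpace ℝ (Fin n) → ℂ)
    (ha : a ∈ symbolClass σ ω m₁ q₁) (hb : b ∈ symbolClass σ ω m₂ q₂) :
    -- the operators act on the Schwartz space, so that the compositions below make sense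
    (∀ f : 𝓢(EuclideanSpace ℝ (Fin n), ℂ),
      (∃ g : 𝓢(EuclideanSpace ℝ (Fin n), ℂ), ⇑g = psiDO a f) ∧
      (∃ g : 𝓢(EuclideanSpace ℝ (Fin n), ℂ), ⇑g = psiDO b f)) ∧
    ∃ c ∈ symbolClass σ ω (m₁ + m₂ - 1) (q₁ + q₂ - 1),
      (∀ f : 𝓢(EuclideanSpace ℝ (Fin n), ℂ),
        psiDO a (psiDO b f) - psiDO b (psiDO a f) = psiDO c f) ∧
      ∀ N : ℕ, 2 ≤ N →
        (c - ∑ β ∈ multiIndicesBelow n N, commutatorTerm a b β) ∈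
          symbolClass σ ω (m₁ + m₂ - N) (q₁ + q₂ - N) := by
  have h1 : (1 : ℝ) ∈ Set.Ioo (-2 : ℝ) 2 := by norm_num
  have hab := symbolComp_mem_symbolClass ha hb h1
  have hba := symbolComp_mem_symbolClass hb ha h1
  rw [add_comm m₂, add_comm q₂] at hba
  have key : ∀ N : ℕ, (symbolComp 1 a b - symbolComp 1 b a) -
      ∑ β ∈ multiIndicesBelow n N, commutatorTerm a b β ∈
        symbolClass σ ω (m₁ + m₂ - N) (q₁ + q₂ - N) := by
    intro N
    have hR := compRemainder_mem_symbolClass hb ha N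
    rw [add_comm m₂, add_comm q₂] at hR
    have h := sub_mem_symbolClass (compRemainder_mem_symbolClass ha hb N) hR
    rw [sum_commutatorTerm ha.1 hb.1]
    convert h using 1
    simp only [compRemainder]
    abel
  refine ⟨fun f => ⟨exists_schwartz_eq_psiDO ha f, exists_schwartz_eq_psiDO hb f⟩,
    symbolComp 1 a b - symbolComp 1 b a, ?_, fun f => ?_, fun N _ => key N⟩
  · -- No multi-index satisfies `0 < |β| < 1`.
    have h : multiIndicesBelow n 1 = ∅ := Finset.eq_empty_of_forall_notMem fun β hβ => by
      have := mem_multiIndicesBelow.mp hβ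
      omega
    simpa [h] using key 1
  · rw [psiDO_sub hab hba, psiDO_psiDO ha hb, psiDO_psiDO hb ha]
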